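/- **Setting.** Let $n\ge 1$ and $a_1=c_0<c_1<\dots<c_n<c_{n+1}=a_2$ be real, with $c_j=b_j$ for $1\le j\le n$ (the double points). Let $E=\bigcup_{j\text{ even}}[c_j,c_{j+1}]$ and $J=\bigcup_{j\text{ odd}}[c_j,c_{j+1}]$ ($0\le j\le n$), with interiors $\mathring E,\mathring J$, and let $\chi=1$ on $\mathring E$, $\chi=-1$ on $\mathring J$. For $x$ in $\mathring E\cup\mathring J$ a subscript $+$ (or the argument $x_+$) denotes the boundary value from the upper half-plane. Let $R(z)=(z-a_1)^{1/2}(z-a_2)^{1/2}$, analytic off $[a_1,a_2]$ with $R(z)\sim z$ at $\infty$, and $$\mathfrak g(z)=\frac{R(z)}{2\pi i}\int_{J\cup E}\frac{\chi(\zeta)\,d\zeta}{(\zeta-z)R_+(\zeta)},\qquad \tilde{\mathfrak g}(z)=\frac{R(z)}{2\pi i}\int_{J}\frac{i\pi\,d\zeta}{(\zeta-z)R_+(\zeta)},\qquad \alpha=\Im\tilde{\mathfrak g}(\infty).$$ With the Pauli matrices $\sigma_1,\sigma_3$ and the branch of the fourth root that is analytic off $[a_1,a_2]$ and equals $1$ at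 $\infty$, let $$\Psi(z)=e^{\tilde{\mathfrak g}(\infty)\sigma_3}\Big(\frac{z-a_1}{z-a_2}\Big)^{\sigma_1/4}e^{-\tilde{\mathfrak g}(z)\sigma_3},$$ and let $\Psi=\widehat\Psi+i\breve\Psi$ be its unique decomposition in which $\widehat\Psi,\breve\Psi$ are Schwarz symmetric ($F(z)=\overline{F(\bar z)}$); $\widehat\Psi_k,\breve\Psi_k$ denote the $k$-th columns. For $\lambda\in[-1,1]\setminus\{0\}$ put $\varkappa=-\ln(|\lambda|/2)$, and $$\begin{aligned} &\text{for }x\in\mathring E:&& u(x)=\Re\big[e^{-i\varkappa\Im\mathfrak g(x_+)}\widehat\Psi_{1}(x_+)\big],\quad w(x)=\Re\big[e^{-i\varkappa\Im\mathfrak g(x_+)}\breve\Psi_{1}(x_+)\big],\\ &\text{for }x\in\mathring J:&& u(x)=\Re\big[e^{i\varkappa\Im\mathfrak g(x_+)}\widehat\Psi_{2}(x_+)\big],\quad w(x)=\Re\big[e^{i\varkappa\Im\mathfrak g(x_+)}\breve\Psi_{2}(x_+)\big]. \end{aligned}$$ The leading-order jump kernels of the resolvent are, with $x$ in the interior of the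 set named by the first subscript and $y$ in the interior of the set named by the second one, $$\tilde R_{EJ},\ \tilde R_{JE}=\frac{\det[u(y),w(x)]-\det[u(x),w(y)]}{\frac{i\pi}{4}(x-y)},\qquad \tilde R_{EE},\ \tilde R_{JJ}=\frac{\det[u(y),w(x)]-\det[u(x),w(y)]}{\operatorname{sgn}(\lambda)\frac{i\pi}{4}(x-y)},$$ where the latter two are extended to $x=y$ as limits. **The vectors.** Let $B_n^{1/4}(z)=(z-a_1)^{1/4}(z-a_2)^{-(-1)^n/4}\prod_{j=1}^n(z-b_j)^{(-1)^j/2}$ (principal branches), $B_n^{-1/4}=1/B_n^{1/4}$, and $$\phi_\pm(x;\varkappa)=\Re\big(e^{i\varkappa\Im\mathfrak g(x_+)}B_n^{\pm1/4}(x_+)\big),\qquad \tilde\phi_\pm(x;\varkappa)=\pm\Re\big(e^{-i\varkappa\Im\mathfrak g(x_+)}B_n^{\pm1/4}(x_+)\big).$$ Let $N=\lfloor n/2\rfloor$, $\tilde N=\lceil n/2\rceil$, and $$\vec f^{\,t}=\Big[\tfrac{\phi_-}{x-b_1},\tfrac{\phi_-}{x-b_3},\dots,\tfrac{\phi_-}{x-b_{2\tilde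 N-1}},\tfrac{\phi_+}{x-b_2},\dots,\tfrac{\phi_+}{x-b_{2N}}\Big],\quad \vec h^{\,t}=\Big[\tfrac{\tilde\phi_-}{x-b_1},\tfrac{\tilde\phi_-}{x-b_3},\dots,\tfrac{\tilde\phi_-}{x-b_{2\tilde N-1}},\tfrac{\tilde\phi_+}{x-b_2},\dots,\tfrac{\tilde\phi_+}{x-b_{2N}}\Big].$$ **The matrix.** Let $\nu_j=\arccos\sqrt{(b_j-a_1)/(a_2-a_1)}$ and $$k_j=\begin{cases}\frac12(a_2-a_1)\cos(\nu_j)(\sin\nu_j)^{\frac{1-(-1)^n}{2}}\prod_{l\ne j}(\sin|\nu_l-\nu_j|)^{(-1)^l},& j\text{ odd},\\[2pt] \frac12(a_2-a_1)(\sin\nu_j)^{\frac{1+(-1)^n}{2}}\prod_{l\ne j}(\sin|\nu_l-\nu_j|)^{(-1)^{l+1}},& j\text{ even}.\end{cases}$$ Let $\mathbb M=\operatorname{diag}(\mathbb M_1,\mathbb M_2)$ with blocks of size $\tilde N\times\tilde N$ and $N\times N$, with diagonal entries $$[\mathbb M_1]_{ll}=k_{2l-1}\cos(\nu_{2l-1}-\alpha)-2k_{2l-1}\sum_{j\ne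 l}\frac{k_{2j-1}\sin(\nu_{2l-1}-\nu_{2j-1})}{b_{2j-1}-b_{2l-1}},\qquad [\mathbb M_2]_{ll}=k_{2l}\sin(\nu_{2l}+\alpha)-2k_{2l}\sum_{j\ne l}\frac{k_{2j}\sin(\nu_{2l}-\nu_{2j})}{b_{2j}-b_{2l}},$$ and, for $j\ne l$, off-diagonal entries $$[\mathbb M_1]_{jl}=\frac{2k_{2j-1}k_{2l-1}\sin(\nu_{2j-1}-\nu_{2l-1})}{b_{2l-1}-b_{2j-1}},\qquad [\mathbb M_2]_{jl}=\frac{2k_{2j}k_{2l}\sin(\nu_{2j}-\nu_{2l})}{b_{2l}-b_{2j}}.$$ **Theorem.** Let $\lambda\in[-1,1]\setminus\{0\}$ and $\varkappa=-\ln(|\lambda|/2)$. 1. For $x,y\in\mathring E$: $\tilde R_{EE}(x,y;\lambda)=\operatorname{sgn}(\lambda)\frac{4}{i\pi}\vec h^{\,t}(y;\varkappa)\,\mathbb M\,\vec h(x;\varkappa)$. 2. For $x\in\mathring E$, $y\in\mathring J$: $\tilde R_{EJ}(x,y;\lambda)=\frac{4}{i\pi}\vec f^{\,t}(y;\varkappa)\,\mathbb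 M\,\vec h(x;\varkappa)$. 3. For $x\in\mathring J$, $y\in\mathring E$: $\tilde R_{JE}(x,y;\lambda)=\frac{4}{i\pi}\vec h^{\,t}(y;\varkappa)\,\mathbb M\,\vec f(x;\varkappa)$. 4. For $x,y\in\mathring J$: $\tilde R_{JJ}(x,y;\lambda)=\operatorname{sgn}(\lambda)\frac{4}{i\pi}\vec f^{\,t}(y;\varkappa)\,\mathbb M\,\vec f(x;\varkappa)$. -/

import Mathlib

open Real Set Filter Topology

noncomputable section

namespace JumpKernel

/-- The configuration: one interval `[a₁, a₂]` with `n ≥ 1` double points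
`b 1 < ⋯ < b n` in `(a₁, a₂)`. The values `b j` for `j = 0` and `j > n` are never used. -/
structure Config where
  n : ℕ
  one_le_n : 1 ≤ n
  a₁ : ℝ
  a₂ : ℝ
  b : ℕ → ℝ
  a₁_lt : a₁ < b 1
  lt_a₂ : b n < a₂
  b_lt : ∀ j, 1 ≤ j → j < n → b j < b (j + 1)

/-- The boundary value `f(x₊)` of `f` at the point `x` of the real line, which is oriented from
left to right: the limit of `f z` as `z` tends to `x` in the open upper half-plane. -/
def plus (f : ℂ → ℂ) (x : ℝ) : ℂ :=
  limUnder (𝓝[{z : ℂ | 0 < z.im}] (x : ℂ)) f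

/-- `β ^ σ₁`, where `σ₁` is the first Pauli matrix:
`cosh (ln β) 1 + sinh (ln β) σ₁`. -/
def powSigma1 (β : ℂ) : Matrix (Fin 2) (Fin 2) ℂ :=
  !![(β + β⁻¹) / 2, (β - β⁻¹) / 2; (β - β⁻¹) / 2, (β + β⁻¹) / 2]

/-- `e ^ (w σ₃)`, where `σ₃` is the third Pauli matrix. -/
def expSigma3 (w : ℂ) : Matrix (Fin 2) (Fin 2) ℂ :=
  !![Complex.exp w, 0; 0, Complex.exp (-w)]

namespace Config

variable (d : Config)

/-- The points `a₁ = c 0 < c 1 = b 1 < ⋯ < c n = b n < c (n + 1) = a₂`. -/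
def c (j : ℕ) : ℝ :=
  if j = 0 then d.a₁ else if j ≤ d.n then d.b j else d.a₂

/-- `E = [a₁, b 1] ∪ [b 2, b 3] ∪ ⋯`. -/
def E : Set ℝ := ⋃ j ∈ {j : ℕ | j ≤ d.n ∧ Even j}, Icc (d.c j) (d.c (j + 1))

/-- `J = [b 1, b 2] ∪ [b 3, b 4] ∪ ⋯`. -/
def J : Set ℝ := ⋃ j ∈ {j : ℕ | j ≤ d.n ∧ Odd j}, Icc (d.c j) (d.c (j + 1))

open Classical in
/-- `χ = 1` on the interior of `E` and `χ = -1` on the interior of `J`. -/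
def chi (x : ℝ) : ℂ :=
  if x ∈ interior d.E then 1 else if x ∈ interior d.J then -1 else 0

/-- `R(z) = (z - a₁)^(1/2) (z - a₂)^(1/2)`, analytic off `[a₁, a₂]` with `R(z) ~ z` at `∞`. -/
def R (z : ℂ) : ℂ := (z - d.a₁) ^ (1 / 2 : ℂ) * (z - d.a₂) ^ (1 / 2 : ℂ)

/-- The `g`-function, with `g₊ + g₋ = 1` on `E` and `g₊ + g₋ = -1` on `J`. -/
def g (z : ℂ) : ℂ :=
  d.R z / (2 * π * Complex.I) *
    ∫ ζ in d.J ∪ d.E, d.chi ζ / (((ζ : ℂ) - z) * plus d.R ζ)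

/-- The auxiliary function `g̃`, with `g̃₊ + g̃₋ = 0` on `E` and `g̃₊ + g̃₋ = iπ` on `J`. -/
def gTilde (z : ℂ) : ℂ :=
  d.R z / (2 * π * Complex.I) *
    ∫ ζ in d.J, (π * Complex.I) / (((ζ : ℂ) - z) * plus d.R ζ)

/-- `g̃(∞)`. -/
def gTildeInf : ℂ := limUnder (Bornology.cobounded ℂ) d.gTilde

/-- The solution `Ψ` of the model problem,
`Ψ(z) = e^{g̃(∞) σ₃} ((z - a₁) / (z - a₂))^{σ₁ / 4} e^{-g̃(z) σ₃}`. -/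
def Psi (z : ℂ) : Matrix (Fin 2) (Fin 2) ℂ :=
  expSigma3 d.gTildeInf * powSigma1 (((z - d.a₁) / (z - d.a₂)) ^ (1 / 4 : ℂ)) *
    expSigma3 (-d.gTilde z)

/-- The entrywise complex conjugate of `Ψ` at the conjugate point. -/
def PsiStar (z : ℂ) : Matrix (Fin 2) (Fin 2) ℂ :=
  (d.Psi (starRingEnd ℂ z)).map (starRingEnd ℂ)

/-- `Ψ` is in exactly one way of the form `PsiHat + i PsiBreve` with both terms Schwarz symmetric,
that is, `F(z)` is the entrywise conjugate of `F` at the conjugate of `z`. This is `PsiHat`. -/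
def PsiHat (z : ℂ) : Matrix (Fin 2) (Fin 2) ℂ :=
  (1 / 2 : ℂ) • (d.Psi z + d.PsiStar z)

/-- The Schwarz symmetric function `PsiBreve` in `Ψ = PsiHat + i PsiBreve`. -/
def PsiBreve (z : ℂ) : Matrix (Fin 2) (Fin 2) ℂ :=
  (1 / (2 * Complex.I)) • (d.Psi z - d.PsiStar z)

/-- `ϰ = ϰ(|λ|) = -ln (|λ| / 2)`. -/
def kappa (lam : ℝ) : ℝ := -Real.log (|lam| / 2)

/-- `Re [e^{i s ϰ Im g(x₊)} F_k(x₊)]`, where `F_k` is the `k`-th column of `F`. -/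
def shoreCol (F : ℂ → Matrix (Fin 2) (Fin 2) ℂ) (s : ℝ) (k : Fin 2) (lam x : ℝ) : Fin 2 → ℝ :=
  fun i => (Complex.exp (Complex.I * s * kappa lam * (plus d.g x).im) *
    plus (fun z => F z i k) x).re

/-- The column `Re [e^{-iϰ Im g} PsiHat_1]` on the upper shore of `E`. -/
def hatE : ℝ → ℝ → Fin 2 → ℝ := d.shoreCol d.PsiHat (-1) 0

/-- The column `Re [e^{-iϰ Im g} PsiBreve_1]` on the upper shore of `E`. -/
def breveE : ℝ → ℝ → Fin 2 → ℝ := d.shoreCol d.PsiBreve (-1) 0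

/-- The column `Re [e^{iϰ Im g} PsiHat_2]` on the upper shore of `J`. -/
def hatJ : ℝ → ℝ → Fin 2 → ℝ := d.shoreCol d.PsiHat 1 1

/-- The column `Re [e^{iϰ Im g} PsiBreve_2]` on the upper shore of `J`. -/
def breveJ : ℝ → ℝ → Fin 2 → ℝ := d.shoreCol d.PsiBreve 1 1

/-- The determinant of the `2 × 2` matrix with columns `u`, `v`. -/
def colDet (u v : Fin 2 → ℝ) : ℝ := (Matrix.of ![u, v]).transpose.det

/-- The leading-order jump kernel for `x, y` in the interior of `E`. -/
def REE (lam x y : ℝ) : ℂ :=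
  ((colDet (d.hatE lam y) (d.breveE lam x) - colDet (d.hatE lam x) (d.breveE lam y) : ℝ) : ℂ) /
    ((Real.sign lam : ℂ) * (Complex.I * π / 4) * ((x : ℂ) - y))

/-- The leading-order jump kernel for `x` in the interior of `E`, `y` in the interior of `J`. -/
def REJ (lam x y : ℝ) : ℂ :=
  ((colDet (d.hatJ lam y) (d.breveE lam x) - colDet (d.hatE lam x) (d.breveJ lam y) : ℝ) : ℂ) /
    ((Complex.I * π / 4) * ((x : ℂ) - y))

/-- The leading-order jump kernel for `x` in the interior of `J`, `y` in the interior of `E`. -/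
def RJE (lam x y : ℝ) : ℂ :=
  ((colDet (d.hatE lam y) (d.breveJ lam x) - colDet (d.hatJ lam x) (d.breveE lam y) : ℝ) : ℂ) /
    ((Complex.I * π / 4) * ((x : ℂ) - y))

/-- The leading-order jump kernel for `x, y` in the interior of `J`. -/
def RJJ (lam x y : ℝ) : ℂ :=
  ((colDet (d.hatJ lam y) (d.breveJ lam x) - colDet (d.hatJ lam x) (d.breveJ lam y) : ℝ) : ℂ) /
    ((Real.sign lam : ℂ) * (Complex.I * π / 4) * ((x : ℂ) - y))

/-- `B_n(z)^{1/4} = (z - a₁)^{1/4} (z - a₂)^{-(-1)^n / 4} ∏ⱼ (z - b j)^{(-1)^j / 2}`, where each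
root has its cut along the half-line to the left of its branch point. -/
def BRoot (z : ℂ) : ℂ :=
  (z - d.a₁) ^ (1 / 4 : ℂ) * (z - d.a₂) ^ (-(-1) ^ d.n / 4 : ℂ) *
    ∏ j ∈ Finset.Icc 1 d.n, (z - d.b j) ^ ((-1) ^ j / 2 : ℂ)

/-- `φ₊(x; ϰ) = Re (e^{iϰ Im g(x₊)} B_n^{1/4}(x₊))`. -/
def phiPlus (lam x : ℝ) : ℝ :=
  (Complex.exp (Complex.I * kappa lam * (plus d.g x).im) * plus d.BRoot x).re

/-- `φ₋(x; ϰ) = Re (e^{iϰ Im g(x₊)} B_n^{-1/4}(x₊))`. -/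
def phiMinus (lam x : ℝ) : ℝ :=
  (Complex.exp (Complex.I * kappa lam * (plus d.g x).im) * (plus d.BRoot x)⁻¹).re

/-- `φ̃₊(x; ϰ) = Re (e^{-iϰ Im g(x₊)} B_n^{1/4}(x₊))`. -/
def phiTildePlus (lam x : ℝ) : ℝ :=
  (Complex.exp (-Complex.I * kappa lam * (plus d.g x).im) * plus d.BRoot x).re

/-- `φ̃₋(x; ϰ) = -Re (e^{-iϰ Im g(x₊)} B_n^{-1/4}(x₊))`. -/
def phiTildeMinus (lam x : ℝ) : ℝ :=
  -(Complex.exp (-Complex.I * kappa lam * (plus d.g x).im) * (plus d.BRoot x)⁻¹).re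

/-- The number `Ñ` of odd `j` in `{1, …, n}`. -/
def Nodd : ℕ := (d.n + 1) / 2

/-- The number `N` of even `j` in `{1, …, n}`. -/
def Neven : ℕ := d.n / 2

/-- The set that indexes the rows of the vectors and of the matrix: first the odd `j`, then
the even `j` in `{1, …, n}`. -/
abbrev Idx : Type := Fin d.Nodd ⊕ Fin d.Neven

/-- The `(l + 1)`-st odd index. -/
def oddIdx (l : Fin d.Nodd) : ℕ := 2 * (l : ℕ) + 1

/-- The `(l + 1)`-st even index. -/
def evenIdx (l : Fin d.Neven) : ℕ := 2 * (l : ℕ) + 2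

/-- The vector `f(x; ϰ)`. -/
def fvec (lam x : ℝ) : d.Idx → ℝ :=
  Sum.elim (fun l => d.phiMinus lam x / (x - d.b (d.oddIdx l)))
    (fun l => d.phiPlus lam x / (x - d.b (d.evenIdx l)))

/-- The vector `h(x; ϰ)`. -/
def hvec (lam x : ℝ) : d.Idx → ℝ :=
  Sum.elim (fun l => d.phiTildeMinus lam x / (x - d.b (d.oddIdx l)))
    (fun l => d.phiTildePlus lam x / (x - d.b (d.evenIdx l)))

/-- `ν_j`: the acute angle adjacent to the side `√(b_j - a₁)` in the right triangle with
hypotenuse `√(a₂ - a₁)` and sides `√(b_j - a₁)`, `√(a₂ - b_j)`. -/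
def nu (j : ℕ) : ℝ := Real.arccos (√(d.b j - d.a₁) / √(d.a₂ - d.a₁))

/-- `α = Im g̃(∞)`. -/
def alpha : ℝ := d.gTildeInf.im

/-- The constants `k_j`. -/
def k (j : ℕ) : ℝ :=
  if Odd j then
    1 / 2 * (d.a₂ - d.a₁) * Real.cos (d.nu j) * (if Odd d.n then Real.sin (d.nu j) else 1) *
      ∏ l ∈ (Finset.Icc 1 d.n).erase j, Real.sin |d.nu l - d.nu j| ^ ((-1 : ℤ) ^ l)
  else
    1 / 2 * (d.a₂ - d.a₁) * (if Even d.n then Real.sin (d.nu j) else 1) *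
      ∏ l ∈ (Finset.Icc 1 d.n).erase j, Real.sin |d.nu l - d.nu j| ^ ((-1 : ℤ) ^ (l + 1))

/-- `2 k_p k_q sin (ν_p - ν_q) / (b_q - b_p)`, for `p ≠ q`. -/
def offDiag (p q : ℕ) : ℝ :=
  2 * d.k p * d.k q * Real.sin (d.nu p - d.nu q) / (d.b q - d.b p)

/-- The block of odd indices. -/
def M1 : Matrix (Fin d.Nodd) (Fin d.Nodd) ℝ := Matrix.of fun j l =>
  if j = l then
    d.k (d.oddIdx l) * Real.cos (d.nu (d.oddIdx l) - d.alpha) -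
      2 * d.k (d.oddIdx l) * ∑ i ∈ Finset.univ.erase l,
        d.k (d.oddIdx i) * Real.sin (d.nu (d.oddIdx l) - d.nu (d.oddIdx i)) /
          (d.b (d.oddIdx i) - d.b (d.oddIdx l))
  else d.offDiag (d.oddIdx j) (d.oddIdx l)

/-- The block of even indices. -/
def M2 : Matrix (Fin d.Neven) (Fin d.Neven) ℝ := Matrix.of fun j l =>
  if j = l then
    d.k (d.evenIdx l) * Real.sin (d.nu (d.evenIdx l) + d.alpha) -
      2 * d.k (d.evenIdx l) * ∑ i ∈ Finset.univ.erase l,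
        d.k (d.evenIdx i) * Real.sin (d.nu (d.evenIdx l) - d.nu (d.evenIdx i)) /
          (d.b (d.evenIdx i) - d.b (d.evenIdx l))
  else d.offDiag (d.evenIdx j) (d.evenIdx l)

/-- The block diagonal matrix `𝕄`. -/
def M : Matrix d.Idx d.Idx ℝ := Matrix.fromBlocks d.M1 0 0 d.M2

/-- `(4 / (iπ)) vᵗ 𝕄 w`. -/
def form (v w : d.Idx → ℝ) : ℂ :=
  4 / (Complex.I * π) * ((dotProduct v (d.M.mulVec w) : ℝ) : ℂ)

end Config

end JumpKernel

end

/-! Put x = a₁ + (a₂ - a₁) cos² η with 0 < η < π/2. Then ν_j is the parameter of b_j, and x - b_j =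
(a₂ - a₁) sin (η + ν_j) sin (ν_j - η). In this parameter the Cauchy integrals are elementary: they
have logarithmic antiderivatives (`hasDerivAt_logRatio`), which give α = ∑ (-1)^(j+1) ν_j and show
that e^{g̃} on the upper shore has modulus ρ with ρ² = ∏ |sin (η + ν_j) / sin (η -
ν_j)|^((-1)^(j+1)) and phase 1 on E, i on J. The fourth root contributes m e^{i(±η - π/4)} with m =
1 / (2 √(sin η cos η)). So u and w are combinations of cosines and sines of η ± α ± ψ, where ψ = π/4
+ ϰ Im g₊, with weights mρ and mσ/ρ, where σ = 1 on E and σ = -1 on J.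

By the addition formulas the difference of determinants contains only sin (η ± η') and cos (ψ ± ψ')
besides the weights (`colDet_hatCol_breveCol`).

The decisive point is that each weight, times sin η cos η, has two expansions. A quotient of sines
with one more sine in the numerator has simple partial fractions (`prod_sin_zpow_eq`). With D =
|B_n^{1/4}| this writes the weights as D (V sin η ± U cos η), where U and V are rational in x with
simple poles at the even b_j, and also, up to signs, as 1/D times such an expression with poles at
the odd b_j (`isBoundaryData`). Expand cos (ψ ± ψ') and use the even expansion in the cos ψ cos ψ'
part and the odd one in the sin ψ sin ψ' part. What remains is 2 (U(x) V(y) - V(x) U(y)) for each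
parity, times D D' cos ψ cos ψ' or σ σ' sin ψ sin ψ' / (D D').

Such a bracket is x - y times a quadratic form in 1 / (y - b_j) and 1 / (x - b_l), whose matrix is a
block of 𝕄 (`sum_quadratic_form`). Finally D cos ψ and -σ sin ψ / D are the functions φ or φ̃. The
identity holds for every real phase ψ, so nothing is needed about Im g₊ except its continuity, which
gives the diagonal limits. -/

namespace JumpKernel

/-! ### Trigonometric partial fractions and the divided difference. -/

/-- Partial fractions for a quotient of sines with one more sine in the numerator. -/
theorem prod_sin_zpow_eq (θ : ℕ → ℝ) (m : ℕ)
    (hθ : ∀ i < 2 * m + 1, ∀ j < 2 * m + 1, i ≠ j → Real.sin (θ i - θ j) ≠ 0) (η : ℝ)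
    (hη : ∀ j < m, Real.sin (η + θ (2 * j + 1)) ≠ 0) :
    ∏ i ∈ Finset.range (2 * m + 1), Real.sin (η + θ i) ^ ((-1 : ℤ) ^ i) =
      Real.sin (η + ∑ i ∈ Finset.range (2 * m + 1), (-1) ^ i * θ i) +
      ∑ j ∈ Finset.range m,
        (∏ i ∈ (Finset.range (2 * m + 1)).erase (2 * j + 1),
          Real.sin (θ i - θ (2 * j + 1)) ^ ((-1 : ℤ) ^ i)) / Real.sin (η + θ (2 * j + 1)) := by
  induction m generalizing η with
  | zero => simp
  | succ m ih =>
    have hlt : ∀ i < 2 * m + 1, i < 2 * (m + 1) + 1 := fun i hi => by omega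
    have ih' := ih (fun i hi j hj hij => hθ i (hlt i hi) j (hlt j hj) hij)
    have hodd : ((-1 : ℤ) ^ (2 * m + 1)) = -1 := by rw [pow_succ, pow_mul]; norm_num
    have heven : ((-1 : ℤ) ^ (2 * m + 2)) = 1 := by
      rw [show 2 * m + 2 = 2 * (m + 1) by ring, pow_mul]; norm_num
    have hoddR : ((-1 : ℝ) ^ (2 * m + 1)) = -1 := by rw [pow_succ, pow_mul]; norm_num
    have hevenR : ((-1 : ℝ) ^ (2 * m + 2)) = 1 := by
      rw [show 2 * m + 2 = 2 * (m + 1) by ring, pow_mul]; norm_num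
    set τ := θ (2 * m + 1) with hτ
    set μ := θ (2 * m + 2) with hμ
    set A := ∑ i ∈ Finset.range (2 * m + 1), (-1 : ℝ) ^ i * θ i with hA
    have hlast : Real.sin (η + τ) ≠ 0 := hη m (by omega)
    have h1 := ih' η (fun j hj => hη j (by omega))
    -- The residue at the new pole η = -τ is the old quotient evaluated there, times sin (μ - τ).
    have h2 := ih' (-τ) (fun j hj => by
      rw [show -τ + θ (2 * j + 1) = θ (2 * j + 1) - θ (2 * m + 1) by rw [hτ]; ring]
      exact hθ _ (by omega) _ (by omega) (by omega))
    rw [show 2 * (m + 1) + 1 = 2 * m + 1 + 1 + 1 by ring, Finset.prod_range_succ,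
      Finset.prod_range_succ, h1, Finset.sum_range_succ, Finset.sum_range_succ,
      Finset.sum_range_succ _ m, ← hA, show 2 * m + 1 + 1 = 2 * m + 2 by ring, hodd, heven, hoddR,
      hevenR, ← hτ, ← hμ, zpow_one, zpow_neg, zpow_one,
      show A + -1 * τ + 1 * μ = A - τ + μ by ring]
    have e1 : ∀ j ∈ Finset.range m,
        (∏ i ∈ (Finset.range (2 * m + 2 + 1)).erase (2 * j + 1),
          Real.sin (θ i - θ (2 * j + 1)) ^ ((-1 : ℤ) ^ i)) / Real.sin (η + θ (2 * j + 1)) =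
        (∏ i ∈ (Finset.range (2 * m + 1)).erase (2 * j + 1),
          Real.sin (θ i - θ (2 * j + 1)) ^ ((-1 : ℤ) ^ i)) *
          (Real.sin (τ - θ (2 * j + 1)))⁻¹ * Real.sin (μ - θ (2 * j + 1)) /
          Real.sin (η + θ (2 * j + 1)) := by
      intro j hj
      have hj' := Finset.mem_range.mp hj
      rw [Finset.range_add_one, Finset.range_add_one (n := 2 * m + 1),
        Finset.erase_insert_of_ne (by omega), Finset.erase_insert_of_ne (by omega),
        Finset.prod_insert (by simp), Finset.prod_insert (by simp), heven, hodd, zpow_one, zpow_neg,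
        zpow_one, ← hτ, ← hμ]
      ring
    have e2 : (∏ i ∈ (Finset.range (2 * m + 2 + 1)).erase (2 * m + 1),
          Real.sin (θ i - τ) ^ ((-1 : ℤ) ^ i)) =
        Real.sin (μ - τ) * (Real.sin (-τ + A) + ∑ j ∈ Finset.range m,
        (∏ i ∈ (Finset.range (2 * m + 1)).erase (2 * j + 1),
          Real.sin (θ i - θ (2 * j + 1)) ^ ((-1 : ℤ) ^ i)) / Real.sin (-τ + θ (2 * j + 1))) := by
      rw [← h2, Finset.range_add_one, Finset.range_add_one (n := 2 * m + 1),
        Finset.erase_insert_of_ne (by omega), Finset.erase_insert (by simp),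
        Finset.prod_insert (by simp), heven, zpow_one, ← hμ]
      congr 1
      refine Finset.prod_congr rfl fun i _ => ?_
      rw [show θ i - τ = -τ + θ i by ring]
    rw [Finset.sum_congr rfl e1, e2]
    -- The induction step multiplies by sin (η + μ) / sin (η + τ); this identity handles the regular
    -- term and `e3` each old pole.
    have key : Real.sin (η + A) * Real.sin (η + μ) =
        Real.sin (η + τ) * Real.sin (η + (A - τ + μ)) +
          Real.sin (μ - τ) * Real.sin (-τ + A) := by
      have a1 : η + A = (η + τ) + (-τ + A) := by ring
      have a2 : η + μ = (η + τ) + (μ - τ) := by ring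
      have a3 : η + (A - τ + μ) = (η + τ) + ((-τ + A) + (μ - τ)) := by ring
      rw [a1, a2, a3]
      generalize η + τ = p
      generalize -τ + A = q
      generalize μ - τ = r
      simp only [Real.sin_add, Real.cos_add]
      linear_combination (Real.sin q * Real.sin r) * Real.sin_sq_add_cos_sq p
    have e3 : ∀ j ∈ Finset.range m,
        (∏ i ∈ (Finset.range (2 * m + 1)).erase (2 * j + 1),
          Real.sin (θ i - θ (2 * j + 1)) ^ ((-1 : ℤ) ^ i)) *
          (Real.sin (τ - θ (2 * j + 1)))⁻¹ * Real.sin (μ - θ (2 * j + 1)) /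
          Real.sin (η + θ (2 * j + 1)) =
        (∏ i ∈ (Finset.range (2 * m + 1)).erase (2 * j + 1),
          Real.sin (θ i - θ (2 * j + 1)) ^ ((-1 : ℤ) ^ i)) / Real.sin (η + θ (2 * j + 1)) *
          (Real.sin (η + μ) * (Real.sin (η + τ))⁻¹) -
        (∏ i ∈ (Finset.range (2 * m + 1)).erase (2 * j + 1),
          Real.sin (θ i - θ (2 * j + 1)) ^ ((-1 : ℤ) ^ i)) / Real.sin (-τ + θ (2 * j + 1)) *
          (Real.sin (μ - τ) * (Real.sin (η + τ))⁻¹) := by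
      intro j hj
      have hj' := Finset.mem_range.mp hj
      have n1 : Real.sin (τ - θ (2 * j + 1)) ≠ 0 := hθ _ (by omega) _ (by omega) (by omega)
      have n2 := hη j (by omega)
      rw [show -τ + θ (2 * j + 1) = -(τ - θ (2 * j + 1)) by ring, Real.sin_neg]
      have id : Real.sin (η + μ) * Real.sin (τ - θ (2 * j + 1)) =
          Real.sin (μ - θ (2 * j + 1)) * Real.sin (η + τ) -
            Real.sin (μ - τ) * Real.sin (η + θ (2 * j + 1)) := by
        rw [show η + μ = (η + θ (2 * j + 1)) + (μ - θ (2 * j + 1)) by ring,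
          show η + τ = (η + θ (2 * j + 1)) + (τ - θ (2 * j + 1)) by ring,
          show μ - τ = (μ - θ (2 * j + 1)) - (τ - θ (2 * j + 1)) by ring]
        generalize η + θ (2 * j + 1) = p
        generalize μ - θ (2 * j + 1) = q
        generalize τ - θ (2 * j + 1) = r
        simp only [Real.sin_add, Real.sin_sub]
        ring
      generalize (∏ i ∈ (Finset.range (2 * m + 1)).erase (2 * j + 1),
          Real.sin (θ i - θ (2 * j + 1)) ^ ((-1 : ℤ) ^ i)) = Q
      field_simp
      linear_combination (-Q) * id
    rw [Finset.sum_congr rfl e3, Finset.sum_sub_distrib, ← Finset.sum_mul, ← Finset.sum_mul]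
    generalize (∑ j ∈ Finset.range m, (∏ i ∈ (Finset.range (2 * m + 1)).erase (2 * j + 1),
      Real.sin (θ i - θ (2 * j + 1)) ^ ((-1 : ℤ) ^ i)) / Real.sin (-τ + θ (2 * j + 1))) = X
    generalize (∑ j ∈ Finset.range m, (∏ i ∈ (Finset.range (2 * m + 1)).erase (2 * j + 1),
      Real.sin (θ i - θ (2 * j + 1)) ^ ((-1 : ℤ) ^ i)) / Real.sin (η + θ (2 * j + 1))) = Y
    field_simp
    linear_combination key

/-- The sign of a product of sines of differences of a decreasing sequence. -/
theorem prod_sin_sub_eq_neg (θ : ℕ → ℝ) (m j : ℕ) (hj : j < m)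
    (hθ : ∀ i < 2 * m + 1, ∀ l < 2 * m + 1, i < l → θ l < θ i) :
    ∏ i ∈ (Finset.range (2 * m + 1)).erase (2 * j + 1),
        Real.sin (θ i - θ (2 * j + 1)) ^ ((-1 : ℤ) ^ i) =
      -∏ i ∈ (Finset.range (2 * m + 1)).erase (2 * j + 1),
        Real.sin |θ i - θ (2 * j + 1)| ^ ((-1 : ℤ) ^ i) := by
  have h : ∀ i ∈ (Finset.range (2 * m + 1)).erase (2 * j + 1),
      Real.sin (θ i - θ (2 * j + 1)) ^ ((-1 : ℤ) ^ i) =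
        (if 2 * j + 1 < i then -1 else 1) * Real.sin |θ i - θ (2 * j + 1)| ^ ((-1 : ℤ) ^ i) := by
    intro i hi
    have hi' := Finset.mem_erase.mp hi
    have hi2 := Finset.mem_range.mp hi'.2
    split_ifs with hlt
    · have := hθ _ (by omega : 2 * j + 1 < 2 * m + 1) i hi2 hlt
      rw [abs_of_neg (by linarith), Real.sin_neg]
      rcases neg_one_pow_eq_or ℤ i with h | h <;> rw [h]
      · simp
      · simp [zpow_neg, inv_neg]
    · have := hθ i hi2 _ (by omega : 2 * j + 1 < 2 * m + 1) (by omega)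
      rw [abs_of_pos (by linarith), one_mul]
  rw [Finset.prod_congr rfl h, Finset.prod_mul_distrib, Finset.prod_ite, Finset.prod_const,
    Finset.prod_const_one, mul_one]
  -- A factor changes sign for each index from 2j + 2 to 2m; their number 2(m - j) - 1 is odd.
  have hc : (Finset.filter (fun i => 2 * j + 1 < i)
      ((Finset.range (2 * m + 1)).erase (2 * j + 1))) = Finset.Ioo (2 * j + 1) (2 * m + 1) := by
    ext i; simp; omega
  rw [hc, Nat.card_Ioo, show 2 * m + 1 - (2 * j + 1) - 1 = 2 * (m - j - 1) + 1 by omega, pow_succ,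
    pow_mul]
  simp

/-- The divided difference of two functions with simple poles as a quadratic form. -/
theorem sum_quadratic_form {ι : Type*} [Fintype ι] [DecidableEq ι] (k ν b : ι → ℝ)
    (hb : Function.Injective b) (γ x y : ℝ) (hx : ∀ i, x ≠ b i) (hy : ∀ i, y ≠ b i) :
    2 * ((Real.sin γ / 2 - ∑ i, k i * Real.sin (ν i) / (x - b i)) *
        (Real.cos γ / 2 + ∑ i, k i * Real.cos (ν i) / (y - b i)) -
      (Real.cos γ / 2 + ∑ i, k i * Real.cos (ν i) / (x - b i)) *
        (Real.sin γ / 2 - ∑ i, k i * Real.sin (ν i) / (y - b i))) =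
    (x - y) * ∑ j, ∑ l, 1 / (y - b j) * (if j = l then
        k l * Real.sin (ν l + γ) - 2 * k l * ∑ i ∈ Finset.univ.erase l,
          k i * Real.sin (ν l - ν i) / (b i - b l)
      else 2 * k j * k l * Real.sin (ν j - ν l) / (b l - b j)) * (1 / (x - b l)) := by
  set z : ι → ℝ := fun i => 1 / (x - b i) with hz
  set w : ι → ℝ := fun i => 1 / (y - b i) with hw
  set C : ι → ι → ℝ := fun j l => Real.sin (ν j - ν l) / (b l - b j) with hC
  have hCs : ∀ j l, C j l = C l j := fun j l => by
    simp only [hC]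
    rw [← neg_sub (ν l), ← neg_sub (b j), Real.sin_neg, neg_div_neg_eq]
  -- The vanishing diagonal lets the sums over `Finset.univ.erase l` run over all indices.
  have hC0 : ∀ j, C j j = 0 := fun j => by simp [hC]
  have r1 : ∀ j l, 1 / (y - b j) * (if j = l then
        k l * Real.sin (ν l + γ) - 2 * k l * ∑ i ∈ Finset.univ.erase l,
          k i * Real.sin (ν l - ν i) / (b i - b l)
      else 2 * k j * k l * Real.sin (ν j - ν l) / (b l - b j)) * (1 / (x - b l)) =
      (if j = l then w l * (k l * Real.sin (ν l + γ) - ∑ i, 2 * k l * k i * C l i) * z l else 0) +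
        2 * k j * k l * C j l * w j * z l := by
    intro j l
    split_ifs with h
    · subst h
      have hs : ∑ i ∈ Finset.univ.erase j, k i * Real.sin (ν j - ν i) / (b i - b j) =
          ∑ i, k i * C j i := by
        rw [← Finset.add_sum_erase _ _ (Finset.mem_univ j), hC0, mul_zero, zero_add]
        exact Finset.sum_congr rfl fun i _ => by rw [hC]; ring
      rw [hs, hC0, Finset.mul_sum]
      simp only [mul_assoc, hz, hw]; ring
    · simp only [hC, hz, hw]; ring
  have hL : 2 * ((Real.sin γ / 2 - ∑ i, k i * Real.sin (ν i) / (x - b i)) *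
        (Real.cos γ / 2 + ∑ i, k i * Real.cos (ν i) / (y - b i)) -
      (Real.cos γ / 2 + ∑ i, k i * Real.cos (ν i) / (x - b i)) *
        (Real.sin γ / 2 - ∑ i, k i * Real.sin (ν i) / (y - b i))) =
      ∑ i, k i * Real.sin (ν i + γ) * (w i - z i) +
        ∑ j, ∑ l, 2 * k j * k l * Real.sin (ν l - ν j) * z j * w l := by
    have e1 : ∀ (f : ι → ℝ) (t : ℝ), ∑ i, k i * f i / (t - b i) = ∑ i, f i * (k i * (1 / (t - b i))) :=
      fun f t => Finset.sum_congr rfl fun i _ => by ring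
    have q : ∑ j, ∑ l, 2 * k j * k l * Real.sin (ν l - ν j) * z j * w l =
        2 * ((∑ i, k i * Real.cos (ν i) / (x - b i)) * (∑ i, k i * Real.sin (ν i) / (y - b i)) -
          (∑ i, k i * Real.sin (ν i) / (x - b i)) * (∑ i, k i * Real.cos (ν i) / (y - b i))) := by
      rw [Finset.sum_mul_sum, Finset.sum_mul_sum, ← Finset.sum_sub_distrib, Finset.mul_sum]
      refine Finset.sum_congr rfl fun j _ => ?_
      rw [← Finset.sum_sub_distrib, Finset.mul_sum]
      refine Finset.sum_congr rfl fun l _ => ?_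
      rw [Real.sin_sub]; simp only [hz, hw]; ring
    have p : ∑ i, k i * Real.sin (ν i + γ) * (w i - z i) =
        Real.sin γ * (∑ i, k i * Real.cos (ν i) / (y - b i)) +
        Real.cos γ * (∑ i, k i * Real.sin (ν i) / (y - b i)) -
        Real.sin γ * (∑ i, k i * Real.cos (ν i) / (x - b i)) -
        Real.cos γ * (∑ i, k i * Real.sin (ν i) / (x - b i)) := by
      simp only [Finset.mul_sum, ← Finset.sum_add_distrib, ← Finset.sum_sub_distrib]
      refine Finset.sum_congr rfl fun i _ => ?_
      rw [Real.sin_add]; simp only [hz, hw]; ring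
    rw [p, q]; ring
  rw [hL]
  simp only [r1, Finset.sum_add_distrib, Finset.sum_ite_eq, Finset.mem_univ, if_true]
  have hwz : ∀ i, w i - z i = (x - y) * (w i * z i) := fun i => by
    have := sub_ne_zero.mpr (hx i); have := sub_ne_zero.mpr (hy i)
    simp only [hz, hw]; field_simp; ring
  -- Both sides agree after symmetrization in (j, l), since `C` is symmetric. The products w_j z_l
  -- become the off-diagonal entries, and the terms -w_j z_j become the sums subtracted in the
  -- diagonal entries.
  have hsym : ∑ j, ∑ l, 2 * k j * k l * Real.sin (ν l - ν j) * z j * w l =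
      (x - y) * ∑ j, ∑ l, 2 * k j * k l * C j l * (w j * z l - w j * z j) := by
    rw [Finset.mul_sum]
    simp only [Finset.mul_sum]
    have hdouble : ∀ F : ι → ι → ℝ, 2 * ∑ j, ∑ l, F j l = ∑ j, ∑ l, (F j l + F l j) := fun F => by
      simp only [Finset.sum_add_distrib]
      rw [Finset.sum_comm (f := fun j l => F l j)]; ring
    have h2 : (2 : ℝ) ≠ 0 := two_ne_zero
    apply mul_left_cancel₀ h2
    rw [hdouble, hdouble]
    refine Finset.sum_congr rfl fun j _ => Finset.sum_congr rfl fun l _ => ?_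
    rw [hCs l j]
    by_cases h : j = l
    · subst h; simp [hC0]
    have hbn : b l - b j ≠ 0 := sub_ne_zero.mpr fun e => h (hb e.symm)
    have := sub_ne_zero.mpr (hx j); have := sub_ne_zero.mpr (hy j)
    have := sub_ne_zero.mpr (hx l); have := sub_ne_zero.mpr (hy l)
    rw [show ν l - ν j = -(ν j - ν l) by ring, Real.sin_neg]
    simp only [hC, hz, hw]
    field_simp
    ring
  rw [hsym, mul_add]
  simp only [hwz, Finset.mul_sum, ← Finset.sum_add_distrib]
  refine Finset.sum_congr rfl fun j _ => ?_
  have : w j * (k j * Real.sin (ν j + γ) - ∑ i, 2 * k j * k i * C j i) * z j =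
    w j * k j * Real.sin (ν j + γ) * z j - ∑ i, 2 * k j * k i * C j i * w j * z j := by
    rw [← Finset.sum_mul, ← Finset.sum_mul]; ring
  rw [this, mul_sub, Finset.mul_sum]
  rw [show ∀ a b c d : ℝ, a = b - c + d ↔ a = b + (d - c) from fun a b c d => by
    constructor <;> intro h <;> linarith]
  rw [← Finset.sum_sub_distrib]
  congr 1
  · ring
  · exact Finset.sum_congr rfl fun l _ => by ring

end JumpKernel

noncomputable section

namespace JumpKernel

namespace Config

variable (d : Config)

/-! ### The points c_j and the sets E and J. -/

theorem c_zero : d.c 0 = d.a₁ := by simp [c]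

theorem c_of_mem {j : ℕ} (h1 : 1 ≤ j) (h2 : j ≤ d.n) : d.c j = d.b j := by
  rw [c, if_neg (by omega), if_pos h2]

theorem c_last : d.c (d.n + 1) = d.a₂ := by simp [c]

theorem c_lt_succ {j : ℕ} (h : j ≤ d.n) : d.c j < d.c (j + 1) := by
  have hn := d.one_le_n
  rcases Nat.eq_zero_or_pos j with rfl | hj
  · rw [c_zero, d.c_of_mem (by omega) (by omega)]; exact d.a₁_lt
  · rw [d.c_of_mem hj h]
    rcases h.lt_or_eq with h | rfl
    · rw [d.c_of_mem (by omega) h]; exact d.b_lt j hj h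
    · rw [c_last]; exact d.lt_a₂

theorem c_lt {i j : ℕ} (hij : i < j) (hj : j ≤ d.n + 1) : d.c i < d.c j := by
  induction j with
  | zero => omega
  | succ j ih =>
    rcases (Nat.lt_succ_iff.mp hij).lt_or_eq with h | rfl
    · exact (ih h (by omega)).trans (d.c_lt_succ (by omega))
    · exact d.c_lt_succ (by omega)

theorem c_le {i j : ℕ} (hij : i ≤ j) (hj : j ≤ d.n + 1) : d.c i ≤ d.c j := by
  rcases hij.lt_or_eq with h | rfl
  · exact (d.c_lt h hj).le
  · exact le_rfl

theorem a₁_le_c {j : ℕ} (hj : j ≤ d.n + 1) : d.a₁ ≤ d.c j := by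
  rw [← c_zero]; exact d.c_le (Nat.zero_le _) hj

theorem c_le_a₂ {j : ℕ} (hj : j ≤ d.n + 1) : d.c j ≤ d.a₂ := by
  rw [← c_last]; exact d.c_le hj le_rfl

theorem a₁_lt_a₂ : d.a₁ < d.a₂ := by
  rw [← c_zero, ← c_last]; exact d.c_lt (by omega) le_rfl

theorem eq_of_mem_Icc_of_mem_Ioo {i j : ℕ} (hi : i ≤ d.n) (hj : j ≤ d.n) {x : ℝ}
    (hx : x ∈ Icc (d.c i) (d.c (i + 1))) (hx' : x ∈ Ioo (d.c j) (d.c (j + 1))) : i = j := by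
  rcases lt_trichotomy i j with h | h | h
  · have := d.c_le (show i + 1 ≤ j by omega) (by omega)
    linarith [hx.2, hx'.1]
  · exact h
  · have := d.c_le (show j + 1 ≤ i by omega) (by omega)
    linarith [hx.1, hx'.2]

theorem mem_E_iff {x : ℝ} : x ∈ d.E ↔ ∃ j ≤ d.n, Even j ∧ x ∈ Icc (d.c j) (d.c (j + 1)) := by
  simp only [E, mem_iUnion, mem_ofPred_eq, exists_prop, and_assoc]

theorem mem_J_iff {x : ℝ} : x ∈ d.J ↔ ∃ j ≤ d.n, Odd j ∧ x ∈ Icc (d.c j) (d.c (j + 1)) := by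
  simp only [J, mem_iUnion, mem_ofPred_eq, exists_prop, and_assoc]

/-- Interior points of a union of some of the intervals `[c j, c (j + 1)]`, no two of them adjacent,
lie in the interior of one of them. -/
theorem exists_mem_Ioo_of_mem_interior (S : Set ℝ) (p : ℕ → Prop) (hp : ∀ j, p j → ¬p (j + 1))
    (hS : ∀ x, x ∈ S ↔ ∃ j ≤ d.n, p j ∧ x ∈ Icc (d.c j) (d.c (j + 1))) {x : ℝ}
    (hx : x ∈ interior S) : ∃ j ≤ d.n, p j ∧ x ∈ Ioo (d.c j) (d.c (j + 1)) := by
  obtain ⟨j, hj, hpj, hxj⟩ := (hS x).mp (interior_subset hx)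
  obtain ⟨ε, hε, hball⟩ := Metric.isOpen_iff.mp isOpen_interior x hx
  have hmem : ∀ y, |y - x| < ε → y ∈ S := fun y hy =>
    interior_subset (hball (by rwa [Metric.mem_ball, Real.dist_eq]))
  -- If `x` were an endpoint, `S` would contain points beyond it: in the adjacent interval, which
  -- `hp` excludes, or outside [a₁, a₂].
  refine ⟨j, hj, hpj, lt_of_le_of_ne hxj.1 ?_, lt_of_le_of_ne hxj.2 ?_⟩
  · rintro rfl
    rcases Nat.eq_zero_or_pos j with rfl | hj0
    · obtain ⟨i, hi, -, hyi⟩ := (hS (d.c 0 - ε / 2)).mp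
        (hmem _ (by rw [abs_lt]; constructor <;> linarith))
      linarith [hyi.1, d.a₁_le_c (j := i) (by omega), d.c_zero]
    · obtain ⟨i, rfl⟩ := Nat.exists_eq_succ_of_ne_zero hj0.ne'
      have hlt := d.c_lt_succ (j := i) (by omega)
      obtain ⟨y, hy1, hy2⟩ := exists_between (show max (d.c i) (d.c (i + 1) - ε) < d.c (i + 1) from
        max_lt hlt (by linarith))
      rw [max_lt_iff] at hy1
      obtain ⟨l, hl, hpl, hyl⟩ := (hS y).mp (hmem y (by rw [abs_lt]; constructor <;> linarith))
      have := d.eq_of_mem_Icc_of_mem_Ioo hl (by omega) hyl ⟨hy1.1, hy2⟩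
      exact hp i (this ▸ hpl) hpj
  · intro hxe
    rcases hj.lt_or_eq with hjn | rfl
    · have hlt := d.c_lt_succ (j := j + 1) (by omega)
      obtain ⟨y, hy1, hy2⟩ := exists_between (show x < min (d.c (j + 2)) (x + ε) from
        lt_min (hxe ▸ hlt) (by linarith))
      rw [lt_min_iff] at hy2
      obtain ⟨l, hl, hpl, hyl⟩ := (hS y).mp (hmem y (by rw [abs_lt]; constructor <;> linarith))
      have := d.eq_of_mem_Icc_of_mem_Ioo hl (by omega) hyl ⟨hxe ▸ hy1, hy2.1⟩
      exact hp j hpj (this ▸ hpl)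
    · obtain ⟨i, hi, -, hyi⟩ := (hS (x + ε / 2)).mp
        (hmem _ (by rw [abs_lt]; constructor <;> linarith))
      have := d.c_le_a₂ (j := i + 1) (by omega)
      linarith [hyi.2, d.c_last]

theorem exists_even_of_mem_interior_E {x : ℝ} (hx : x ∈ interior d.E) :
    ∃ j ≤ d.n, Even j ∧ x ∈ Ioo (d.c j) (d.c (j + 1)) :=
  d.exists_mem_Ioo_of_mem_interior d.E Even (fun j h => by simp [Nat.even_add_one, h])
    (fun _ => d.mem_E_iff) hx

theorem exists_odd_of_mem_interior_J {x : ℝ} (hx : x ∈ interior d.J) :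
    ∃ j ≤ d.n, Odd j ∧ x ∈ Ioo (d.c j) (d.c (j + 1)) :=
  d.exists_mem_Ioo_of_mem_interior d.J Odd
    (fun j h => by rw [Nat.not_odd_iff_even]; exact h.add_one)
    (fun _ => d.mem_J_iff) hx

theorem mem_interior_E {j : ℕ} (hj : j ≤ d.n) (he : Even j) {x : ℝ}
    (hx : x ∈ Ioo (d.c j) (d.c (j + 1))) : x ∈ interior d.E :=
  mem_interior.mpr ⟨_, fun _ hy => d.mem_E_iff.mpr ⟨j, hj, he, Ioo_subset_Icc_self hy⟩, isOpen_Ioo,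
    hx⟩

theorem mem_interior_J {j : ℕ} (hj : j ≤ d.n) (he : Odd j) {x : ℝ}
    (hx : x ∈ Ioo (d.c j) (d.c (j + 1))) : x ∈ interior d.J :=
  mem_interior.mpr ⟨_, fun _ hy => d.mem_J_iff.mpr ⟨j, hj, he, Ioo_subset_Icc_self hy⟩, isOpen_Ioo,
    hx⟩

theorem mem_J_iff_odd {j : ℕ} (hj : j ≤ d.n) {x : ℝ} (hx : x ∈ Ioo (d.c j) (d.c (j + 1))) :
    x ∈ d.J ↔ Odd j := by
  refine ⟨fun h => ?_, fun h => interior_subset (d.mem_interior_J hj h hx)⟩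
  obtain ⟨i, hi, hio, hxi⟩ := d.mem_J_iff.mp h
  exact d.eq_of_mem_Icc_of_mem_Ioo hi hj hxi hx ▸ hio

theorem chi_of_mem_Ioo {j : ℕ} (hj : j ≤ d.n) {x : ℝ} (hx : x ∈ Ioo (d.c j) (d.c (j + 1))) :
    d.chi x = (-1) ^ j := by
  rcases Nat.even_or_odd j with h | h
  · rw [chi, if_pos (d.mem_interior_E hj h hx), h.neg_one_pow]
  · rw [chi, if_neg, if_pos (d.mem_interior_J hj h hx), h.neg_one_pow]
    intro hE
    obtain ⟨i, hi, hie, hxi⟩ := d.mem_E_iff.mp (interior_subset hE)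
    rw [d.eq_of_mem_Icc_of_mem_Ioo hi hj hxi hx] at hie
    exact (Nat.not_even_iff_odd.mpr h) hie

theorem J_union_E : d.J ∪ d.E = Icc d.a₁ d.a₂ := by
  ext x
  constructor
  · rintro (h | h)
    · obtain ⟨i, hi, -, hxi⟩ := d.mem_J_iff.mp h
      exact ⟨(d.a₁_le_c (by omega)).trans hxi.1, hxi.2.trans (d.c_le_a₂ (by omega))⟩
    · obtain ⟨i, hi, -, hxi⟩ := d.mem_E_iff.mp h
      exact ⟨(d.a₁_le_c (by omega)).trans hxi.1, hxi.2.trans (d.c_le_a₂ (by omega))⟩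
  · rintro ⟨h1, h2⟩
    -- Induction on the right end. The alternative m = 0 is the empty start, absorbed by the first
    -- interval of E through `h1`.
    have key : ∀ m ≤ d.n + 1, x ≤ d.c m → x ∈ d.J ∪ d.E ∨ m = 0 := by
      intro m
      induction m with
      | zero => exact fun _ _ => Or.inr rfl
      | succ m ih =>
        intro hm hx
        left
        rcases le_total x (d.c m) with h | h
        · rcases ih (by omega) h with h' | rfl
          · exact h'
          · exact Or.inr (d.mem_E_iff.mpr ⟨0, by omega, by simp, by rw [c_zero]; exact h1, hx⟩)
        · rcases Nat.even_or_odd m with he | he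
          · exact Or.inr (d.mem_E_iff.mpr ⟨m, by omega, he, h, hx⟩)
          · exact Or.inl (d.mem_J_iff.mpr ⟨m, by omega, he, h, hx⟩)
    rcases key (d.n + 1) le_rfl (by rwa [c_last]) with h | h
    · exact h
    · omega

theorem Ioo_subset {j : ℕ} (hj : j ≤ d.n) : Ioo (d.c j) (d.c (j + 1)) ⊆ Ioo d.a₁ d.a₂ :=
  Ioo_subset_Ioo (d.a₁_le_c (by omega)) (d.c_le_a₂ (by omega))

/-! ### The trigonometric parameter. -/

/-- The length `√(a₂ - a₁)`. -/
def scale : ℝ := √(d.a₂ - d.a₁)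

theorem scale_pos : 0 < d.scale := Real.sqrt_pos.mpr (sub_pos.mpr d.a₁_lt_a₂)

theorem scale_sq : d.scale ^ 2 = d.a₂ - d.a₁ := Real.sq_sqrt (sub_pos.mpr d.a₁_lt_a₂).le

/-- The angle `η ∈ [0, π / 2]` with `x = a₁ + (a₂ - a₁) cos² η`. -/
def angle (x : ℝ) : ℝ := Real.arccos (√(x - d.a₁) / d.scale)

theorem nu_eq (j : ℕ) : d.nu j = d.angle (d.b j) := rfl

theorem nu_le (j : ℕ) : d.nu j ≤ π / 2 := by
  rw [nu, Real.arccos_le_pi_div_two]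
  exact div_nonneg (Real.sqrt_nonneg _) (Real.sqrt_nonneg _)

theorem scale_mul_cos {x : ℝ} (hx : x ∈ Icc d.a₁ d.a₂) :
    d.scale * Real.cos (d.angle x) = √(x - d.a₁) := by
  have h0 := d.scale_pos
  rw [angle, Real.cos_arccos]
  · field_simp
  · linarith [div_nonneg (Real.sqrt_nonneg (x - d.a₁)) h0.le]
  · rw [div_le_one h0]
    exact Real.sqrt_le_sqrt (by linarith [hx.2])

theorem scale_mul_sin {x : ℝ} (hx : x ∈ Icc d.a₁ d.a₂) :
    d.scale * Real.sin (d.angle x) = √(d.a₂ - x) := by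
  have h0 := d.scale_pos
  rw [angle, Real.sin_arccos]
  have : 1 - (√(x - d.a₁) / d.scale) ^ 2 = (d.a₂ - x) / d.scale ^ 2 := by
    rw [div_pow, Real.sq_sqrt (by linarith [hx.1])]
    field_simp
    rw [d.scale_sq]; ring
  rw [this, Real.sqrt_div (by linarith [hx.2]), Real.sqrt_sq h0.le]
  field_simp

theorem angle_nonneg (x : ℝ) : 0 ≤ d.angle x := Real.arccos_nonneg _

theorem angle_le (x : ℝ) : d.angle x ≤ π / 2 := by
  rw [angle, Real.arccos_le_pi_div_two]
  exact div_nonneg (Real.sqrt_nonneg _) d.scale_pos.le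

theorem angle_a₁ : d.angle d.a₁ = π / 2 := by simp [angle]

theorem angle_a₂ : d.angle d.a₂ = 0 := by
  rw [angle, show √(d.a₂ - d.a₁) = d.scale from rfl, div_self d.scale_pos.ne', Real.arccos_one]

theorem angle_lt {x y : ℝ} (hx : d.a₁ ≤ x) (hxy : x < y) (hy : y ≤ d.a₂) :
    d.angle y < d.angle x := by
  have h0 := d.scale_pos
  refine Real.arccos_lt_arccos ?_ ?_ ?_
  · linarith [div_nonneg (Real.sqrt_nonneg (x - d.a₁)) h0.le]
  · gcongr
  · rw [div_le_one h0]
    exact Real.sqrt_le_sqrt (by linarith)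

theorem angle_pos {x : ℝ} (hx : x ∈ Ioo d.a₁ d.a₂) : 0 < d.angle x :=
  d.angle_a₂ ▸ d.angle_lt hx.1.le hx.2 le_rfl

theorem angle_lt_pi_div_two {x : ℝ} (hx : x ∈ Ioo d.a₁ d.a₂) : d.angle x < π / 2 :=
  d.angle_a₁ ▸ d.angle_lt le_rfl hx.1 hx.2.le

theorem sin_angle_pos {x : ℝ} (hx : x ∈ Ioo d.a₁ d.a₂) : 0 < Real.sin (d.angle x) :=
  Real.sin_pos_of_pos_of_lt_pi (d.angle_pos hx) (by linarith [d.angle_le x, Real.pi_pos])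

theorem cos_angle_pos {x : ℝ} (hx : x ∈ Ioo d.a₁ d.a₂) : 0 < Real.cos (d.angle x) :=
  Real.cos_pos_of_mem_Ioo ⟨by linarith [d.angle_pos hx, Real.pi_pos], d.angle_lt_pi_div_two hx⟩

theorem eq_add_cos_sq {x : ℝ} (hx : x ∈ Icc d.a₁ d.a₂) :
    x = d.a₁ + d.scale ^ 2 * Real.cos (d.angle x) ^ 2 := by
  rw [← mul_pow, d.scale_mul_cos hx, Real.sq_sqrt (by linarith [hx.1])]; ring

/-- This is cos² p - cos² q = sin (p + q) sin (q - p). It turns products over x - b_j into products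
of sines of η ± ν_j. -/
theorem sub_eq_sin_mul_sin {x y : ℝ} (hx : x ∈ Icc d.a₁ d.a₂) (hy : y ∈ Icc d.a₁ d.a₂) :
    x - y = d.scale ^ 2 *
      (Real.sin (d.angle x + d.angle y) * Real.sin (d.angle y - d.angle x)) := by
  conv_lhs => rw [d.eq_add_cos_sq hx, d.eq_add_cos_sq hy]
  rw [Real.sin_add, Real.sin_sub]
  generalize d.angle x = p
  generalize d.angle y = q
  linear_combination (d.scale ^ 2 * Real.cos q ^ 2) * Real.sin_sq_add_cos_sq p -
    (d.scale ^ 2 * Real.cos p ^ 2) * Real.sin_sq_add_cos_sq q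

theorem angle_c_lt {i j : ℕ} (hij : i < j) (hj : j ≤ d.n + 1) :
    d.angle (d.c j) < d.angle (d.c i) :=
  d.angle_lt (d.a₁_le_c (by omega)) (d.c_lt hij hj) (d.c_le_a₂ hj)

theorem nu_eq_angle_c {j : ℕ} (h1 : 1 ≤ j) (h2 : j ≤ d.n) : d.nu j = d.angle (d.c j) := by
  rw [d.c_of_mem h1 h2, nu_eq]

theorem sin_angle_c_sub_ne_zero {i j : ℕ} (hi : i ≤ d.n + 1) (hj : j ≤ d.n + 1) (hij : i ≠ j) :
    Real.sin (d.angle (d.c i) - d.angle (d.c j)) ≠ 0 := by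
  have hpi := Real.pi_pos
  have a1 := d.angle_nonneg (d.c i)
  have a2 := d.angle_nonneg (d.c j)
  have a3 := d.angle_le (d.c i)
  have a4 := d.angle_le (d.c j)
  rcases hij.lt_or_gt with h | h
  · have := d.angle_c_lt h hj
    exact (Real.sin_pos_of_pos_of_lt_pi (by linarith) (by linarith)).ne'
  · have := d.angle_c_lt h hi
    exact (Real.sin_neg_of_neg_of_neg_pi_lt (by linarith) (by linarith)).ne

/-! ### Partial fractions with poles at the even and at the odd double points. -/

/-- `∑ⱼ (-1)^(j+1) ν_j`, the value of `α`. -/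
def angleSum : ℝ := ∑ j ∈ Finset.Icc 1 d.n, (-1) ^ (j + 1) * d.nu j

theorem prod_range_erase_succ {M : Type*} [CommMonoid M] (f : ℕ → M) (m j : ℕ) :
    ∏ i ∈ (Finset.range m).erase j, f (i + 1) = ∏ i ∈ (Finset.Icc 1 m).erase (j + 1), f i :=
  Finset.prod_nbij' (· + 1) (· - 1) (by simp) (by simp; omega) (by simp)
    (fun i hi => Nat.sub_add_cancel (by simp at hi; omega)) (by simp)

theorem prod_range_succ_eq_Icc {M : Type*} [CommMonoid M] (f : ℕ → M) (m : ℕ) :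
    ∏ i ∈ Finset.range m, f (i + 1) = ∏ i ∈ Finset.Icc 1 m, f i :=
  Finset.prod_nbij' (· + 1) (· - 1) (by simp) (by simp; omega) (by simp)
    (fun i hi => Nat.sub_add_cancel (by simp at hi; omega)) (by simp)

theorem sum_range_succ_eq_Icc {M : Type*} [AddCommMonoid M] (f : ℕ → M) (m : ℕ) :
    ∑ i ∈ Finset.range m, f (i + 1) = ∑ i ∈ Finset.Icc 1 m, f i :=
  Finset.sum_nbij' (· + 1) (· - 1) (by simp) (by simp; omega) (by simp)
    (fun i hi => Nat.sub_add_cancel (by simp at hi; omega)) (by simp)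

theorem one_le_evenIdx (l : Fin d.Neven) : 1 ≤ d.evenIdx l := by simp [evenIdx]

theorem evenIdx_le (l : Fin d.Neven) : d.evenIdx l ≤ d.n := by
  have := l.2; simp only [evenIdx, Neven] at *; omega

theorem one_le_oddIdx (l : Fin d.Nodd) : 1 ≤ d.oddIdx l := by simp [oddIdx]

theorem oddIdx_le (l : Fin d.Nodd) : d.oddIdx l ≤ d.n := by
  have := l.2; simp only [oddIdx, Nodd] at *; omega

/-- An instance of `prod_sin_zpow_eq` at the angles of c_1, …, c_{2N+1}. For even n the last point
is a₂, of angle 0: it supplies sin t on the left and sin ν_j in `k`, and adds nothing to `angleSum`.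
For odd n the last point is b_n. By `prod_sin_sub_eq_neg` all residues carry the same minus sign. -/
theorem even_partial_fractions (t : ℝ)
    (ht : ∀ l : Fin d.Neven, Real.sin (t + d.nu (d.evenIdx l)) ≠ 0) :
    (if Even d.n then Real.sin t else 1) *
        ∏ j ∈ Finset.Icc 1 d.n, Real.sin (t + d.nu j) ^ ((-1 : ℤ) ^ (j + 1)) =
      Real.sin (t + d.angleSum) -
        ∑ l, 2 * d.k (d.evenIdx l) / d.scale ^ 2 / Real.sin (t + d.nu (d.evenIdx l)) := by
  have hm : ∀ i, i < 2 * d.Neven + 1 → i + 1 ≤ d.n + 1 := fun i hi => by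
    simp only [Neven] at hi; omega
  have hnu : ∀ l : Fin d.Neven, d.angle (d.c (2 * (l : ℕ) + 1 + 1)) = d.nu (d.evenIdx l) := fun l =>
    (d.nu_eq_angle_c (d.one_le_evenIdx l) (d.evenIdx_le l)).symm
  have h := prod_sin_zpow_eq (fun i => d.angle (d.c (i + 1))) d.Neven
    (fun i hi j hj hij => d.sin_angle_c_sub_ne_zero (hm i hi) (hm j hj) (by omega)) t
    (fun j hj => by
      have := ht ⟨j, hj⟩
      rwa [← hnu ⟨j, hj⟩] at this)
  have hres : ∀ j ∈ Finset.range d.Neven,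
      (∏ i ∈ (Finset.range (2 * d.Neven + 1)).erase (2 * j + 1),
        Real.sin (d.angle (d.c (i + 1)) - d.angle (d.c (2 * j + 1 + 1))) ^ ((-1 : ℤ) ^ i)) /
          Real.sin (t + d.angle (d.c (2 * j + 1 + 1))) =
      (fun j => -(∏ i ∈ (Finset.Icc 1 (2 * d.Neven + 1)).erase (2 * j + 2),
        Real.sin |d.angle (d.c i) - d.angle (d.c (2 * j + 2))| ^ ((-1 : ℤ) ^ (i + 1))) /
          Real.sin (t + d.angle (d.c (2 * j + 1 + 1)))) j := by
    intro j hj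
    rw [prod_sin_sub_eq_neg (fun i => d.angle (d.c (i + 1))) d.Neven j (Finset.mem_range.mp hj)
      (fun i _ l hl hil => d.angle_c_lt (by omega) (hm l hl))]
    simp only [← prod_range_erase_succ, pow_succ, mul_neg, mul_one, neg_neg]
  rw [Finset.sum_congr rfl hres, Finset.sum_range (n := d.Neven)] at h
  rw [show ∏ i ∈ Finset.range (2 * d.Neven + 1),
        Real.sin (t + d.angle (d.c (i + 1))) ^ ((-1 : ℤ) ^ i) =
      ∏ i ∈ Finset.Icc 1 (2 * d.Neven + 1),
        Real.sin (t + d.angle (d.c i)) ^ ((-1 : ℤ) ^ (i + 1)) by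
      rw [← prod_range_succ_eq_Icc]; simp only [pow_succ, mul_neg, mul_one, neg_neg],
    show ∑ i ∈ Finset.range (2 * d.Neven + 1), (-1 : ℝ) ^ i * d.angle (d.c (i + 1)) =
      ∑ i ∈ Finset.Icc 1 (2 * d.Neven + 1), (-1 : ℝ) ^ (i + 1) * d.angle (d.c i) by
      rw [← sum_range_succ_eq_Icc]; simp only [pow_succ, mul_neg, mul_one, neg_neg]] at h
  have hk : ∀ l : Fin d.Neven, ∏ i ∈ (Finset.Icc 1 (2 * d.Neven + 1)).erase (2 * (l : ℕ) + 2),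
        Real.sin |d.angle (d.c i) - d.angle (d.c (2 * (l : ℕ) + 2))| ^ ((-1 : ℤ) ^ (i + 1)) =
      2 * d.k (d.evenIdx l) / d.scale ^ 2 := by
    intro l
    have hd : d.a₂ - d.a₁ ≠ 0 := (sub_pos.mpr d.a₁_lt_a₂).ne'
    have hne : ¬Odd (d.evenIdx l) := by
      rw [Nat.not_odd_iff_even, evenIdx]
      exact ⟨l + 1, by ring⟩
    have e1 : ∏ i ∈ (Finset.Icc 1 d.n).erase (2 * (l : ℕ) + 2),
        Real.sin |d.angle (d.c i) - d.angle (d.c (2 * (l : ℕ) + 2))| ^ ((-1 : ℤ) ^ (i + 1)) =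
        ∏ i ∈ (Finset.Icc 1 d.n).erase (d.evenIdx l),
        Real.sin |d.nu i - d.nu (d.evenIdx l)| ^ ((-1 : ℤ) ^ (i + 1)) := by
      refine Finset.prod_congr rfl fun i hi => ?_
      have hi' := Finset.mem_Icc.mp (Finset.mem_of_mem_erase hi)
      rw [d.nu_eq_angle_c hi'.1 hi'.2, ← hnu l]
    have e2 : 2 * d.k (d.evenIdx l) / d.scale ^ 2 =
        (if Even d.n then Real.sin (d.nu (d.evenIdx l)) else 1) *
        ∏ i ∈ (Finset.Icc 1 d.n).erase (d.evenIdx l),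
          Real.sin |d.nu i - d.nu (d.evenIdx l)| ^ ((-1 : ℤ) ^ (i + 1)) := by
      rw [k, if_neg hne, d.scale_sq]; field_simp
    rw [e2, ← e1]
    by_cases hn : Even d.n
    · have hnn : 2 * d.Neven + 1 = d.n + 1 := by
        rw [Neven]; have := Nat.two_mul_div_two_of_even hn; omega
      have hl := d.evenIdx_le l
      rw [hnn, if_pos hn, ← Finset.insert_Icc_right_eq_Icc_add_one (by omega),
        Finset.erase_insert_of_ne (by simp only [evenIdx] at hl; omega),
        Finset.prod_insert (by simp)]
      congr 1
      rw [c_last, angle_a₂, zero_sub, abs_neg, abs_of_nonneg (d.angle_nonneg _),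
        show d.n + 1 + 1 = d.n + 2 by ring, pow_add, hn.neg_one_pow, hnu l]
      simp
    · have hnn : 2 * d.Neven + 1 = d.n := by
        rw [Neven]; have := Nat.two_mul_div_two_add_one_of_odd (Nat.not_even_iff_odd.mp hn); omega
      rw [hnn, if_neg hn, one_mul]
  have e3 : ∏ i ∈ Finset.Icc 1 (2 * d.Neven + 1),
      Real.sin (t + d.angle (d.c i)) ^ ((-1 : ℤ) ^ (i + 1)) =
      (if Even d.n then Real.sin t else 1) *
        ∏ j ∈ Finset.Icc 1 d.n, Real.sin (t + d.nu j) ^ ((-1 : ℤ) ^ (j + 1)) := by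
    have e1 : ∏ i ∈ Finset.Icc 1 d.n, Real.sin (t + d.angle (d.c i)) ^ ((-1 : ℤ) ^ (i + 1)) =
        ∏ j ∈ Finset.Icc 1 d.n, Real.sin (t + d.nu j) ^ ((-1 : ℤ) ^ (j + 1)) :=
      Finset.prod_congr rfl fun i hi => by
        have hi' := Finset.mem_Icc.mp hi
        rw [d.nu_eq_angle_c hi'.1 hi'.2]
    rw [← e1]
    by_cases hn : Even d.n
    · have hnn : 2 * d.Neven + 1 = d.n + 1 := by
        rw [Neven]; have := Nat.two_mul_div_two_of_even hn; omega
      rw [hnn, if_pos hn, ← Finset.insert_Icc_right_eq_Icc_add_one (by omega),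
        Finset.prod_insert (by simp)]
      congr 1
      rw [c_last, angle_a₂, show d.n + 1 + 1 = d.n + 2 by ring, pow_add, hn.neg_one_pow]
      simp
    · have hnn : 2 * d.Neven + 1 = d.n := by
        rw [Neven]; have := Nat.two_mul_div_two_add_one_of_odd (Nat.not_even_iff_odd.mp hn); omega
      rw [hnn, if_neg hn, one_mul]
  have e4 : ∑ i ∈ Finset.Icc 1 (2 * d.Neven + 1), (-1 : ℝ) ^ (i + 1) * d.angle (d.c i) =
      d.angleSum := by
    have e1 : ∑ i ∈ Finset.Icc 1 d.n, (-1 : ℝ) ^ (i + 1) * d.angle (d.c i) = d.angleSum :=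
      Finset.sum_congr rfl fun i hi => by
        have hi' := Finset.mem_Icc.mp hi
        rw [d.nu_eq_angle_c hi'.1 hi'.2]
    rw [← e1]
    by_cases hn : Even d.n
    · have hnn : 2 * d.Neven + 1 = d.n + 1 := by
        rw [Neven]; have := Nat.two_mul_div_two_of_even hn; omega
      rw [hnn, ← Finset.insert_Icc_right_eq_Icc_add_one (by omega), Finset.sum_insert (by simp),
        c_last, angle_a₂, mul_zero, zero_add]
    · have hnn : 2 * d.Neven + 1 = d.n := by
        rw [Neven]; have := Nat.two_mul_div_two_add_one_of_odd (Nat.not_even_iff_odd.mp hn); omega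
      rw [hnn]
  rw [← e3, h, e4, sub_eq_add_neg, ← Finset.sum_neg_distrib]
  congr 1
  refine Finset.sum_congr rfl fun l _ => ?_
  rw [hk, hnu, neg_div]

/-- The same at the angles of c_0, …, c_{2Ñ}. The point c_0 = a₁ has angle π/2: it supplies cos t on
the left, cos ν_j in `k`, and the shift that turns the sine of the regular term into a cosine. Here
a₂ occurs exactly for odd n. -/
theorem odd_partial_fractions (t : ℝ)
    (ht : ∀ l : Fin d.Nodd, Real.sin (t + d.nu (d.oddIdx l)) ≠ 0) :
    Real.cos t * (if Odd d.n then Real.sin t else 1) *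
        ∏ j ∈ Finset.Icc 1 d.n, Real.sin (t + d.nu j) ^ ((-1 : ℤ) ^ j) =
      Real.cos (t - d.angleSum) -
        ∑ l, 2 * d.k (d.oddIdx l) / d.scale ^ 2 / Real.sin (t + d.nu (d.oddIdx l)) := by
  have hm : ∀ i, i < 2 * d.Nodd + 1 → i ≤ d.n + 1 := fun i hi => by
    simp only [Nodd] at hi; omega
  have hnu : ∀ l : Fin d.Nodd, d.angle (d.c (2 * (l : ℕ) + 1)) = d.nu (d.oddIdx l) := fun l =>
    (d.nu_eq_angle_c (d.one_le_oddIdx l) (d.oddIdx_le l)).symm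
  have h := prod_sin_zpow_eq (fun i => d.angle (d.c i)) d.Nodd
    (fun i hi j hj hij => d.sin_angle_c_sub_ne_zero (hm i hi) (hm j hj) (by omega)) t
    (fun j hj => by
      have := ht ⟨j, hj⟩
      rwa [← hnu ⟨j, hj⟩] at this)
  have hres : ∀ j ∈ Finset.range d.Nodd,
      (∏ i ∈ (Finset.range (2 * d.Nodd + 1)).erase (2 * j + 1),
        Real.sin (d.angle (d.c i) - d.angle (d.c (2 * j + 1))) ^ ((-1 : ℤ) ^ i)) /
          Real.sin (t + d.angle (d.c (2 * j + 1))) =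
      (fun j => -(∏ i ∈ (Finset.range (2 * d.Nodd + 1)).erase (2 * j + 1),
        Real.sin |d.angle (d.c i) - d.angle (d.c (2 * j + 1))| ^ ((-1 : ℤ) ^ i)) /
          Real.sin (t + d.angle (d.c (2 * j + 1)))) j := by
    intro j hj
    rw [prod_sin_sub_eq_neg (fun i => d.angle (d.c i)) d.Nodd j (Finset.mem_range.mp hj)
      (fun i _ l hl hil => d.angle_c_lt (by omega) (hm l hl))]
  rw [Finset.sum_congr rfl hres, Finset.sum_range (n := d.Nodd)] at h
  have hr : Finset.range (2 * d.Nodd + 1) =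
      insert 0 (if Odd d.n then insert (d.n + 1) (Finset.Icc 1 d.n) else Finset.Icc 1 d.n) := by
    ext i
    split_ifs with hn
    · have : 2 * d.Nodd = d.n + 1 := by
        rw [Nodd]; have := Nat.two_mul_div_two_add_one_of_odd hn; omega
      simp; omega
    · have : 2 * d.Nodd = d.n := by
        rw [Nodd]; have := Nat.two_mul_div_two_of_even (Nat.not_odd_iff_even.mp hn); omega
      simp; omega
  have h0 : (0 : ℕ) ∉ (if Odd d.n then insert (d.n + 1) (Finset.Icc 1 d.n) else Finset.Icc 1 d.n) := by
    split_ifs <;> simp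
  have hk : ∀ l : Fin d.Nodd, ∏ i ∈ (Finset.range (2 * d.Nodd + 1)).erase (2 * (l : ℕ) + 1),
        Real.sin |d.angle (d.c i) - d.angle (d.c (2 * (l : ℕ) + 1))| ^ ((-1 : ℤ) ^ i) =
      2 * d.k (d.oddIdx l) / d.scale ^ 2 := by
    intro l
    have hd : d.a₂ - d.a₁ ≠ 0 := (sub_pos.mpr d.a₁_lt_a₂).ne'
    have hne : Odd (d.oddIdx l) := ⟨l, rfl⟩
    have e1 : ∏ i ∈ (Finset.Icc 1 d.n).erase (2 * (l : ℕ) + 1),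
        Real.sin |d.angle (d.c i) - d.angle (d.c (2 * (l : ℕ) + 1))| ^ ((-1 : ℤ) ^ i) =
        ∏ i ∈ (Finset.Icc 1 d.n).erase (d.oddIdx l),
        Real.sin |d.nu i - d.nu (d.oddIdx l)| ^ ((-1 : ℤ) ^ i) := by
      refine Finset.prod_congr rfl fun i hi => ?_
      have hi' := Finset.mem_Icc.mp (Finset.mem_of_mem_erase hi)
      rw [d.nu_eq_angle_c hi'.1 hi'.2, ← hnu l]
    have e2 : 2 * d.k (d.oddIdx l) / d.scale ^ 2 = Real.cos (d.nu (d.oddIdx l)) *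
        ((if Odd d.n then Real.sin (d.nu (d.oddIdx l)) else 1) *
        ∏ i ∈ (Finset.Icc 1 d.n).erase (d.oddIdx l),
          Real.sin |d.nu i - d.nu (d.oddIdx l)| ^ ((-1 : ℤ) ^ i)) := by
      rw [k, if_pos hne, d.scale_sq]; field_simp
    have hl := d.oddIdx_le l
    simp only [oddIdx] at hl
    rw [e2, ← e1, hr, Finset.erase_insert_of_ne (by omega),
      Finset.prod_insert (fun h => h0 (Finset.mem_of_mem_erase h))]
    congr 1
    · rw [c_zero, angle_a₁, hnu, abs_of_nonneg (sub_nonneg.mpr (d.nu_le _)), pow_zero, zpow_one, Real.sin_pi_div_two_sub]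
    · split_ifs with hn
      · rw [Finset.erase_insert_of_ne (by omega), Finset.prod_insert (by simp)]
        congr 1
        rw [c_last, angle_a₂, zero_sub, abs_neg, abs_of_nonneg (d.angle_nonneg _), hn.add_one.neg_one_pow,
          hnu l, zpow_one]
      · rw [one_mul]
  have e3 : ∏ i ∈ Finset.range (2 * d.Nodd + 1),
      Real.sin (t + d.angle (d.c i)) ^ ((-1 : ℤ) ^ i) =
      Real.cos t * (if Odd d.n then Real.sin t else 1) *
        ∏ j ∈ Finset.Icc 1 d.n, Real.sin (t + d.nu j) ^ ((-1 : ℤ) ^ j) := by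
    have e1 : ∏ i ∈ Finset.Icc 1 d.n, Real.sin (t + d.angle (d.c i)) ^ ((-1 : ℤ) ^ i) =
        ∏ j ∈ Finset.Icc 1 d.n, Real.sin (t + d.nu j) ^ ((-1 : ℤ) ^ j) :=
      Finset.prod_congr rfl fun i hi => by
        have hi' := Finset.mem_Icc.mp hi
        rw [d.nu_eq_angle_c hi'.1 hi'.2]
    rw [← e1, hr, Finset.prod_insert h0, mul_assoc]
    congr 1
    · rw [c_zero, angle_a₁, pow_zero, zpow_one, Real.sin_add_pi_div_two]
    · split_ifs with hn
      · rw [Finset.prod_insert (by simp)]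
        congr 1
        rw [c_last, angle_a₂, hn.add_one.neg_one_pow, zpow_one, add_zero]
      · rw [one_mul]
  have e4 : ∑ i ∈ Finset.range (2 * d.Nodd + 1), (-1 : ℝ) ^ i * d.angle (d.c i) =
      π / 2 - d.angleSum := by
    have e1 : ∑ i ∈ Finset.Icc 1 d.n, (-1 : ℝ) ^ i * d.angle (d.c i) = -d.angleSum := by
      rw [angleSum, ← Finset.sum_neg_distrib]
      refine Finset.sum_congr rfl fun i hi => ?_
      have hi' := Finset.mem_Icc.mp hi
      rw [d.nu_eq_angle_c hi'.1 hi'.2]; ring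
    rw [hr, Finset.sum_insert h0, c_zero, angle_a₁, pow_zero, one_mul, sub_eq_add_neg, ← e1]
    congr 1
    split_ifs with hn
    · rw [Finset.sum_insert (by simp), c_last, angle_a₂, mul_zero, zero_add]
    · rfl
  rw [← e3, h, e4, sub_eq_add_neg (Real.cos _), ← Finset.sum_neg_distrib,
    show t + (π / 2 - d.angleSum) = t - d.angleSum + π / 2 by ring, Real.sin_add_pi_div_two]
  congr 1
  refine Finset.sum_congr rfl fun l _ => ?_
  rw [hk, hnu, neg_div]

/-- The coefficient of `cos η` in the partial fraction expansion with poles at the even `b j`. -/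
def evenU (x : ℝ) : ℝ := Real.sin d.angleSum / 2 -
  ∑ l, d.k (d.evenIdx l) * Real.sin (d.nu (d.evenIdx l)) / (x - d.b (d.evenIdx l))

/-- The coefficient of `sin η` in the partial fraction expansion with poles at the even `b j`. -/
def evenV (x : ℝ) : ℝ := Real.cos d.angleSum / 2 +
  ∑ l, d.k (d.evenIdx l) * Real.cos (d.nu (d.evenIdx l)) / (x - d.b (d.evenIdx l))

/-- The coefficient of `cos η` in the partial fraction expansion with poles at the odd `b j`. -/
def oddU (x : ℝ) : ℝ := Real.sin (π / 2 - d.angleSum) / 2 -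
  ∑ l, d.k (d.oddIdx l) * Real.sin (d.nu (d.oddIdx l)) / (x - d.b (d.oddIdx l))

/-- The coefficient of `sin η` in the partial fraction expansion with poles at the odd `b j`. -/
def oddV (x : ℝ) : ℝ := Real.cos (π / 2 - d.angleSum) / 2 +
  ∑ l, d.k (d.oddIdx l) * Real.cos (d.nu (d.oddIdx l)) / (x - d.b (d.oddIdx l))

/-- `∏ⱼ sin (η + ν_j)^((-1)^(j+1))`. -/
def addProd (t : ℝ) : ℝ := ∏ j ∈ Finset.Icc 1 d.n, Real.sin (t + d.nu j) ^ ((-1 : ℤ) ^ (j + 1))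

/-- `∏ⱼ sin (η - ν_j)^((-1)^(j+1))`. -/
def subProd (t : ℝ) : ℝ := ∏ j ∈ Finset.Icc 1 d.n, Real.sin (t - d.nu j) ^ ((-1 : ℤ) ^ (j + 1))

theorem b_mem {j : ℕ} (h1 : 1 ≤ j) (h2 : j ≤ d.n) : d.b j ∈ Ioo d.a₁ d.a₂ := by
  rw [← d.c_of_mem h1 h2, ← c_zero, ← c_last]
  exact ⟨d.c_lt (by omega) (by omega), d.c_lt (by omega) le_rfl⟩

theorem ne_b_of_mem_Ioo {i j : ℕ} (hi : i ≤ d.n) {x : ℝ} (hx : x ∈ Ioo (d.c i) (d.c (i + 1)))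
    (h1 : 1 ≤ j) (h2 : j ≤ d.n) : x ≠ d.b j := by
  rintro rfl
  rw [← d.c_of_mem h1 h2] at hx
  rcases le_or_gt j i with h | h
  · linarith [hx.1, d.c_le h (by omega)]
  · linarith [hx.2, d.c_le (show i + 1 ≤ j from h) (by omega)]

theorem sin_angle_add_nu_pos {x : ℝ} (hx : x ∈ Ioo d.a₁ d.a₂) (j : ℕ) :
    0 < Real.sin (d.angle x + d.nu j) := by
  have h1 := d.angle_pos hx
  have h2 := d.angle_lt_pi_div_two hx
  have h3 := d.nu_le j
  have h4 : 0 ≤ d.nu j := Real.arccos_nonneg _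
  exact Real.sin_pos_of_pos_of_lt_pi (by linarith) (by linarith)

theorem sub_b_eq {x : ℝ} (hx : x ∈ Ioo d.a₁ d.a₂) {j : ℕ} (h1 : 1 ≤ j) (h2 : j ≤ d.n) :
    x - d.b j = d.scale ^ 2 *
      (Real.sin (d.angle x + d.nu j) * Real.sin (d.nu j - d.angle x)) :=
  d.sub_eq_sin_mul_sin (Ioo_subset_Icc_self hx) (Ioo_subset_Icc_self (d.b_mem h1 h2))

theorem sin_nu_sub_angle_ne_zero {x : ℝ} (hx : x ∈ Ioo d.a₁ d.a₂) {j : ℕ} (h1 : 1 ≤ j)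
    (h2 : j ≤ d.n) (hne : x ≠ d.b j) : Real.sin (d.nu j - d.angle x) ≠ 0 := by
  intro h
  have := d.sub_b_eq hx h1 h2
  rw [h, mul_zero, mul_zero, sub_eq_zero] at this
  exact hne this

/-- By `h`, 1 / sin (t + ν) = `scale`² sin (ν - t) / (x - b), and expanding sin (ν - t) leaves
coefficients that depend on `x` alone. The parameter `t` is free because `h` holds for the angle of
`x` and for its negative. -/
theorem even_expansion (x t : ℝ) (h : ∀ l, x - d.b (d.evenIdx l) = d.scale ^ 2 *
      (Real.sin (t + d.nu (d.evenIdx l)) * Real.sin (d.nu (d.evenIdx l) - t)))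
    (hne : ∀ l, x ≠ d.b (d.evenIdx l)) :
    (if Even d.n then Real.sin t else 1) * d.addProd t =
      2 * (d.evenV x * Real.sin t + d.evenU x * Real.cos t) := by
  have h0 := d.scale_pos.ne'
  have h1 : ∀ l, Real.sin (t + d.nu (d.evenIdx l)) ≠ 0 := fun l e => by
    have := h l
    rw [e, zero_mul, mul_zero, sub_eq_zero] at this
    exact hne l this
  have h2 : ∀ l, Real.sin (d.nu (d.evenIdx l) - t) ≠ 0 := fun l e => by
    have := h l
    rw [e, mul_zero, mul_zero, sub_eq_zero] at this
    exact hne l this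
  rw [addProd, d.even_partial_fractions t h1, evenV, evenU]
  have : ∑ l, 2 * d.k (d.evenIdx l) / d.scale ^ 2 / Real.sin (t + d.nu (d.evenIdx l)) =
      2 * ((∑ l, d.k (d.evenIdx l) * Real.sin (d.nu (d.evenIdx l)) / (x - d.b (d.evenIdx l))) *
        Real.cos t - (∑ l, d.k (d.evenIdx l) * Real.cos (d.nu (d.evenIdx l)) /
          (x - d.b (d.evenIdx l))) * Real.sin t) := by
    rw [Finset.sum_mul, Finset.sum_mul, ← Finset.sum_sub_distrib, Finset.mul_sum]
    refine Finset.sum_congr rfl fun l _ => ?_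
    have h1' := h1 l
    have h2' := h2 l
    rw [h l]
    field_simp
    rw [Real.sin_sub]
  rw [this, Real.sin_add]; ring

theorem odd_expansion (x t : ℝ) (h : ∀ l, x - d.b (d.oddIdx l) = d.scale ^ 2 *
      (Real.sin (t + d.nu (d.oddIdx l)) * Real.sin (d.nu (d.oddIdx l) - t)))
    (hne : ∀ l, x ≠ d.b (d.oddIdx l)) :
    Real.cos t * (if Odd d.n then Real.sin t else 1) * (d.addProd t)⁻¹ =
      2 * (d.oddV x * Real.sin t + d.oddU x * Real.cos t) := by
  have h0 := d.scale_pos.ne'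
  have h1 : ∀ l, Real.sin (t + d.nu (d.oddIdx l)) ≠ 0 := fun l e => by
    have := h l
    rw [e, zero_mul, mul_zero, sub_eq_zero] at this
    exact hne l this
  have h2 : ∀ l, Real.sin (d.nu (d.oddIdx l) - t) ≠ 0 := fun l e => by
    have := h l
    rw [e, mul_zero, mul_zero, sub_eq_zero] at this
    exact hne l this
  have hinv : (d.addProd t)⁻¹ =
      ∏ j ∈ Finset.Icc 1 d.n, Real.sin (t + d.nu j) ^ ((-1 : ℤ) ^ j) := by
    rw [addProd, ← Finset.prod_inv_distrib]
    exact Finset.prod_congr rfl fun j _ => by rw [← zpow_neg, pow_succ]; simp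
  rw [hinv, d.odd_partial_fractions t h1, oddV, oddU, Real.sin_pi_div_two_sub,
    Real.cos_pi_div_two_sub]
  have : ∑ l, 2 * d.k (d.oddIdx l) / d.scale ^ 2 / Real.sin (t + d.nu (d.oddIdx l)) =
      2 * ((∑ l, d.k (d.oddIdx l) * Real.sin (d.nu (d.oddIdx l)) / (x - d.b (d.oddIdx l))) *
        Real.cos t - (∑ l, d.k (d.oddIdx l) * Real.cos (d.nu (d.oddIdx l)) /
          (x - d.b (d.oddIdx l))) * Real.sin t) := by
    rw [Finset.sum_mul, Finset.sum_mul, ← Finset.sum_sub_distrib, Finset.mul_sum]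
    refine Finset.sum_congr rfl fun l _ => ?_
    have h1' := h1 l
    have h2' := h2 l
    rw [h l]
    field_simp
    rw [Real.sin_sub]
  rw [this, Real.cos_sub]; ring

theorem addProd_neg (t : ℝ) : d.addProd (-t) = (-1) ^ d.n * d.subProd t := by
  have hc : ((-1 : ℝ)) ^ d.n = ∏ _j ∈ Finset.Icc 1 d.n, (-1 : ℝ) := by simp
  rw [addProd, subProd, hc, ← Finset.prod_mul_distrib]
  refine Finset.prod_congr rfl fun j _ => ?_
  rw [show -t + d.nu j = -(t - d.nu j) by ring, Real.sin_neg]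
  rcases neg_one_pow_eq_or ℤ (j + 1) with h | h <;> rw [h]
  · simp
  · simp [zpow_neg, inv_neg]

theorem addProd_pos {x : ℝ} (hx : x ∈ Ioo d.a₁ d.a₂) : 0 < d.addProd (d.angle x) :=
  Finset.prod_pos fun j _ => zpow_pos (d.sin_angle_add_nu_pos hx j) _

theorem sin_angle_sub_nu_pos {i j : ℕ} (hi : i ≤ d.n) {x : ℝ}
    (hx : x ∈ Ioo (d.c i) (d.c (i + 1))) (h2 : j ≤ d.n) (hij : i < j) :
    0 < Real.sin (d.angle x - d.nu j) := by
  have hx' := d.Ioo_subset hi hx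
  have := d.angle_lt (x := x) (y := d.c j) hx'.1.le
    (hx.2.trans_le (d.c_le hij (by omega))) (d.c_le_a₂ (by omega))
  rw [d.nu_eq_angle_c (by omega) h2]
  have h1 := d.angle_lt_pi_div_two hx'
  have h3 := d.angle_nonneg (d.c j)
  exact Real.sin_pos_of_pos_of_lt_pi (by linarith) (by linarith [Real.pi_pos])

theorem sin_angle_sub_nu_neg {i j : ℕ} (hi : i ≤ d.n) {x : ℝ}
    (hx : x ∈ Ioo (d.c i) (d.c (i + 1))) (h1 : 1 ≤ j) (hij : j ≤ i) :
    Real.sin (d.angle x - d.nu j) < 0 := by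
  have hx' := d.Ioo_subset hi hx
  have := d.angle_lt (x := d.c j) (y := x) (d.a₁_le_c (by omega))
    ((d.c_le hij (by omega)).trans_lt hx.1) hx'.2.le
  rw [d.nu_eq_angle_c h1 (by omega)]
  have h1 := d.angle_le (d.c j)
  have h3 := d.angle_nonneg x
  exact Real.sin_neg_of_neg_of_neg_pi_lt (by linarith) (by linarith [Real.pi_pos])

/-- Exactly the factors with j ≤ i are negative, and an exponent ±1 keeps the sign of its base. -/
theorem subProd_eq {i : ℕ} (hi : i ≤ d.n) {x : ℝ} (hx : x ∈ Ioo (d.c i) (d.c (i + 1))) :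
    d.subProd (d.angle x) = (-1) ^ i * |d.subProd (d.angle x)| := by
  rw [subProd, Finset.abs_prod]
  have h : ∀ j ∈ Finset.Icc 1 d.n, Real.sin (d.angle x - d.nu j) ^ ((-1 : ℤ) ^ (j + 1)) =
      (if j ≤ i then -1 else 1) * |Real.sin (d.angle x - d.nu j) ^ ((-1 : ℤ) ^ (j + 1))| := by
    intro j hj
    have hj' := Finset.mem_Icc.mp hj
    split_ifs with hji
    · have := d.sin_angle_sub_nu_neg hi hx hj'.1 hji
      rcases neg_one_pow_eq_or ℤ (j + 1) with h | h <;> rw [h]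
      · rw [zpow_one, abs_of_neg this]; ring
      · rw [zpow_neg, zpow_one, abs_of_neg (inv_lt_zero.mpr this)]; ring
    · have := d.sin_angle_sub_nu_pos hi hx hj'.2 (by omega)
      rw [abs_of_pos (zpow_pos this _), one_mul]
  conv_lhs => rw [Finset.prod_congr rfl h, Finset.prod_mul_distrib, Finset.prod_ite,
    Finset.prod_const, Finset.prod_const_one, mul_one]
  rw [show Finset.filter (fun j => j ≤ i) (Finset.Icc 1 d.n) = Finset.Icc 1 i by
    ext j; simp; omega, Nat.card_Icc, Nat.add_sub_cancel]

theorem subProd_ne_zero {i : ℕ} (hi : i ≤ d.n) {x : ℝ} (hx : x ∈ Ioo (d.c i) (d.c (i + 1))) :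
    d.subProd (d.angle x) ≠ 0 := by
  refine Finset.prod_ne_zero_iff.mpr fun j hj => zpow_ne_zero _ ?_
  have hj' := Finset.mem_Icc.mp hj
  rcases le_or_gt j i with h | h
  · exact (d.sin_angle_sub_nu_neg hi hx hj'.1 h).ne
  · exact (d.sin_angle_sub_nu_pos hi hx hj'.2 h).ne'

/-! ### Boundary data: two expansions of the same weights. -/

/-- The relations between the modulus `D` of the boundary value of `B_n^{1/4}` at `x`, the modulus `ρ`
of that of `e^{g̃}`, the sign `σ` of `χ`, the normalization `m`, and the partial fraction
expansions. -/
structure IsBoundaryData (x σ ρ D m : ℝ) : Prop where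
  rho_pos : 0 < ρ
  D_pos : 0 < D
  sigma_sq : σ * σ = 1
  mem : x ∈ Ioo d.a₁ d.a₂
  even_add : m * ρ * (Real.sin (d.angle x) * Real.cos (d.angle x)) =
    D * (d.evenV x * Real.sin (d.angle x) + d.evenU x * Real.cos (d.angle x))
  even_sub : m * (σ / ρ) * (Real.sin (d.angle x) * Real.cos (d.angle x)) =
    D * (d.evenV x * Real.sin (d.angle x) - d.evenU x * Real.cos (d.angle x))
  odd_add : m * (σ / ρ) * (Real.sin (d.angle x) * Real.cos (d.angle x)) =
    σ / D * (d.oddV x * Real.sin (d.angle x) + d.oddU x * Real.cos (d.angle x))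
  odd_sub : m * ρ * (Real.sin (d.angle x) * Real.cos (d.angle x)) =
    -(σ / D) * (d.oddV x * Real.sin (d.angle x) - d.oddU x * Real.cos (d.angle x))

/-- The hypotheses fix m², ρ² and D² in terms of sines, and positivity selects the roots. This
matches ρ and 1/ρ with the left-hand sides of the even and odd expansions at the angle of `x` and at
its negative. -/
theorem isBoundaryData {i : ℕ} (hi : i ≤ d.n) {x : ℝ} (hx : x ∈ Ioo (d.c i) (d.c (i + 1)))
    {ρ D m : ℝ} (hρ : 0 < ρ) (hD : 0 < D) (hm : 0 < m)
    (hm2 : m ^ 2 * (4 * (Real.sin (d.angle x) * Real.cos (d.angle x))) = 1)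
    (hρ2 : ρ ^ 2 * |d.subProd (d.angle x)| = d.addProd (d.angle x))
    (hD2 : D ^ 2 * (d.addProd (d.angle x) * |d.subProd (d.angle x)|) =
      Real.cos (d.angle x) * Real.sin (d.angle x) ^ (-(-1 : ℤ) ^ d.n)) :
    d.IsBoundaryData x ((-1) ^ i) ρ D m := by
  have hx' := d.Ioo_subset hi hx
  have hs := d.sin_angle_pos hx'
  have hc := d.cos_angle_pos hx'
  have hP := d.addProd_pos hx'
  have hT0 := d.subProd_ne_zero hi hx
  have hT := abs_pos.mpr hT0
  have hTe := d.subProd_eq hi hx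
  have hσ : ((-1 : ℝ) ^ i) * (-1) ^ i = 1 := by
    rw [← mul_pow]; norm_num
  have hσn : ((-1 : ℝ) ^ d.n) * (-1) ^ d.n = 1 := by
    rw [← mul_pow]; norm_num
  have ee : ∀ l, x - d.b (d.evenIdx l) = _ := fun l =>
    d.sub_b_eq hx' (d.one_le_evenIdx l) (d.evenIdx_le l)
  have eo : ∀ l, x - d.b (d.oddIdx l) = _ := fun l =>
    d.sub_b_eq hx' (d.one_le_oddIdx l) (d.oddIdx_le l)
  have ne : ∀ l, x ≠ d.b (d.evenIdx l) := fun l =>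
    d.ne_b_of_mem_Ioo hi hx (d.one_le_evenIdx l) (d.evenIdx_le l)
  have no : ∀ l, x ≠ d.b (d.oddIdx l) := fun l =>
    d.ne_b_of_mem_Ioo hi hx (d.one_le_oddIdx l) (d.oddIdx_le l)
  -- The product of sines is even in η, so each expansion holds at η and at -η with the same
  -- coefficients.
  have swap : ∀ p q : ℝ, Real.sin (p + q) * Real.sin (q - p) =
      Real.sin (-p + q) * Real.sin (q - -p) := fun p q => by
    rw [show -p + q = q - p by ring, show q - -p = p + q by ring, mul_comm]
  have E1 := d.even_expansion x (d.angle x) ee ne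
  have E2 := d.even_expansion x (-d.angle x) (fun l => by rw [ee l, swap]) ne
  have O1 := d.odd_expansion x (d.angle x) eo no
  have O2 := d.odd_expansion x (-d.angle x) (fun l => by rw [eo l, swap]) no
  rw [addProd_neg, Real.sin_neg, Real.cos_neg] at E2 O2
  set s := Real.sin (d.angle x) with hsdef
  set c := Real.cos (d.angle x) with hcdef
  set P := d.addProd (d.angle x)
  set T := d.subProd (d.angle x)
  have E2' : (if Even d.n then s else 1) * T = 2 * (d.evenV x * s - d.evenU x * c) := by
    rcases Nat.even_or_odd d.n with h | h
    · rw [if_pos h, h.neg_one_pow] at E2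
      rw [if_pos h]; linarith
    · rw [if_neg (Nat.not_even_iff_odd.mpr h), h.neg_one_pow] at E2
      rw [if_neg (Nat.not_even_iff_odd.mpr h)]; linarith
  have O2' : c * (if Odd d.n then s else 1) * T⁻¹ = -2 * (d.oddV x * s - d.oddU x * c) := by
    rcases Nat.even_or_odd d.n with h | h
    · rw [if_neg (Nat.not_odd_iff_even.mpr h), h.neg_one_pow, one_mul] at O2
      rw [if_neg (Nat.not_odd_iff_even.mpr h)]; linarith
    · rw [if_pos h, h.neg_one_pow, neg_one_mul, inv_neg] at O2
      rw [if_pos h]; linarith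
  -- One of `e`, `o` is sin η and the other is 1, so the parity of n no longer matters below.
  set e : ℝ := if Even d.n then s else 1 with he
  set o : ℝ := if Odd d.n then s else 1 with ho
  have hepos : 0 < e := by rw [he]; split_ifs <;> positivity
  have hopos : 0 < o := by rw [ho]; split_ifs <;> positivity
  have heo : e * o = s := by
    rcases Nat.even_or_odd d.n with h | h
    · rw [he, ho, if_pos h, if_neg (Nat.not_odd_iff_even.mpr h), mul_one]
    · rw [he, ho, if_neg (Nat.not_even_iff_odd.mpr h), if_pos h, one_mul]
  have hz : s ^ (-(-1 : ℤ) ^ d.n) * e = o := by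
    rcases Nat.even_or_odd d.n with h | h
    · rw [he, ho, if_pos h, if_neg (Nat.not_odd_iff_even.mpr h), h.neg_one_pow, zpow_neg, zpow_one]
      field_simp
    · rw [he, ho, if_neg (Nat.not_even_iff_odd.mpr h), if_pos h, h.neg_one_pow]; simp
  have hDe : D ^ 2 * (P * |T|) * e = c * o := by rw [hD2, mul_assoc, hz]
  -- Both sides are positive, so their squares are compared; the other three relations follow from
  -- this one by `hρ2` and `hDe`.
  have r1 : 2 * m * ρ * (s * c) = D * (e * P) := by
    refine (sq_eq_sq₀ (by positivity) (by positivity)).mp ?_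
    have : (|T| * o) ≠ 0 := by positivity
    refine mul_right_cancel₀ this ?_
    linear_combination (4 * m ^ 2 * (s * c) ^ 2 * o) * hρ2 + P * o * (s * c) * hm2 -
      (e * P) * o * hDe - (P * c * o) * heo
  have hρ0 := hρ.ne'
  have hP0 := hP.ne'
  have hD0 := hD.ne'
  have hTa0 := hT.ne'
  have r2 : 2 * m * (s * c) / ρ = D * (e * |T|) := by
    rw [div_eq_iff hρ0]
    refine mul_left_cancel₀ hρ0 ?_
    linear_combination r1 - D * e * hρ2
  have r3 : 2 * m * (s * c) / ρ = D⁻¹ * (c * o * P⁻¹) := by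
    rw [r2]
    field_simp
    linear_combination hDe
  have r4 : 2 * m * ρ * (s * c) = D⁻¹ * (c * o * |T|⁻¹) := by
    rw [r1]
    field_simp
    linear_combination hDe
  have hTi : |T|⁻¹ = (-1) ^ i * T⁻¹ := by
    have hi0 : ((-1 : ℝ) ^ i) ≠ 0 := by positivity
    conv_rhs => rw [hTe]
    rw [mul_inv, ← mul_assoc, mul_inv_cancel₀ hi0, one_mul]
  refine ⟨hρ, hD, hσ, hx', ?_, ?_, ?_, ?_⟩
  · linear_combination r1 / 2 + D / 2 * E1
  · linear_combination (-1) ^ i / 2 * r2 - D * e / 2 * hTe + D / 2 * E2'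
  · linear_combination (-1) ^ i / 2 * r3 + (-1) ^ i / 2 * D⁻¹ * O1
  · rw [hTi] at r4
    linear_combination r4 / 2 + (-1) ^ i / 2 * D⁻¹ * O2'

/-! ### The determinants as a bilinear form with matrix 𝕄. -/

/-- The column `u` in terms of the boundary data. -/
def hatCol (m ρ σ η α ψ : ℝ) : Fin 2 → ℝ :=
  ![m / 2 * (ρ * Real.cos (η - α - ψ) + σ / ρ * Real.cos (η + α - ψ)),
    m / 2 * (ρ * Real.cos (η - α + ψ) + σ / ρ * Real.cos (η + α + ψ))]

/-- The column `w` in terms of the boundary data. -/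
def breveCol (m ρ σ η α ψ : ℝ) : Fin 2 → ℝ :=
  ![-(m / 2 * (ρ * Real.sin (η - α - ψ) - σ / ρ * Real.sin (η + α - ψ))),
    m / 2 * (ρ * Real.sin (η - α + ψ) - σ / ρ * Real.sin (η + α + ψ))]

/-- The vectors `f` and `h` in terms of the boundary data. -/
def boundaryVec (D σ ψ x : ℝ) : d.Idx → ℝ :=
  Sum.elim (fun l => -σ * Real.sin ψ / D / (x - d.b (d.oddIdx l)))
    (fun l => D * Real.cos ψ / (x - d.b (d.evenIdx l)))

theorem colDet_eq (u v : Fin 2 → ℝ) : colDet u v = u 0 * v 1 - v 0 * u 1 := by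
  simp [colDet, Matrix.det_fin_two]; ring

/-- In products of like weights the arguments η ∓ α enter through their difference, in mixed
products through a sum with opposite signs of α. Hence α cancels everywhere. -/
theorem colDet_hatCol_breveCol (m ρ σ η α ψ m' ρ' σ' η' ψ' : ℝ) :
    colDet (hatCol m' ρ' σ' η' α ψ') (breveCol m ρ σ η α ψ) -
      colDet (hatCol m ρ σ η α ψ) (breveCol m' ρ' σ' η' α ψ') =
    m * m' / 2 * (Real.sin (η - η') * Real.cos (ψ + ψ') * (ρ * ρ' - σ / ρ * (σ' / ρ')) +
      Real.sin (η + η') * Real.cos (ψ - ψ') * (ρ * (σ' / ρ') - σ / ρ * ρ')) := by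
  have k1 : ∀ p q r s : ℝ, Real.cos (q - s) * Real.sin (p + r) + Real.cos (q + s) * Real.sin (p - r) -
      (Real.cos (p - r) * Real.sin (q + s) + Real.cos (p + r) * Real.sin (q - s)) =
      2 * Real.sin (p - q) * Real.cos (r + s) := by
    intro p q r s
    have e1 : Real.sin (p + r) * Real.cos (q - s) - Real.cos (p + r) * Real.sin (q - s) =
        Real.sin ((p - q) + (r + s)) := by rw [← Real.sin_sub]; congr 1; ring
    have e2 : Real.sin (p - r) * Real.cos (q + s) - Real.cos (p - r) * Real.sin (q + s) =
        Real.sin ((p - q) - (r + s)) := by rw [← Real.sin_sub]; congr 1; ring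
    rw [Real.sin_add (p - q)] at e1
    rw [Real.sin_sub (p - q)] at e2
    linear_combination e1 + e2
  have k2 : ∀ p q r s : ℝ, Real.cos (q - s) * Real.sin (p + r) + Real.cos (q + s) * Real.sin (p - r) +
      (Real.cos (p - r) * Real.sin (q + s) + Real.cos (p + r) * Real.sin (q - s)) =
      2 * Real.sin (p + q) * Real.cos (r - s) := by
    intro p q r s
    have e1 : Real.sin (p + r) * Real.cos (q - s) + Real.cos (p + r) * Real.sin (q - s) =
        Real.sin ((p + q) + (r - s)) := by rw [← Real.sin_add]; congr 1; ring
    have e2 : Real.sin (p - r) * Real.cos (q + s) + Real.cos (p - r) * Real.sin (q + s) =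
        Real.sin ((p + q) - (r - s)) := by rw [← Real.sin_add]; congr 1; ring
    rw [Real.sin_add (p + q)] at e1
    rw [Real.sin_sub (p + q)] at e2
    linear_combination e1 + e2
  have h1 := k1 (η - α) (η' - α) ψ ψ'
  have h2 := k1 (η + α) (η' + α) ψ ψ'
  have h3 := k2 (η - α) (η' + α) ψ ψ'
  have h4 := k2 (η + α) (η' - α) ψ ψ'
  rw [show η - α - (η' - α) = η - η' by ring] at h1
  rw [show η + α - (η' + α) = η - η' by ring] at h2
  rw [show η - α + (η' + α) = η + η' by ring] at h3
  rw [show η + α + (η' - α) = η + η' by ring] at h4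
  simp only [colDet_eq, hatCol, breveCol, Matrix.cons_val_zero, Matrix.cons_val_one]
  generalize σ / ρ = r
  generalize σ' / ρ' = r'
  linear_combination (m * m' / 4) * (ρ * ρ' * h1 - r * r' * h2 + ρ * r' * h3 - r * ρ' * h4)

theorem evenIdx_injective : Function.Injective d.evenIdx := fun i j h => by
  simp only [evenIdx] at h; exact Fin.ext (by omega)

theorem oddIdx_injective : Function.Injective d.oddIdx := fun i j h => by
  simp only [oddIdx] at h; exact Fin.ext (by omega)

theorem b_injOn {i j : ℕ} (hi : 1 ≤ i) (hi' : i ≤ d.n) (hj : 1 ≤ j) (hj' : j ≤ d.n)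
    (h : d.b i = d.b j) : i = j := by
  rw [← d.c_of_mem hi hi', ← d.c_of_mem hj hj'] at h
  rcases lt_trichotomy i j with h' | h' | h'
  · exact absurd h (d.c_lt h' (by omega)).ne
  · exact h'
  · exact absurd h (d.c_lt h' (by omega)).ne'

theorem dotProduct_M_mulVec (a a' : Fin d.Nodd → ℝ) (b b' : Fin d.Neven → ℝ) :
    dotProduct (Sum.elim a b) (d.M.mulVec (Sum.elim a' b')) =
      (∑ j, ∑ l, a j * d.M1 j l * a' l) + ∑ j, ∑ l, b j * d.M2 j l * b' l := by
  simp [M, dotProduct, Matrix.mulVec, Finset.mul_sum, mul_assoc]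

/-- After expanding cos (ψ ± ψ'), the even relations are used for the coefficient of cos ψ cos ψ'
and the odd ones for that of sin ψ sin ψ'. This keeps even and odd poles apart and makes 𝕄 block
diagonal. -/
theorem colDet_boundary_eq (hα : d.alpha = d.angleSum) {x y σ σ' ρ ρ' D D' m m' : ℝ} (ψ ψ' : ℝ)
    (hx : d.IsBoundaryData x σ ρ D m) (hy : d.IsBoundaryData y σ' ρ' D' m')
    (hxb : ∀ j ∈ Finset.Icc 1 d.n, x ≠ d.b j) (hyb : ∀ j ∈ Finset.Icc 1 d.n, y ≠ d.b j) :
    colDet (hatCol m' ρ' σ' (d.angle y) d.alpha ψ') (breveCol m ρ σ (d.angle x) d.alpha ψ) -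
      colDet (hatCol m ρ σ (d.angle x) d.alpha ψ) (breveCol m' ρ' σ' (d.angle y) d.alpha ψ') =
    (x - y) * dotProduct (d.boundaryVec D' σ' ψ' y) (d.M.mulVec (d.boundaryVec D σ ψ x)) := by
  have hs := d.sin_angle_pos hx.mem
  have hc := d.cos_angle_pos hx.mem
  have hs' := d.sin_angle_pos hy.mem
  have hc' := d.cos_angle_pos hy.mem
  have q1 := sum_quadratic_form (fun l => d.k (d.oddIdx l)) (fun l => d.nu (d.oddIdx l))
    (fun l => d.b (d.oddIdx l)) (fun i j h => d.oddIdx_injective (d.b_injOn (d.one_le_oddIdx i)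
      (d.oddIdx_le i) (d.one_le_oddIdx j) (d.oddIdx_le j) h)) (π / 2 - d.angleSum) x y
    (fun i => hxb _ (Finset.mem_Icc.mpr ⟨d.one_le_oddIdx i, d.oddIdx_le i⟩))
    (fun i => hyb _ (Finset.mem_Icc.mpr ⟨d.one_le_oddIdx i, d.oddIdx_le i⟩))
  have q2 := sum_quadratic_form (fun l => d.k (d.evenIdx l)) (fun l => d.nu (d.evenIdx l))
    (fun l => d.b (d.evenIdx l)) (fun i j h => d.evenIdx_injective (d.b_injOn (d.one_le_evenIdx i)
      (d.evenIdx_le i) (d.one_le_evenIdx j) (d.evenIdx_le j) h)) d.angleSum x y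
    (fun i => hxb _ (Finset.mem_Icc.mpr ⟨d.one_le_evenIdx i, d.evenIdx_le i⟩))
    (fun i => hyb _ (Finset.mem_Icc.mpr ⟨d.one_le_evenIdx i, d.evenIdx_le i⟩))
  have hR : (x - y) * dotProduct (d.boundaryVec D' σ' ψ' y) (d.M.mulVec (d.boundaryVec D σ ψ x)) =
      σ * σ' * Real.sin ψ * Real.sin ψ' / (D * D') *
        (2 * (d.oddU x * d.oddV y - d.oddV x * d.oddU y)) +
      D * D' * Real.cos ψ * Real.cos ψ' *
        (2 * (d.evenU x * d.evenV y - d.evenV x * d.evenU y)) := by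
    rw [oddU, oddV, oddU, oddV, evenU, evenV, evenU, evenV, q1, q2, boundaryVec, boundaryVec,
      dotProduct_M_mulVec]
    simp only [Finset.mul_sum, mul_add]
    congr 1
    · refine Finset.sum_congr rfl fun j _ => Finset.sum_congr rfl fun l _ => ?_
      -- The odd block takes γ = π/2 - α in `sum_quadratic_form`, which is why it has a cosine where
      -- the even block has a sine.
      have hcos : Real.sin (d.nu (d.oddIdx l) + (π / 2 - d.angleSum)) =
          Real.cos (d.nu (d.oddIdx l) - d.alpha) := by
        rw [hα, ← Real.sin_add_pi_div_two]; congr 1; ring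
      simp only [M1, Matrix.of_apply, hcos, offDiag, Finset.mul_sum]
      ring
    · refine Finset.sum_congr rfl fun j _ => Finset.sum_congr rfl fun l _ => ?_
      simp only [M2, Matrix.of_apply, offDiag, Finset.mul_sum, hα]
      ring
  rw [hR, colDet_hatCol_breveCol]
  obtain ⟨-, -, -, -, e1, e2, o1, o2⟩ := hx
  obtain ⟨-, -, -, -, e1', e2', o1', o2'⟩ := hy
  set s := Real.sin (d.angle x)
  set c := Real.cos (d.angle x)
  set s' := Real.sin (d.angle y)
  set c' := Real.cos (d.angle y)
  -- The relations in `IsBoundaryData` carry the factor sin η cos η, so it is multiplied in at both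
  -- points.
  have hne : s * c * (s' * c') ≠ 0 := by positivity
  refine mul_left_cancel₀ hne ?_
  rw [Real.sin_sub, Real.sin_add, Real.cos_add, Real.cos_sub, div_eq_mul_inv _ (D * D'), mul_inv]
  rw [div_eq_mul_inv σ D] at o1 o2
  rw [div_eq_mul_inv σ' D'] at o1' o2'
  have x1 := congrArg₂ (· * ·) e1 e1'
  have x2 := congrArg₂ (· * ·) e2 e2'
  have x3 := congrArg₂ (· * ·) e1 e2'
  have x4 := congrArg₂ (· * ·) e2 e1'
  have y1 := congrArg₂ (· * ·) o1 o1'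
  have y2 := congrArg₂ (· * ·) o2 o2'
  have y3 := congrArg₂ (· * ·) o1 o2'
  have y4 := congrArg₂ (· * ·) o2 o1'
  change _ * (m * m' / 2 * ((s * c' - c * s') * _ * _ + (s * c' + c * s') * _ * _)) = _
  generalize σ / ρ = r at *
  generalize σ' / ρ' = r' at *
  generalize Real.cos ψ = a
  generalize Real.sin ψ = b
  generalize Real.cos ψ' = a'
  generalize Real.sin ψ' = b'
  linear_combination (a * a' / 2) * ((s * c' - c * s') * (x1 - x2) + (s * c' + c * s') * (x3 - x4))
    + (b * b' / 2) * (-(s * c' - c * s') * (y2 - y1) + (s * c' + c * s') * (y4 - y3))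

end Config

/-! ### Limits of logarithms and powers from the upper half-plane. -/

/-- The filter of neighbourhoods of a real point in the open upper half-plane. -/
abbrev upper (x : ℝ) : Filter ℂ := 𝓝[{z : ℂ | 0 < z.im}] (x : ℂ)

instance upper_neBot (x : ℝ) : (upper x).NeBot := by
  rw [← mem_closure_iff_nhdsWithin_neBot, Complex.closure_setOfPred_lt_im]
  simp

theorem plus_eq {f : ℂ → ℂ} {x : ℝ} {L : ℂ} (h : Tendsto f (upper x) (𝓝 L)) : plus f x = L :=
  h.limUnder_eq

/-- At a negative real point the principal logarithm is continuous from the closed upper half-plane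
only; this is the use of `him`. -/
theorem tendsto_log_upper {x : ℝ} (hx : x ≠ 0) {ι : Type*} {l : Filter ι} {f : ι → ℂ}
    (hf : Tendsto f l (𝓝 (x : ℂ))) (him : ∀ᶠ z in l, 0 ≤ (f z).im) :
    Tendsto (fun z => Complex.log (f z)) l (𝓝 (Complex.log x)) := by
  rcases hx.lt_or_gt with h | h
  · have := Complex.continuousWithinAt_log_of_re_neg_of_im_zero (z := (x : ℂ)) (by simpa) (by simp)
    exact this.tendsto.comp (tendsto_nhdsWithin_iff.mpr ⟨hf, him⟩)
  · exact (continuousAt_clog (by simp [Complex.mem_slitPlane_iff, h])).tendsto.comp hf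

theorem tendsto_cpow_upper {x : ℝ} (hx : x ≠ 0) (r : ℂ) {ι : Type*} {l : Filter ι} {f : ι → ℂ}
    (hf : Tendsto f l (𝓝 (x : ℂ))) (him : ∀ᶠ z in l, 0 ≤ (f z).im) :
    Tendsto (fun z => f z ^ r) l (𝓝 ((x : ℂ) ^ r)) := by
  have h0 : (x : ℂ) ≠ 0 := by exact_mod_cast hx
  have h1 : ∀ᶠ z in l, f z ≠ 0 := hf.eventually_ne h0
  rw [Complex.cpow_def_of_ne_zero h0]
  refine Tendsto.congr' (h1.mono fun z hz => (Complex.cpow_def_of_ne_zero hz r).symm) ?_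
  exact (Complex.continuous_exp.tendsto _).comp ((tendsto_log_upper hx hf him).mul_const r)

theorem tendsto_sub_upper (x b : ℝ) :
    Tendsto (fun z : ℂ => z - b) (upper x) (𝓝 ((x - b : ℝ) : ℂ)) := by
  have : Tendsto (fun z : ℂ => z - b) (𝓝 (x : ℂ)) (𝓝 ((x : ℂ) - b)) :=
    (continuous_id.sub continuous_const).tendsto _
  rw [Complex.ofReal_sub]
  exact this.mono_left nhdsWithin_le_nhds

theorem eventually_im_sub_upper (x b : ℝ) : ∀ᶠ z : ℂ in upper x, 0 ≤ (z - b).im := by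
  filter_upwards [self_mem_nhdsWithin] with z hz
  have : 0 < z.im := hz
  simp [this.le]

theorem tendsto_sub_cpow_upper {x b : ℝ} (hx : x ≠ b) (r : ℂ) :
    Tendsto (fun z : ℂ => (z - b) ^ r) (upper x) (𝓝 (((x - b : ℝ) : ℂ) ^ r)) :=
  tendsto_cpow_upper (sub_ne_zero.mpr hx) r (tendsto_sub_upper x b) (eventually_im_sub_upper x b)

theorem ofReal_cpow_of_pos {x : ℝ} (hx : 0 < x) (r : ℝ) : (x : ℂ) ^ (r : ℂ) = ((x ^ r : ℝ) : ℂ) :=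
  (Complex.ofReal_cpow hx.le r).symm

theorem ofReal_cpow_of_neg {x : ℝ} (hx : x < 0) (r : ℝ) :
    (x : ℂ) ^ (r : ℂ) = (((-x) ^ r : ℝ) : ℂ) * Complex.exp (π * Complex.I * r) :=
  by rw [Complex.ofReal_cpow_of_nonpos hx.le, Complex.ofReal_cpow (by linarith)]; simp

theorem sq_cpow_half (w : ℂ) : (w ^ (1 / 2 : ℂ)) ^ 2 = w := by
  rw [← Complex.cpow_nat_mul]; simp

/-- The principal root halves the argument. That the values fill only the open first quadrant keeps
the logarithms in `logRatio` off their cut. -/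
theorem cpow_half_re_im_pos {w : ℂ} (hw : 0 < w.im) :
    0 < (w ^ (1 / 2 : ℂ)).re ∧ 0 < (w ^ (1 / 2 : ℂ)).im := by
  have h0 : w ≠ 0 := by rintro rfl; simp at hw
  have h1 : 0 < w.arg := by
    rcases (Complex.arg_nonneg_iff.mpr hw.le).lt_or_eq with h | h
    · exact h
    · have := Complex.arg_eq_zero_iff.mp h.symm
      linarith [this.2]
  have h2 := Complex.arg_le_pi w
  rw [Complex.cpow_def_of_ne_zero h0, Complex.exp_re, Complex.exp_im]
  have e : (Complex.log w * (1 / 2)).im = w.arg / 2 := by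
    rw [show (1 / 2 : ℂ) = ((1 / 2 : ℝ) : ℂ) by simp, Complex.im_mul_ofReal, Complex.log_im]; ring
  rw [e]
  exact ⟨mul_pos (Real.exp_pos _) (Real.cos_pos_of_mem_Ioo ⟨by linarith, by
      have h3 : w.arg ≠ π := fun h => by
        have := Complex.arg_eq_pi_iff.mp h
        linarith [this.2]
      have := lt_of_le_of_ne h2 h3
      linarith⟩),
    mul_pos (Real.exp_pos _) (Real.sin_pos_of_pos_of_lt_pi (by linarith) (by linarith))⟩

theorem log_I_mul_of_pos {t : ℝ} (ht : 0 < t) :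
    Complex.log (Complex.I * t) = Real.log t + π / 2 * Complex.I := by
  rw [mul_comm, Complex.log_ofReal_mul ht Complex.I_ne_zero, Complex.log_I]

theorem log_I_mul_of_neg {t : ℝ} (ht : t < 0) :
    Complex.log (Complex.I * t) = Real.log t - π / 2 * Complex.I := by
  have h : Complex.I * t = ((-t : ℝ) : ℂ) * (-Complex.I) := by push_cast; ring
  rw [h, Complex.log_ofReal_mul (by linarith) (neg_ne_zero.mpr Complex.I_ne_zero),
    Complex.log_neg_I, Real.log_neg_eq_log]
  ring

namespace Config

variable (d : Config)

/-! ### The Cauchy integrals in closed form. -/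

/-- `(z - a₁)^(1/2)`. -/
def rootP (z : ℂ) : ℂ := (z - d.a₁) ^ (1 / 2 : ℂ)

/-- `(z - a₂)^(1/2)`. -/
def rootQ (z : ℂ) : ℂ := (z - d.a₂) ^ (1 / 2 : ℂ)

theorem R_eq (z : ℂ) : d.R z = d.rootP z * d.rootQ z := rfl

theorem rootP_sq (z : ℂ) : d.rootP z ^ 2 = z - d.a₁ := sq_cpow_half _

theorem rootQ_sq (z : ℂ) : d.rootQ z ^ 2 = z - d.a₂ := sq_cpow_half _

theorem rootP_pos {z : ℂ} (hz : 0 < z.im) : 0 < (d.rootP z).re ∧ 0 < (d.rootP z).im :=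
  cpow_half_re_im_pos (by simpa)

theorem rootQ_pos {z : ℂ} (hz : 0 < z.im) : 0 < (d.rootQ z).re ∧ 0 < (d.rootQ z).im :=
  cpow_half_re_im_pos (by simpa)

theorem tendsto_rootP {x : ℝ} (hx : d.a₁ < x) :
    Tendsto d.rootP (upper x) (𝓝 ((√(x - d.a₁) : ℝ) : ℂ)) := by
  have := tendsto_sub_cpow_upper hx.ne' (1 / 2 : ℂ)
  rwa [show (1 / 2 : ℂ) = ((1 / 2 : ℝ) : ℂ) by simp, ofReal_cpow_of_pos (by linarith),
    ← Real.sqrt_eq_rpow, show ((1 / 2 : ℝ) : ℂ) = (1 / 2 : ℂ) by simp] at this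

theorem tendsto_rootQ {x : ℝ} (hx : x < d.a₂) :
    Tendsto d.rootQ (upper x) (𝓝 (Complex.I * (√(d.a₂ - x) : ℝ))) := by
  have := tendsto_sub_cpow_upper hx.ne (1 / 2 : ℂ)
  rwa [show (1 / 2 : ℂ) = ((1 / 2 : ℝ) : ℂ) by simp, ofReal_cpow_of_neg (by linarith),
    ← Real.sqrt_eq_rpow, show ((1 / 2 : ℝ) : ℂ) = (1 / 2 : ℂ) by simp, neg_sub,
    show (π : ℂ) * Complex.I * (1 / 2) = π / 2 * Complex.I by ring, Complex.exp_pi_div_two_mul_I,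
    mul_comm] at this

theorem plus_R {x : ℝ} (hx : x ∈ Ioo d.a₁ d.a₂) :
    plus d.R x = Complex.I * (√(x - d.a₁) * √(d.a₂ - x) : ℝ) := by
  refine plus_eq ?_
  have := (d.tendsto_rootP hx.1).mul (d.tendsto_rootQ hx.2)
  have hR : d.R = fun z => d.rootP z * d.rootQ z := rfl
  rw [hR, show Complex.I * (√(x - d.a₁) * √(d.a₂ - x) : ℝ) =
    (√(x - d.a₁) : ℝ) * (Complex.I * (√(d.a₂ - x) : ℝ)) by push_cast; ring]
  exact this

/-- The antiderivative of `-R(z) / ((ζ - z) R₊(ζ))` in `ζ`. -/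
def logRatio (z : ℂ) (ζ : ℝ) : ℂ :=
  Complex.log (d.rootQ z * √(ζ - d.a₁) + Complex.I * d.rootP z * √(d.a₂ - ζ)) -
    Complex.log (d.rootQ z * √(ζ - d.a₁) - Complex.I * d.rootP z * √(d.a₂ - ζ))

/-- With p and q in the open first quadrant and u, v ≥ 0 not both zero, q u + i p v has positive
imaginary part. In `sub_mem_slitPlane`, q u - i p v has positive real part. -/
theorem add_mem_slitPlane {z : ℂ} (hz : 0 < z.im) {ζ : ℝ} (hζ : ζ ∈ Icc d.a₁ d.a₂) :
    d.rootQ z * √(ζ - d.a₁) + Complex.I * d.rootP z * √(d.a₂ - ζ) ∈ Complex.slitPlane := by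
  have hp := d.rootP_pos hz
  have hq := d.rootQ_pos hz
  have h1 := Real.sqrt_nonneg (ζ - d.a₁)
  have h2 := Real.sqrt_nonneg (d.a₂ - ζ)
  refine Complex.mem_slitPlane_iff.mpr (Or.inr (ne_of_gt ?_))
  simp only [Complex.add_im, Complex.mul_im, Complex.mul_re, Complex.I_re, Complex.I_im,
    Complex.ofReal_re, Complex.ofReal_im]
  rcases hζ.1.lt_or_eq with h | h
  · have := Real.sqrt_pos.mpr (sub_pos.mpr h)
    nlinarith [mul_pos hq.2 this, mul_nonneg hp.1.le h2]
  · have := Real.sqrt_pos.mpr (sub_pos.mpr (h ▸ d.a₁_lt_a₂))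
    nlinarith [mul_pos hp.1 this, mul_nonneg hq.2.le h1]

theorem sub_mem_slitPlane {z : ℂ} (hz : 0 < z.im) {ζ : ℝ} (hζ : ζ ∈ Icc d.a₁ d.a₂) :
    d.rootQ z * √(ζ - d.a₁) - Complex.I * d.rootP z * √(d.a₂ - ζ) ∈ Complex.slitPlane := by
  have hp := d.rootP_pos hz
  have hq := d.rootQ_pos hz
  have h1 := Real.sqrt_nonneg (ζ - d.a₁)
  have h2 := Real.sqrt_nonneg (d.a₂ - ζ)
  refine Complex.mem_slitPlane_iff.mpr (Or.inl ?_)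
  simp only [Complex.sub_re, Complex.mul_im, Complex.mul_re, Complex.I_re, Complex.I_im,
    Complex.ofReal_re, Complex.ofReal_im]
  rcases hζ.1.lt_or_eq with h | h
  · have := Real.sqrt_pos.mpr (sub_pos.mpr h)
    nlinarith [mul_pos hq.1 this, mul_nonneg hp.2.le h2]
  · have := Real.sqrt_pos.mpr (sub_pos.mpr (h ▸ d.a₁_lt_a₂))
    nlinarith [mul_pos hp.2 this, mul_nonneg hq.1.le h1]

theorem hasDerivAt_sqrt_sub_a₁ {ζ : ℝ} (hζ : d.a₁ < ζ) :
    HasDerivAt (fun t => √(t - d.a₁)) (1 / (2 * √(ζ - d.a₁))) ζ := by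
  simpa using ((hasDerivAt_id ζ).sub_const d.a₁).sqrt (sub_pos.mpr hζ).ne'

theorem hasDerivAt_sqrt_a₂_sub {ζ : ℝ} (hζ : ζ < d.a₂) :
    HasDerivAt (fun t => √(d.a₂ - t)) (-1 / (2 * √(d.a₂ - ζ))) ζ := by
  simpa using ((hasDerivAt_id ζ).const_sub d.a₂).sqrt (sub_pos.mpr hζ).ne'

theorem hasDerivAt_logRatio {z : ℂ} (hz : 0 < z.im) {ζ : ℝ} (hζ : ζ ∈ Ioo d.a₁ d.a₂) :
    HasDerivAt (d.logRatio z) (-(d.R z * (1 / ((ζ - z) * plus d.R ζ)))) ζ := by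
  have hu := (d.hasDerivAt_sqrt_sub_a₁ hζ.1).ofReal_comp
  have hv := (d.hasDerivAt_sqrt_a₂_sub hζ.2).ofReal_comp
  have hS1 := d.add_mem_slitPlane hz (Ioo_subset_Icc_self hζ)
  have hS2 := d.sub_mem_slitPlane hz (Ioo_subset_Icc_self hζ)
  have h1 := ((hu.const_mul (d.rootQ z)).add (hv.const_mul (Complex.I * d.rootP z))).clog_real hS1
  have h2 := ((hu.const_mul (d.rootQ z)).sub (hv.const_mul (Complex.I * d.rootP z))).clog_real hS2
  refine (h1.sub h2).congr_deriv ?_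
  simp only [Pi.add_apply, Pi.sub_apply]
  have n1 := Complex.slitPlane_ne_zero hS1
  have n2 := Complex.slitPlane_ne_zero hS2
  have hu0 : ((√(ζ - d.a₁) : ℝ) : ℂ) ≠ 0 := by
    exact_mod_cast (Real.sqrt_pos.mpr (sub_pos.mpr hζ.1)).ne'
  have hv0 : ((√(d.a₂ - ζ) : ℝ) : ℂ) ≠ 0 := by
    exact_mod_cast (Real.sqrt_pos.mpr (sub_pos.mpr hζ.2)).ne'
  have hu2 : ((√(ζ - d.a₁) : ℝ) : ℂ) ^ 2 = ζ - d.a₁ := by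
    exact_mod_cast Real.sq_sqrt (sub_pos.mpr hζ.1).le
  have hv2 : ((√(d.a₂ - ζ) : ℝ) : ℂ) ^ 2 = d.a₂ - ζ := by
    exact_mod_cast Real.sq_sqrt (sub_pos.mpr hζ.2).le
  have hz0 : (ζ : ℂ) - z ≠ 0 := fun h => by
    have := congrArg Complex.im h
    simp at this
    linarith
  have hp2 := d.rootP_sq z
  have hq2 := d.rootQ_sq z
  rw [d.plus_R hζ, R_eq]
  push_cast
  generalize ((√(ζ - d.a₁) : ℝ) : ℂ) = u at *
  generalize ((√(d.a₂ - ζ) : ℝ) : ℂ) = v at *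
  generalize d.rootP z = p at *
  generalize d.rootQ z = q at *
  have hI := Complex.I_ne_zero
  have hI2 := Complex.I_sq
  -- As u² + v² = a₂ - a₁, the product of the two arguments is a constant multiple of z - ζ; this
  -- produces the Cauchy kernel.
  have key : (q * u + Complex.I * p * v) * (q * u - Complex.I * p * v) =
      -(ζ - z) * (u ^ 2 + v ^ 2) := by
    linear_combination (-(p ^ 2) * v ^ 2) * hI2 + u ^ 2 * hq2 + v ^ 2 * hp2 +
      (z - d.a₂) * hu2 + (z - d.a₁) * hv2 - (z - ζ) * hu2 - (z - ζ) * hv2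
  rw [div_sub_div _ _ n1 n2, key]
  have huv : u ^ 2 + v ^ 2 ≠ 0 := fun h => by
    rw [h, mul_zero] at key
    exact (mul_ne_zero n1 n2) key
  field_simp
  ring_nf
  simp only [hI2]
  ring

theorem continuousOn_logRatio {z : ℂ} (hz : 0 < z.im) :
    ContinuousOn (d.logRatio z) (Icc d.a₁ d.a₂) := by
  refine ContinuousOn.sub (ContinuousOn.clog ?_ fun ζ hζ => d.add_mem_slitPlane hz hζ)
    (ContinuousOn.clog ?_ fun ζ hζ => d.sub_mem_slitPlane hz hζ) <;> fun_prop

theorem hasDerivAt_angle {ζ : ℝ} (hζ : ζ ∈ Ioo d.a₁ d.a₂) :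
    HasDerivAt d.angle (-(1 / 2 * (1 / (√(ζ - d.a₁) * √(d.a₂ - ζ))))) ζ := by
  have h0 := d.scale_pos
  have hu := Real.sqrt_pos.mpr (sub_pos.mpr hζ.1)
  have hv := Real.sqrt_pos.mpr (sub_pos.mpr hζ.2)
  have hlt : √(ζ - d.a₁) / d.scale < 1 := by
    rw [div_lt_one h0]
    exact Real.sqrt_lt_sqrt (sub_pos.mpr hζ.1).le (by linarith [hζ.2])
  have h1 := (Real.hasDerivAt_arccos (x := √(ζ - d.a₁) / d.scale)
    (by linarith [div_pos hu h0]) hlt.ne).comp ζ ((d.hasDerivAt_sqrt_sub_a₁ hζ.1).div_const d.scale)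
  refine h1.congr_deriv ?_
  have h2 : √(1 - (√(ζ - d.a₁) / d.scale) ^ 2) = √(d.a₂ - ζ) / d.scale := by
    rw [← Real.sin_arccos, ← d.scale_mul_sin (Ioo_subset_Icc_self hζ), angle]
    field_simp
  rw [h2]
  field_simp

theorem continuous_angle : Continuous d.angle := by
  unfold angle
  fun_prop

/-- The weight is the derivative of -2 η, which is continuous up to the endpoints. A nonnegative
derivative of a continuous function is integrable, whatever its singularities at a₁ and a₂. -/
theorem intervalIntegrable_weight :
    IntervalIntegrable (fun ζ => 1 / (√(ζ - d.a₁) * √(d.a₂ - ζ))) MeasureTheory.volume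
      d.a₁ d.a₂ := by
  rw [intervalIntegrable_iff_integrableOn_Ioc_of_le d.a₁_lt_a₂.le]
  refine intervalIntegral.integrableOn_deriv_of_nonneg (g := fun ζ => -2 * d.angle ζ)
    (d.continuous_angle.const_mul (-2)).continuousOn (fun ζ hζ => ?_) (fun ζ hζ => by positivity)
  exact ((d.hasDerivAt_angle hζ).const_mul (-2)).congr_deriv (by ring)

theorem intervalIntegrable_mono {f : ℝ → ℂ}
    (hf : IntervalIntegrable f MeasureTheory.volume d.a₁ d.a₂) {u v : ℝ} (hu : d.a₁ ≤ u)
    (huv : u ≤ v) (hv : v ≤ d.a₂) : IntervalIntegrable f MeasureTheory.volume u v :=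
  hf.mono_set (by rw [uIcc_of_le huv, uIcc_of_le d.a₁_lt_a₂.le]; exact Icc_subset_Icc hu hv)

theorem intervalIntegrable_mul_inv_R {f : ℝ → ℂ} (hf : ContinuousOn f (Icc d.a₁ d.a₂)) :
    IntervalIntegrable (fun ζ => f ζ * (1 / plus d.R ζ)) MeasureTheory.volume d.a₁ d.a₂ := by
  have h1 : IntervalIntegrable (fun ζ => ((1 / (√(ζ - d.a₁) * √(d.a₂ - ζ)) : ℝ) : ℂ))
      MeasureTheory.volume d.a₁ d.a₂ :=
    ⟨d.intervalIntegrable_weight.1.ofReal, d.intervalIntegrable_weight.2.ofReal⟩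
  have h2 := (h1.continuousOn_mul (g := fun ζ => f ζ * -Complex.I)
    (by rw [uIcc_of_le d.a₁_lt_a₂.le]; exact hf.mul continuousOn_const))
  refine h2.congr_ae ?_
  rw [uIoc_of_le d.a₁_lt_a₂.le, ← MeasureTheory.Measure.restrict_congr_set
    MeasureTheory.Ioo_ae_eq_Ioc]
  refine (MeasureTheory.ae_restrict_mem measurableSet_Ioo).mono fun ζ hζ => ?_
  dsimp only
  rw [d.plus_R hζ]
  push_cast
  simp only [one_div, mul_inv, Complex.inv_I]
  ring

theorem intervalIntegrable_cauchy {z : ℂ} (hz : 0 < z.im) :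
    IntervalIntegrable (fun ζ : ℝ => 1 / ((ζ - z) * plus d.R ζ)) MeasureTheory.volume
      d.a₁ d.a₂ := by
  have := d.intervalIntegrable_mul_inv_R (f := fun ζ : ℝ => 1 / ((ζ : ℂ) - z)) (by
    refine ContinuousOn.div continuousOn_const (by fun_prop) fun ζ _ h => ?_
    have := congrArg Complex.im h
    simp at this
    linarith)
  simpa only [one_div_mul_one_div] using this

theorem integral_cauchy {z : ℂ} (hz : 0 < z.im) {u v : ℝ} (hu : d.a₁ ≤ u) (huv : u ≤ v)
    (hv : v ≤ d.a₂) :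
    d.R z * ∫ ζ in u..v, 1 / ((ζ - z) * plus d.R ζ) = d.logRatio z u - d.logRatio z v := by
  have h := intervalIntegral.integral_eq_sub_of_hasDerivAt_of_le huv
    ((d.continuousOn_logRatio hz).mono (Icc_subset_Icc hu hv))
    (fun ζ hζ => d.hasDerivAt_logRatio hz (Ioo_subset_Ioo hu hv hζ))
    (((d.intervalIntegrable_mono (d.intervalIntegrable_cauchy hz) hu huv hv).const_mul _).neg)
  rw [intervalIntegral.integral_neg, intervalIntegral.integral_const_mul] at h
  linear_combination -h

theorem integral_weight {u v : ℝ} (hu : d.a₁ ≤ u) (huv : u ≤ v) (hv : v ≤ d.a₂) :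
    ∫ ζ in u..v, 1 / plus d.R ζ = -2 * Complex.I * (d.angle u - d.angle v) := by
  have hI : IntervalIntegrable (fun ζ => 1 / plus d.R ζ) MeasureTheory.volume u v := by
    have := d.intervalIntegrable_mul_inv_R (f := fun _ => 1) continuousOn_const
    simp only [one_mul] at this
    exact d.intervalIntegrable_mono this hu huv hv
  have h := intervalIntegral.integral_eq_sub_of_hasDerivAt_of_le
    (f := fun ζ => 2 * Complex.I * (d.angle ζ : ℂ)) huv
    (by have := d.continuous_angle; fun_prop) (fun ζ hζ => by
      refine ((d.hasDerivAt_angle (Ioo_subset_Ioo hu hv hζ)).ofReal_comp.const_mul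
        (2 * Complex.I)).congr_deriv (?_ : _ = 1 / plus d.R ζ)
      rw [d.plus_R (Ioo_subset_Ioo hu hv hζ), one_div]
      push_cast
      simp only [one_div, mul_inv, Complex.inv_I]
      ring) hI
  rw [h]; ring

/-- The endpoints are a null set, so the weight matters only inside the intervals. This covers both
χ and the indicator of J. -/
theorem integral_Icc_weighted {w F : ℝ → ℂ} {ω : ℕ → ℂ}
    (hw : ∀ j ≤ d.n, ∀ x ∈ Ioo (d.c j) (d.c (j + 1)), w x = ω j)
    (hF : IntervalIntegrable F MeasureTheory.volume d.a₁ d.a₂) :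
    ∫ ζ in Icc d.a₁ d.a₂, w ζ * F ζ =
      ∑ j ∈ Finset.range (d.n + 1), ω j * ∫ ζ in d.c j..d.c (j + 1), F ζ := by
  have hj : ∀ j, j < d.n + 1 → Set.EqOn (fun ζ => ω j * F ζ) (fun ζ => w ζ * F ζ)
      (Ioo (d.c j) (d.c (j + 1))) := fun j hj x hx => by
    dsimp only
    rw [hw j (by omega) x hx]
  have hae : ∀ j, j < d.n + 1 → (fun ζ => ω j * F ζ) =ᵐ[MeasureTheory.volume.restrict
      (uIoc (d.c j) (d.c (j + 1)))] (fun ζ => w ζ * F ζ) := fun j hj' => by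
    rw [uIoc_of_le (d.c_lt_succ (by omega)).le, ← MeasureTheory.Measure.restrict_congr_set
      MeasureTheory.Ioo_ae_eq_Ioc]
    exact (MeasureTheory.ae_restrict_mem measurableSet_Ioo).mono (hj j hj')
  rw [MeasureTheory.integral_Icc_eq_integral_Ioc, ← intervalIntegral.integral_of_le d.a₁_lt_a₂.le,
    ← c_zero, ← c_last, ← intervalIntegral.sum_integral_adjacent_intervals]
  · refine Finset.sum_congr rfl fun j hjm => ?_
    have hj' := Finset.mem_range.mp hjm
    rw [← intervalIntegral.integral_const_mul]
    refine intervalIntegral.integral_congr_ae_restrict (hae j hj').symm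
  · intro j hj'
    exact ((d.intervalIntegrable_mono hF (d.a₁_le_c (by omega)) (d.c_lt_succ (by omega)).le
      (d.c_le_a₂ (by omega))).const_mul (ω j)).congr_ae (hae j hj')

theorem measurableSet_J : MeasurableSet d.J :=
  MeasurableSet.biUnion (Set.to_countable _) fun _ _ => measurableSet_Icc

theorem J_subset : d.J ⊆ Icc d.a₁ d.a₂ := by
  rw [← J_union_E]; exact subset_union_left

theorem integral_J {F : ℝ → ℂ} (hF : IntervalIntegrable F MeasureTheory.volume d.a₁ d.a₂) :
    ∫ ζ in d.J, F ζ = ∑ j ∈ Finset.range (d.n + 1),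
      (if Odd j then 1 else 0) * ∫ ζ in d.c j..d.c (j + 1), F ζ := by
  rw [← d.integral_Icc_weighted (w := d.J.indicator fun _ => 1) (fun j hj x hx => ?_) hF,
    ← inter_eq_right.mpr d.J_subset, ← MeasureTheory.setIntegral_indicator d.measurableSet_J,
    inter_eq_right.mpr d.J_subset]
  · congr 1 with ζ
    simp only [Set.indicator]
    split_ifs <;> simp
  · simp only [Set.indicator, d.mem_J_iff_odd hj hx]

theorem logRatio_a₂ (z : ℂ) : d.logRatio z d.a₂ = 0 := by simp [logRatio]

/-- Summation by parts. In the applications f vanishes at a₂, so the last term drops out. -/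
theorem sum_odd_eq (f : ℕ → ℂ) (m : ℕ) :
    ∑ j ∈ Finset.range (m + 1), (if Odd j then 1 else 0) * (f j - f (j + 1)) =
      ∑ j ∈ Finset.Icc 1 m, (-1) ^ (j + 1) * f j - (if Odd m then 1 else 0) * f (m + 1) := by
  induction m with
  | zero => simp
  | succ m ih =>
    rw [Finset.sum_range_succ, ih, ← Finset.insert_Icc_right_eq_Icc_add_one (by omega),
      Finset.sum_insert (by simp)]
    rcases Nat.even_or_odd m with h | h
    · rw [if_neg (Nat.not_odd_iff_even.mpr h), if_pos h.add_one, h.add_one.add_one.neg_one_pow]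
      ring
    · rw [if_pos h, if_neg (Nat.not_odd_iff_even.mpr h.add_one), h.add_one.add_one.neg_one_pow]
      ring

theorem gTilde_eq {z : ℂ} (hz : 0 < z.im) :
    d.gTilde z = 1 / 2 * ∑ j ∈ Finset.Icc 1 d.n, (-1) ^ (j + 1) * d.logRatio z (d.b j) := by
  have hπ : (π : ℂ) ≠ 0 := by exact_mod_cast Real.pi_ne_zero
  have h : ∫ ζ in d.J, (π * Complex.I) / (((ζ : ℂ) - z) * plus d.R ζ) =
      π * Complex.I * ∫ ζ in d.J, 1 / (((ζ : ℂ) - z) * plus d.R ζ) := by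
    rw [← MeasureTheory.integral_const_mul]
    simp only [mul_one_div]
  have h2 : d.R z * ∫ ζ in d.J, 1 / (((ζ : ℂ) - z) * plus d.R ζ) =
      ∑ j ∈ Finset.Icc 1 d.n, (-1) ^ (j + 1) * d.logRatio z (d.b j) := by
    rw [d.integral_J (d.intervalIntegrable_cauchy hz), Finset.mul_sum]
    have : ∀ j ∈ Finset.range (d.n + 1), d.R z * ((if Odd j then 1 else 0) *
        ∫ ζ in d.c j..d.c (j + 1), 1 / (((ζ : ℂ) - z) * plus d.R ζ)) =
        (if Odd j then 1 else 0) * (d.logRatio z (d.c j) - d.logRatio z (d.c (j + 1))) := by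
      intro j hj
      have hj' := Finset.mem_range.mp hj
      rw [← d.integral_cauchy hz (d.a₁_le_c (by omega)) (d.c_lt_succ (by omega)).le
        (d.c_le_a₂ (by omega))]
      ring
    rw [Finset.sum_congr rfl this, sum_odd_eq (fun j => d.logRatio z (d.c j)), c_last, logRatio_a₂,
      mul_zero, sub_zero]
    refine Finset.sum_congr rfl fun j hj => ?_
    have hj' := Finset.mem_Icc.mp hj
    rw [d.c_of_mem hj'.1 hj'.2]
  rw [gTilde, h, ← h2]
  field_simp

theorem g_eq {z : ℂ} (hz : 0 < z.im) :
    d.g z = 1 / (2 * π * Complex.I) * ∑ j ∈ Finset.range (d.n + 1), (-1) ^ j *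
      (d.logRatio z (d.c j) - d.logRatio z (d.c (j + 1))) := by
  have h : ∫ ζ in d.J ∪ d.E, d.chi ζ / (((ζ : ℂ) - z) * plus d.R ζ) =
      ∫ ζ in Icc d.a₁ d.a₂, d.chi ζ * (1 / (((ζ : ℂ) - z) * plus d.R ζ)) := by
    rw [J_union_E]
    simp only [mul_one_div]
  rw [g, h, d.integral_Icc_weighted (fun j hj x hx => d.chi_of_mem_Ioo hj hx)
    (d.intervalIntegrable_cauchy hz), Finset.mul_sum, Finset.mul_sum]
  refine Finset.sum_congr rfl fun j hj => ?_
  have hj' := Finset.mem_range.mp hj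
  rw [← d.integral_cauchy hz (d.a₁_le_c (by omega)) (d.c_lt_succ (by omega)).le
    (d.c_le_a₂ (by omega))]
  ring

end Config

/-! ### Behaviour at infinity and the value of α. -/

theorem cpow_half_re_nonneg (w : ℂ) : 0 ≤ (w ^ (1 / 2 : ℂ)).re := by
  rcases eq_or_ne w 0 with rfl | h0
  · simp
  rw [Complex.cpow_def_of_ne_zero h0, Complex.exp_re]
  have e : (Complex.log w * (1 / 2)).im = w.arg / 2 := by
    rw [show (1 / 2 : ℂ) = ((1 / 2 : ℝ) : ℂ) by simp, Complex.im_mul_ofReal, Complex.log_im]; ring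
  rw [e]
  exact mul_nonneg (Real.exp_pos _).le (Real.cos_nonneg_of_neg_pi_div_two_le_of_le
    (by linarith [Complex.neg_pi_lt_arg w]) (by linarith [Complex.arg_le_pi w]))

theorem cpow_half_im_nonneg {w : ℂ} (hw : 0 ≤ w.im) : 0 ≤ (w ^ (1 / 2 : ℂ)).im := by
  rcases eq_or_ne w 0 with rfl | h0
  · simp
  rw [Complex.cpow_def_of_ne_zero h0, Complex.exp_im]
  have e : (Complex.log w * (1 / 2)).im = w.arg / 2 := by
    rw [show (1 / 2 : ℂ) = ((1 / 2 : ℝ) : ℂ) by simp, Complex.im_mul_ofReal, Complex.log_im]; ring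
  rw [e]
  have := Complex.arg_nonneg_iff.mpr hw
  exact mul_nonneg (Real.exp_pos _).le (Real.sin_nonneg_of_nonneg_of_le_pi
    (by linarith) (by linarith [Complex.arg_le_pi w, Real.pi_pos]))

theorem cpow_half_im_nonpos {w : ℂ} (hw : w.im < 0) : (w ^ (1 / 2 : ℂ)).im ≤ 0 := by
  have h0 : w ≠ 0 := by rintro rfl; simp at hw
  rw [Complex.cpow_def_of_ne_zero h0, Complex.exp_im]
  have e : (Complex.log w * (1 / 2)).im = w.arg / 2 := by
    rw [show (1 / 2 : ℂ) = ((1 / 2 : ℝ) : ℂ) by simp, Complex.im_mul_ofReal, Complex.log_im]; ring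
  rw [e]
  have := Complex.arg_neg_iff.mpr hw
  exact mul_nonpos_of_nonneg_of_nonpos (Real.exp_pos _).le (Real.sin_nonpos_of_nonpos_of_neg_pi_le
    (by linarith) (by linarith [Complex.neg_pi_lt_arg w, Real.pi_pos]))

/-- Here |w + 1| ≥ 1. The bound selects the branch: in the right half-plane, w² → 1 forces w → 1 and
not w → -1. -/
theorem norm_sub_one_le_norm_sq_sub_one {w : ℂ} (hw : 0 ≤ w.re) : ‖w - 1‖ ≤ ‖w ^ 2 - 1‖ := by
  have h : 1 ≤ ‖w + 1‖ := by
    refine le_trans ?_ (Complex.re_le_norm _)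
    simp [hw]
  rw [show w ^ 2 - 1 = (w - 1) * (w + 1) by ring, norm_mul]
  nlinarith [norm_nonneg (w - 1)]

theorem tendsto_sub_div_sub_cobounded (a b : ℂ) :
    Tendsto (fun z : ℂ => (z - a) / (z - b)) (Bornology.cobounded ℂ) (𝓝 1) := by
  have h1 : Tendsto (fun z : ℂ => z - b) (Bornology.cobounded ℂ) (Bornology.cobounded ℂ) := by
    simpa only [sub_eq_add_neg] using tendsto_add_const_cobounded (-b)
  have h2 := ((tendsto_inv₀_cobounded.comp h1).const_mul (b - a)).const_add 1
  rw [mul_zero, add_zero] at h2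
  refine h2.congr' ?_
  filter_upwards [h1.eventually (Bornology.eventually_ne_cobounded 0)] with z hz
  simp only [Function.comp_apply]
  field_simp
  ring

namespace Config

variable (d : Config)

theorem tendsto_rootQ_div_rootP :
    Tendsto (fun z => d.rootQ z / d.rootP z) (Bornology.cobounded ℂ) (𝓝 1) := by
  have h := tendsto_sub_div_sub_cobounded (d.a₂ : ℂ) d.a₁
  rw [tendsto_iff_norm_sub_tendsto_zero] at h ⊢
  refine squeeze_zero (fun _ => norm_nonneg _) (fun z => ?_) h
  -- The two roots lie in the same closed quadrant, the first or the fourth, so their quotient is in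
  -- the closed right half-plane.
  have hre : 0 ≤ (d.rootQ z / d.rootP z).re := by
    rw [Complex.div_re, ← add_div]
    refine div_nonneg (add_nonneg (mul_nonneg (cpow_half_re_nonneg _) (cpow_half_re_nonneg _)) ?_)
      (Complex.normSq_nonneg _)
    rcases le_or_gt 0 z.im with h | h
    · exact mul_nonneg (cpow_half_im_nonneg (by simpa)) (cpow_half_im_nonneg (by simpa))
    · exact mul_nonneg_of_nonpos_of_nonpos (cpow_half_im_nonpos (by simpa))
        (cpow_half_im_nonpos (by simpa))
  have := norm_sub_one_le_norm_sq_sub_one hre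
  rwa [div_pow, rootQ_sq, rootP_sq] at this

theorem tendsto_R_div (ζ : ℝ) :
    Tendsto (fun z => d.R z / (ζ - z)) (Bornology.cobounded ℂ) (𝓝 (-1)) := by
  have h := (d.tendsto_rootQ_div_rootP.mul (tendsto_sub_div_sub_cobounded (d.a₁ : ℂ) ζ)).neg
  rw [mul_one] at h
  refine h.congr' ?_
  filter_upwards [Bornology.eventually_ne_cobounded (d.a₁ : ℂ)] with z hz
  have hp := d.rootP_sq z
  have hp0 : d.rootP z ≠ 0 := fun h0 => by
    rw [h0] at hp
    exact hz (by linear_combination -hp)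
  rw [R_eq, ← hp, ← neg_sub z, div_neg]
  field_simp

theorem norm_R_le (z : ℂ) : ‖d.R z‖ ≤ ‖z‖ + (|d.a₁| + |d.a₂|) := by
  have h : ‖d.R z‖ ^ 2 = ‖z - d.a₁‖ * ‖z - d.a₂‖ := by
    rw [R_eq, norm_mul, mul_pow, ← norm_pow, ← norm_pow, rootP_sq, rootQ_sq]
  have h1 := norm_sub_le z d.a₁
  have h2 := norm_sub_le z d.a₂
  rw [Complex.norm_real, Real.norm_eq_abs] at h1 h2
  have h3 := abs_nonneg d.a₁
  have h4 := abs_nonneg d.a₂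
  refine (sq_le_sq₀ (norm_nonneg _) (by positivity)).mp ?_
  rw [h, sq]
  exact mul_le_mul (by linarith) (by linarith) (norm_nonneg _) (by positivity)

theorem norm_R_div_le {z : ℂ} (hz : 3 * (|d.a₁| + |d.a₂|) + 1 ≤ ‖z‖) {ζ : ℝ}
    (hζ : ζ ∈ Icc d.a₁ d.a₂) : ‖d.R z / (ζ - z)‖ ≤ 2 := by
  have h1 := d.norm_R_le z
  have h2 : ‖z‖ - |ζ| ≤ ‖(ζ : ℂ) - z‖ := by
    rw [norm_sub_rev, ← Real.norm_eq_abs, ← Complex.norm_real]; exact norm_sub_norm_le _ _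
  have h3 : |ζ| ≤ |d.a₁| + |d.a₂| := by
    refine (abs_le_max_abs_abs hζ.1 hζ.2).trans (max_le ?_ ?_)
    · linarith [abs_nonneg d.a₂]
    · linarith [abs_nonneg d.a₁]
  have h4 := abs_nonneg d.a₁
  have h5 := abs_nonneg d.a₂
  rw [norm_div, div_le_iff₀ (by linarith)]
  linarith

theorem integral_J_inv_R :
    ∫ ζ in d.J, 1 / plus d.R ζ = -2 * Complex.I * d.angleSum := by
  have hI : IntervalIntegrable (fun ζ => 1 / plus d.R ζ) MeasureTheory.volume d.a₁ d.a₂ := by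
    simpa only [one_mul] using d.intervalIntegrable_mul_inv_R (f := fun _ => 1) continuousOn_const
  rw [d.integral_J hI]
  have : ∀ j ∈ Finset.range (d.n + 1), (if Odd j then 1 else 0) *
        ∫ ζ in d.c j..d.c (j + 1), 1 / plus d.R ζ =
      -2 * Complex.I * ((if Odd j then 1 else 0) *
        ((d.angle (d.c j) : ℂ) - d.angle (d.c (j + 1)))) := by
    intro j hj
    have hj' := Finset.mem_range.mp hj
    rw [d.integral_weight (d.a₁_le_c (by omega)) (d.c_lt_succ (by omega)).le
      (d.c_le_a₂ (by omega))]
    ring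
  rw [Finset.sum_congr rfl this, ← Finset.mul_sum, sum_odd_eq (fun j => (d.angle (d.c j) : ℂ)),
    c_last, angle_a₂, Complex.ofReal_zero, mul_zero, sub_zero, angleSum, Complex.ofReal_sum]
  congr 1
  refine Finset.sum_congr rfl fun j hj => ?_
  have hj' := Finset.mem_Icc.mp hj
  rw [d.nu_eq_angle_c hj'.1 hj'.2]
  push_cast
  rfl

theorem gTilde_eq_integral (z : ℂ) :
    d.gTilde z = 1 / 2 * ∫ ζ in d.J, d.R z / (ζ - z) * (1 / plus d.R ζ) := by
  have hπ : (π : ℂ) ≠ 0 := by exact_mod_cast Real.pi_ne_zero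
  rw [gTilde, ← MeasureTheory.integral_const_mul, ← MeasureTheory.integral_const_mul]
  congr 1 with ζ
  have hI := Complex.I_ne_zero
  field_simp

/-- Dominated convergence: R(z) / (ζ - z) tends to -1 and is bounded by 2 for large z, while 1/R₊ is
integrable with antiderivative 2iη. -/
theorem tendsto_gTilde :
    Tendsto d.gTilde (Bornology.cobounded ℂ) (𝓝 (Complex.I * d.angleSum)) := by
  have hI : MeasureTheory.IntegrableOn (fun ζ => 1 / plus d.R ζ) d.J := by
    have : IntervalIntegrable (fun ζ => 1 / plus d.R ζ) MeasureTheory.volume d.a₁ d.a₂ := by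
      simpa only [one_mul] using d.intervalIntegrable_mul_inv_R (f := fun _ => 1) continuousOn_const
    rw [intervalIntegrable_iff_integrableOn_Icc_of_le d.a₁_lt_a₂.le] at this
    exact this.mono_set d.J_subset
  have hcg : (Bornology.cobounded ℂ).IsCountablyGenerated := by
    rw [← comap_norm_atTop]; infer_instance
  have key : Tendsto (fun z => ∫ ζ in d.J, d.R z / (ζ - z) * (1 / plus d.R ζ))
      (Bornology.cobounded ℂ) (𝓝 (∫ ζ in d.J, -1 * (1 / plus d.R ζ))) := by
    refine MeasureTheory.tendsto_integral_filter_of_dominated_convergence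
      (fun ζ => 2 * ‖1 / plus d.R ζ‖) (Eventually.of_forall fun z => ?_) ?_ (hI.norm.const_mul 2)
      (Eventually.of_forall fun ζ => (d.tendsto_R_div ζ).mul_const _)
    · exact (Measurable.aestronglyMeasurable (by fun_prop)).mul hI.aestronglyMeasurable
    · filter_upwards [tendsto_norm_cobounded_atTop.eventually_ge_atTop
        (3 * (|d.a₁| + |d.a₂|) + 1)] with z hz
      refine (MeasureTheory.ae_restrict_mem d.measurableSet_J).mono fun ζ hζ => ?_
      rw [norm_mul]
      exact mul_le_mul_of_nonneg_right (d.norm_R_div_le hz (d.J_subset hζ)) (norm_nonneg _)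
  rw [MeasureTheory.integral_const_mul, integral_J_inv_R] at key
  have h := key.const_mul (1 / 2)
  rw [show (1 / 2 : ℂ) * (-1 * (-2 * Complex.I * d.angleSum)) = Complex.I * d.angleSum by ring] at h
  exact h.congr fun z => (d.gTilde_eq_integral z).symm

theorem gTildeInf_eq : d.gTildeInf = Complex.I * d.angleSum := d.tendsto_gTilde.limUnder_eq

theorem alpha_eq : d.alpha = d.angleSum := by rw [alpha, gTildeInf_eq]; simp

/-! ### Boundary values of g and g̃. -/

/-- The boundary value of `logRatio` at `x` from the upper half-plane. -/
def logRatioBd (x ζ : ℝ) : ℂ :=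
  Complex.log (Complex.I * (d.scale ^ 2 * Real.sin (d.angle x + d.angle ζ) : ℝ)) -
    Complex.log (Complex.I * (d.scale ^ 2 * Real.sin (d.angle x - d.angle ζ) : ℝ))

theorem I_mul_mem_slitPlane {t : ℝ} (ht : t ≠ 0) : Complex.I * (t : ℂ) ∈ Complex.slitPlane :=
  Complex.mem_slitPlane_iff.mpr (Or.inr (by simpa))

theorem sin_angle_add_angle_pos {x : ℝ} (hx : x ∈ Ioo d.a₁ d.a₂) (ζ : ℝ) :
    0 < Real.sin (d.angle x + d.angle ζ) :=
  Real.sin_pos_of_pos_of_lt_pi (by linarith [d.angle_pos hx, d.angle_nonneg ζ])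
    (by linarith [d.angle_lt_pi_div_two hx, d.angle_le ζ])

theorem sin_angle_sub_angle_ne_zero {x ζ : ℝ} (hx : x ∈ Ioo d.a₁ d.a₂) (hζ : ζ ∈ Icc d.a₁ d.a₂)
    (hne : x ≠ ζ) : Real.sin (d.angle x - d.angle ζ) ≠ 0 := fun h => by
  have := d.sub_eq_sin_mul_sin hζ (Ioo_subset_Icc_self hx)
  rw [h, mul_zero, mul_zero, sub_eq_zero] at this
  exact hne this.symm

theorem tendsto_logRatio {x ζ : ℝ} (hx : x ∈ Ioo d.a₁ d.a₂) (hζ : ζ ∈ Icc d.a₁ d.a₂)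
    (hne : x ≠ ζ) : Tendsto (fun z => d.logRatio z ζ) (upper x) (𝓝 (d.logRatioBd x ζ)) := by
  have hp := d.tendsto_rootP hx.1
  have hq := d.tendsto_rootQ hx.2
  have hx' := Ioo_subset_Icc_self hx
  have h0 := d.scale_pos.ne'
  have e1 := (hq.mul_const (√(ζ - d.a₁) : ℂ)).add
    ((hp.const_mul Complex.I).mul_const (√(d.a₂ - ζ) : ℂ))
  have e2 := (hq.mul_const (√(ζ - d.a₁) : ℂ)).sub
    ((hp.const_mul Complex.I).mul_const (√(d.a₂ - ζ) : ℂ))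
  rw [show Complex.I * (√(d.a₂ - x) : ℝ) * (√(ζ - d.a₁) : ℂ) + Complex.I * (√(x - d.a₁) : ℝ) *
      (√(d.a₂ - ζ) : ℂ) = Complex.I * (d.scale ^ 2 * Real.sin (d.angle x + d.angle ζ) : ℝ) by
    rw [← d.scale_mul_cos hx', ← d.scale_mul_cos hζ, ← d.scale_mul_sin hx', ← d.scale_mul_sin hζ,
      Real.sin_add]
    push_cast; ring] at e1
  rw [show Complex.I * (√(d.a₂ - x) : ℝ) * (√(ζ - d.a₁) : ℂ) - Complex.I * (√(x - d.a₁) : ℝ) *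
      (√(d.a₂ - ζ) : ℂ) = Complex.I * (d.scale ^ 2 * Real.sin (d.angle x - d.angle ζ) : ℝ) by
    rw [← d.scale_mul_cos hx', ← d.scale_mul_cos hζ, ← d.scale_mul_sin hx', ← d.scale_mul_sin hζ,
      Real.sin_sub]
    push_cast; ring] at e2
  exact ((continuousAt_clog (I_mul_mem_slitPlane (mul_ne_zero (pow_ne_zero 2 h0)
      (d.sin_angle_add_angle_pos hx ζ).ne'))).tendsto.comp e1).sub
    ((continuousAt_clog (I_mul_mem_slitPlane (mul_ne_zero (pow_ne_zero 2 h0)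
      (d.sin_angle_sub_angle_ne_zero hx hζ hne)))).tendsto.comp e2)

theorem continuousAt_logRatioBd {x ζ : ℝ} (hx : x ∈ Ioo d.a₁ d.a₂) (hζ : ζ ∈ Icc d.a₁ d.a₂)
    (hne : x ≠ ζ) : ContinuousAt (fun t => d.logRatioBd t ζ) x := by
  have h0 := d.scale_pos.ne'
  have hc := d.continuous_angle
  refine ContinuousAt.sub (ContinuousAt.clog ?_ (I_mul_mem_slitPlane (mul_ne_zero
    (pow_ne_zero 2 h0) (d.sin_angle_add_angle_pos hx ζ).ne'))) (ContinuousAt.clog ?_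
    (I_mul_mem_slitPlane (mul_ne_zero (pow_ne_zero 2 h0) (d.sin_angle_sub_angle_ne_zero hx hζ hne))))
  · exact Continuous.continuousAt (by fun_prop)
  · exact Continuous.continuousAt (by fun_prop)

theorem logRatioBd_of_pos {x ζ : ℝ} (hx : x ∈ Ioo d.a₁ d.a₂)
    (h : 0 < Real.sin (d.angle x - d.angle ζ)) : d.logRatioBd x ζ =
      (Real.log (Real.sin (d.angle x + d.angle ζ)) - Real.log (Real.sin (d.angle x - d.angle ζ)) :
        ℝ) := by
  have h1 := d.sin_angle_add_angle_pos hx ζ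
  have h0 := pow_pos d.scale_pos 2
  rw [logRatioBd, log_I_mul_of_pos (mul_pos h0 h1), log_I_mul_of_pos (mul_pos h0 h),
    Real.log_mul h0.ne' h1.ne', Real.log_mul h0.ne' h.ne']
  push_cast; ring

theorem logRatioBd_of_neg {x ζ : ℝ} (hx : x ∈ Ioo d.a₁ d.a₂)
    (h : Real.sin (d.angle x - d.angle ζ) < 0) : d.logRatioBd x ζ =
      (Real.log (Real.sin (d.angle x + d.angle ζ)) - Real.log (Real.sin (d.angle x - d.angle ζ)) :
        ℝ) + π * Complex.I := by
  have h1 := d.sin_angle_add_angle_pos hx ζ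
  have h0 := pow_pos d.scale_pos 2
  rw [logRatioBd, log_I_mul_of_pos (mul_pos h0 h1), log_I_mul_of_neg (mul_neg_of_pos_of_neg h0 h),
    Real.log_mul h0.ne' h1.ne', Real.log_mul h0.ne' h.ne]
  push_cast; ring

theorem ne_c_of_mem_Ioo {i j : ℕ} (hi : i ≤ d.n) {x : ℝ} (hx : x ∈ Ioo (d.c i) (d.c (i + 1)))
    (hj : j ≤ d.n + 1) : x ≠ d.c j := by
  rintro rfl
  rcases le_or_gt j i with h | h
  · linarith [hx.1, d.c_le h (by omega)]
  · linarith [hx.2, d.c_le (show i + 1 ≤ j from h) hj]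

/-- The boundary value of `g` from the upper half-plane. -/
def gBd (x : ℝ) : ℂ := 1 / (2 * π * Complex.I) * ∑ j ∈ Finset.range (d.n + 1), (-1) ^ j *
  (d.logRatioBd x (d.c j) - d.logRatioBd x (d.c (j + 1)))

theorem c_mem_Icc {j : ℕ} (hj : j ≤ d.n + 1) : d.c j ∈ Icc d.a₁ d.a₂ :=
  ⟨d.a₁_le_c hj, d.c_le_a₂ hj⟩

theorem plus_g {i : ℕ} (hi : i ≤ d.n) {x : ℝ} (hx : x ∈ Ioo (d.c i) (d.c (i + 1))) :
    plus d.g x = d.gBd x := by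
  refine plus_eq (Tendsto.congr' (eventually_mem_nhdsWithin.mono fun z hz => (d.g_eq hz).symm) ?_)
  refine (tendsto_finsetSum _ fun j hj => ?_).const_mul _
  have hj' := Finset.mem_range.mp hj
  have hx' := d.Ioo_subset hi hx
  exact ((d.tendsto_logRatio hx' (d.c_mem_Icc (by omega)) (d.ne_c_of_mem_Ioo hi hx (by omega))).sub
    (d.tendsto_logRatio hx' (d.c_mem_Icc (by omega))
      (d.ne_c_of_mem_Ioo hi hx (by omega)))).const_mul _

/-- Needed only for the limits on the diagonal; elsewhere Im g₊ acts as an arbitrary real phase. -/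
theorem continuousAt_plus_g {i : ℕ} (hi : i ≤ d.n) {x : ℝ} (hx : x ∈ Ioo (d.c i) (d.c (i + 1))) :
    ContinuousAt (plus d.g) x := by
  have h : ContinuousAt d.gBd x := by
    refine ContinuousAt.mul continuousAt_const (tendsto_finsetSum _ fun j hj => ?_)
    have hj' := Finset.mem_range.mp hj
    have hx' := d.Ioo_subset hi hx
    exact continuousAt_const.mul ((d.continuousAt_logRatioBd hx' (d.c_mem_Icc (by omega))
      (d.ne_c_of_mem_Ioo hi hx (by omega))).sub (d.continuousAt_logRatioBd hx'
        (d.c_mem_Icc (by omega)) (d.ne_c_of_mem_Ioo hi hx (by omega))))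
  refine h.congr ?_
  filter_upwards [isOpen_Ioo.mem_nhds hx] with t ht
  exact (d.plus_g hi ht).symm

/-- The real part of the boundary value of `g̃`. -/
def logRho (x : ℝ) : ℝ := 1 / 2 * ∑ j ∈ Finset.Icc 1 d.n, (-1) ^ (j + 1) *
  (Real.log (Real.sin (d.angle x + d.nu j)) - Real.log (Real.sin (d.angle x - d.nu j)))

theorem sum_neg_one_pow_succ (i : ℕ) :
    ∑ j ∈ Finset.Icc 1 i, (-1 : ℂ) ^ (j + 1) = if Odd i then 1 else 0 := by
  induction i with
  | zero => simp
  | succ i ih =>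
    rw [← Finset.insert_Icc_right_eq_Icc_add_one (by omega), Finset.sum_insert (by simp), ih]
    rcases Nat.even_or_odd i with h | h
    · rw [if_neg (Nat.not_odd_iff_even.mpr h), if_pos h.add_one, h.add_one.add_one.neg_one_pow]
      ring
    · rw [if_pos h, if_neg (Nat.not_odd_iff_even.mpr h.add_one), h.add_one.add_one.neg_one_pow]
      ring

/-- Each j ≤ i has sin (η - ν_j) < 0 and contributes (-1)^(j+1) iπ/2. The alternating sum leaves
iπ/2 on J and 0 on E. -/
theorem tendsto_gTilde_upper {i : ℕ} (hi : i ≤ d.n) {x : ℝ}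
    (hx : x ∈ Ioo (d.c i) (d.c (i + 1))) :
    Tendsto d.gTilde (upper x)
      (𝓝 (d.logRho x + (if Odd i then 1 else 0) * (π / 2 * Complex.I))) := by
  have hx' := d.Ioo_subset hi hx
  refine Tendsto.congr' (eventually_mem_nhdsWithin.mono fun z hz => (d.gTilde_eq hz).symm) ?_
  have h : Tendsto (fun z => 1 / 2 * ∑ j ∈ Finset.Icc 1 d.n, (-1) ^ (j + 1) *
      d.logRatio z (d.b j)) (upper x) (𝓝 (1 / 2 * ∑ j ∈ Finset.Icc 1 d.n, (-1) ^ (j + 1) *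
      d.logRatioBd x (d.b j))) := by
    refine (tendsto_finsetSum _ fun j hj => ?_).const_mul _
    have hj' := Finset.mem_Icc.mp hj
    exact (d.tendsto_logRatio hx' (Ioo_subset_Icc_self (d.b_mem hj'.1 hj'.2))
      (d.ne_b_of_mem_Ioo hi hx hj'.1 hj'.2)).const_mul _
  convert h using 2
  have h1 : ∀ j ∈ Finset.Icc 1 d.n, (-1) ^ (j + 1) * d.logRatioBd x (d.b j) =
      (((-1) ^ (j + 1) * (Real.log (Real.sin (d.angle x + d.nu j)) -
        Real.log (Real.sin (d.angle x - d.nu j))) : ℝ) : ℂ) +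
      (if j ≤ i then (-1) ^ (j + 1) else 0) * (π * Complex.I) := by
    intro j hj
    have hj' := Finset.mem_Icc.mp hj
    split_ifs with hji
    · rw [d.logRatioBd_of_neg hx' (d.sin_angle_sub_nu_neg hi hx hj'.1 hji)]
      simp only [nu_eq]
      push_cast; ring
    · rw [d.logRatioBd_of_pos hx' (d.sin_angle_sub_nu_pos hi hx hj'.2 (by omega))]
      simp only [nu_eq]
      push_cast; ring
  rw [Finset.sum_congr rfl h1, Finset.sum_add_distrib, ← Finset.sum_mul, ← Finset.sum_filter,
    show Finset.filter (fun j => j ≤ i) (Finset.Icc 1 d.n) = Finset.Icc 1 i by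
      ext j; simp; omega, sum_neg_one_pow_succ, ← Complex.ofReal_sum, logRho]
  push_cast
  ring

/-! ### Schwarz symmetry and the fourth root. -/

theorem conj_R {z : ℂ} (hz : 0 < z.im) :
    d.R (starRingEnd ℂ z) = starRingEnd ℂ (d.R z) := by
  have h : ∀ a : ℝ, (starRingEnd ℂ z - a) ^ (1 / 2 : ℂ) = starRingEnd ℂ ((z - a) ^ (1 / 2 : ℂ)) := by
    intro a
    have h1 : (z - a).arg ≠ π := fun h => by
      have := (Complex.arg_eq_pi_iff.mp h).2
      simp at this
      linarith
    have h2 := Complex.conj_cpow (z - a) (1 / 2) h1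
    rw [map_sub, Complex.conj_ofReal] at h2
    rw [h2]
    congr 2
    rw [map_div₀, map_one, map_ofNat]
  rw [R, R, map_mul, h, h]

theorem ae_restrict_J_conj_plus_R : ∀ᵐ ζ ∂MeasureTheory.volume.restrict d.J,
    starRingEnd ℂ (plus d.R ζ) = -plus d.R ζ := by
  refine MeasureTheory.ae_restrict_of_ae_restrict_of_subset d.J_subset ?_
  rw [← MeasureTheory.Measure.restrict_congr_set MeasureTheory.Ioo_ae_eq_Icc]
  refine (MeasureTheory.ae_restrict_mem measurableSet_Ioo).mono fun ζ hζ => ?_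
  rw [d.plus_R hζ, map_mul, Complex.conj_I, Complex.conj_ofReal]
  ring

/-- Conjugation reverses the sign of 1/(2πi), of iπ and of R₊, three signs in all. Since g̃(∞) is
imaginary too, `PsiStar` is `Psi` with the signs of its exponents reversed. -/
theorem conj_gTilde {z : ℂ} (hz : 0 < z.im) :
    starRingEnd ℂ (d.gTilde (starRingEnd ℂ z)) = -d.gTilde z := by
  rw [gTilde, gTilde, map_mul, conj_R d hz, map_div₀, ← integral_conj, Complex.conj_conj]
  have : ∫ ζ in d.J, starRingEnd ℂ ((π * Complex.I) / (((ζ : ℂ) - starRingEnd ℂ z) * plus d.R ζ)) =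
      ∫ ζ in d.J, (π * Complex.I) / (((ζ : ℂ) - z) * plus d.R ζ) := by
    refine MeasureTheory.integral_congr_ae (d.ae_restrict_J_conj_plus_R.mono fun ζ hζ => ?_)
    dsimp only
    rw [map_div₀, map_mul, map_mul, hζ, map_sub, Complex.conj_conj]
    simp only [Complex.conj_ofReal, Complex.conj_I, mul_neg, neg_div_neg_eq]
  rw [this]
  simp only [map_mul, Complex.conj_ofReal, Complex.conj_I, map_ofNat, mul_neg, div_neg, neg_mul]

/-- The fourth root in `Ψ`. -/
def beta (z : ℂ) : ℂ := ((z - d.a₁) / (z - d.a₂)) ^ (1 / 4 : ℂ)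

theorem im_div_neg {z : ℂ} (hz : 0 < z.im) : ((z - d.a₁) / (z - d.a₂)).im < 0 := by
  have h := d.a₁_lt_a₂
  have h0 : z - d.a₂ ≠ 0 := fun h => by
    have := congrArg Complex.im h
    simp at this
    linarith
  have hn := Complex.normSq_pos.mpr h0
  rw [Complex.div_im, ← sub_div]
  refine div_neg_of_neg_of_pos ?_ hn
  simp only [Complex.sub_im, Complex.sub_re, Complex.ofReal_re, Complex.ofReal_im, sub_zero]
  nlinarith

theorem conj_beta {z : ℂ} (hz : 0 < z.im) :
    starRingEnd ℂ (d.beta (starRingEnd ℂ z)) = d.beta z := by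
  have h1 : ((z - d.a₁) / (z - d.a₂)).arg ≠ π := fun h => by
    have := (Complex.arg_eq_pi_iff.mp h).2
    linarith [d.im_div_neg hz]
  have h2 := Complex.conj_cpow _ (1 / 4) h1
  rw [map_div₀, map_sub, map_sub, Complex.conj_ofReal, Complex.conj_ofReal] at h2
  rw [beta, h2, Complex.conj_conj, beta]
  congr 1
  rw [map_div₀, map_one, map_ofNat]

/-- The quotient approaches the negative axis from below, the wrong side for the principal root. Its
reciprocal approaches from above, so the limit is taken there and inverted. -/
theorem tendsto_beta {x : ℝ} (hx : x ∈ Ioo d.a₁ d.a₂) :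
    Tendsto d.beta (upper x) (𝓝 ((√(Real.cos (d.angle x)) / √(Real.sin (d.angle x)) : ℝ) *
      Complex.exp (-(π / 4 * Complex.I)))) := by
  have hs := d.sin_angle_pos hx
  have hc := d.cos_angle_pos hx
  have h1 : Tendsto (fun z : ℂ => (z - d.a₂) / (z - d.a₁)) (upper x)
      (𝓝 (((x - d.a₂) / (x - d.a₁) : ℝ) : ℂ)) := by
    rw [Complex.ofReal_div]
    exact (tendsto_sub_upper x d.a₂).div (tendsto_sub_upper x d.a₁)
      (by exact_mod_cast (sub_pos.mpr hx.1).ne')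
  have hneg : (x - d.a₂) / (x - d.a₁) < 0 :=
    div_neg_of_neg_of_pos (by linarith [hx.2]) (by linarith [hx.1])
  have him : ∀ᶠ z : ℂ in upper x, 0 ≤ ((z - d.a₂) / (z - d.a₁)).im := by
    filter_upwards [self_mem_nhdsWithin] with z hz
    have := d.im_div_neg (z := z) hz
    rw [← inv_div, Complex.inv_im]
    exact div_nonneg (by linarith) (Complex.normSq_nonneg _)
  have h2 := (tendsto_cpow_upper hneg.ne (1 / 4) h1 him)
  have hval : ((((x - d.a₂) / (x - d.a₁) : ℝ) : ℂ) ^ (1 / 4 : ℂ))⁻¹ =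
      (√(Real.cos (d.angle x)) / √(Real.sin (d.angle x)) : ℝ) *
      Complex.exp (-(π / 4 * Complex.I)) := by
    have e : -((x - d.a₂) / (x - d.a₁)) = (√(Real.sin (d.angle x)) / √(Real.cos (d.angle x))) ^ 4 := by
      have e1 : x - d.a₁ = (d.scale * Real.cos (d.angle x)) ^ 2 := by
        rw [d.scale_mul_cos (Ioo_subset_Icc_self hx), Real.sq_sqrt (by linarith [hx.1])]
      have e2 : d.a₂ - x = (d.scale * Real.sin (d.angle x)) ^ 2 := by
        rw [d.scale_mul_sin (Ioo_subset_Icc_self hx), Real.sq_sqrt (by linarith [hx.2])]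
      rw [← neg_div, neg_sub, e1, e2, div_pow, show (4 : ℕ) = 2 * 2 by norm_num, pow_mul, pow_mul,
        Real.sq_sqrt hs.le, Real.sq_sqrt hc.le, mul_pow, mul_pow,
        mul_div_mul_left _ _ (pow_pos d.scale_pos 2).ne']
    rw [show (1 / 4 : ℂ) = ((1 / 4 : ℝ) : ℂ) by simp, ofReal_cpow_of_neg hneg, e,
      ← Real.rpow_natCast, ← Real.rpow_mul (by positivity)]
    norm_num
    rw [← Complex.exp_neg, mul_comm]
    congr 2
    ring
  rw [← hval]
  refine (h2.inv₀ ?_).congr' ?_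
  · rw [Complex.cpow_ne_zero_iff]
    left
    exact_mod_cast hneg.ne
  · filter_upwards [self_mem_nhdsWithin] with z hz
    have h3 : ((z - d.a₁) / (z - d.a₂)).arg ≠ π := fun h => by
      have := (Complex.arg_eq_pi_iff.mp h).2
      linarith [d.im_div_neg hz]
    rw [beta, ← inv_div (z - d.a₁), Complex.inv_cpow _ _ h3, inv_inv]

/-- The normalization `1 / (2 √(sin η cos η))`. -/
def norm (x : ℝ) : ℝ := 1 / (2 * (√(Real.sin (d.angle x)) * √(Real.cos (d.angle x))))

theorem norm_pos {x : ℝ} (hx : x ∈ Ioo d.a₁ d.a₂) : 0 < d.norm x := by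
  have := Real.sqrt_pos.mpr (d.sin_angle_pos hx)
  have := Real.sqrt_pos.mpr (d.cos_angle_pos hx)
  unfold norm
  positivity

theorem norm_sq_mul {x : ℝ} (hx : x ∈ Ioo d.a₁ d.a₂) :
    d.norm x ^ 2 * (4 * (Real.sin (d.angle x) * Real.cos (d.angle x))) = 1 := by
  have hs := d.sin_angle_pos hx
  have hc := d.cos_angle_pos hx
  rw [norm, div_pow, mul_pow, mul_pow, Real.sq_sqrt hs.le, Real.sq_sqrt hc.le]
  field_simp
  norm_num

/-- In the limit β = √(cos η / sin η) e^{-iπ/4} and 1/β = i √(sin η / cos η) e^{-iπ/4}, so β ± 1/β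
is a multiple of cos η ± i sin η = e^{±iη}. -/
theorem tendsto_beta_add_inv {x : ℝ} (hx : x ∈ Ioo d.a₁ d.a₂) :
    Tendsto (fun z => (d.beta z + (d.beta z)⁻¹) / 2) (upper x)
      (𝓝 (d.norm x * Complex.exp ((d.angle x - π / 4 : ℝ) * Complex.I))) ∧
    Tendsto (fun z => (d.beta z - (d.beta z)⁻¹) / 2) (upper x)
      (𝓝 (d.norm x * Complex.exp ((-d.angle x - π / 4 : ℝ) * Complex.I))) := by
  have hs := d.sin_angle_pos hx
  have hc := d.cos_angle_pos hx
  have hs' := Real.sqrt_pos.mpr hs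
  have hc' := Real.sqrt_pos.mpr hc
  have h := d.tendsto_beta hx
  have hne : ((√(Real.cos (d.angle x)) / √(Real.sin (d.angle x)) : ℝ) : ℂ) *
      Complex.exp (-(π / 4 * Complex.I)) ≠ 0 :=
    mul_ne_zero (by exact_mod_cast (div_pos hc' hs').ne') (Complex.exp_ne_zero _)
  have hi := h.inv₀ hne
  have k1 : Complex.exp ((d.angle x - π / 4 : ℝ) * Complex.I) =
      (Real.cos (d.angle x) + Real.sin (d.angle x) * Complex.I) *
        Complex.exp (-(π / 4 * Complex.I)) := by
    rw [Complex.ofReal_cos, Complex.ofReal_sin, ← Complex.exp_mul_I, ← Complex.exp_add]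
    congr 1; push_cast; ring
  have k2 : Complex.exp ((-d.angle x - π / 4 : ℝ) * Complex.I) =
      (Real.cos (d.angle x) - Real.sin (d.angle x) * Complex.I) *
        Complex.exp (-(π / 4 * Complex.I)) := by
    have h : (Real.cos (d.angle x) - Real.sin (d.angle x) * Complex.I : ℂ) =
        Complex.exp (-(d.angle x) * Complex.I) := by
      rw [Complex.exp_mul_I, Complex.cos_neg, Complex.sin_neg, Complex.ofReal_cos,
        Complex.ofReal_sin]
      ring
    rw [h, ← Complex.exp_add]
    congr 1; push_cast; ring
  have k3 : (Complex.exp (-(π / 4 * Complex.I)))⁻¹ =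
      Complex.I * Complex.exp (-(π / 4 * Complex.I)) := by
    rw [← Complex.exp_neg, neg_neg]
    nth_rewrite 2 [← Complex.exp_pi_div_two_mul_I]
    rw [← Complex.exp_add]
    congr 1; ring
  have es : ((√(Real.sin (d.angle x)) : ℝ) : ℂ) ^ 2 = Real.sin (d.angle x) := by
    exact_mod_cast Real.sq_sqrt hs.le
  have ec : ((√(Real.cos (d.angle x)) : ℝ) : ℂ) ^ 2 = Real.cos (d.angle x) := by
    exact_mod_cast Real.sq_sqrt hc.le
  have ns : ((√(Real.sin (d.angle x)) : ℝ) : ℂ) ≠ 0 := by exact_mod_cast hs'.ne'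
  have nc : ((√(Real.cos (d.angle x)) : ℝ) : ℂ) ≠ 0 := by exact_mod_cast hc'.ne'
  constructor
  · convert (h.add hi).div_const 2 using 2
    rw [k1, mul_inv, k3, norm, ← es, ← ec]
    push_cast
    field_simp
  · convert (h.sub hi).div_const 2 using 2
    rw [k2, mul_inv, k3, norm, ← es, ← ec]
    push_cast
    field_simp

end Config

/-! ### Moduli and phases of e^{g̃} and of B_n^{1/4}. -/

theorem rpow_sq_of_sign {t : ℝ} (ht : 0 < t) (k : ℤ) : (t ^ ((k : ℝ) / 2)) ^ 2 = t ^ k := by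
  rw [← Real.rpow_natCast, ← Real.rpow_mul ht.le, ← Real.rpow_intCast]
  congr 1
  push_cast
  ring

theorem sum_Ioc_neg_one_pow {i n : ℕ} (h : i ≤ n) :
    ∑ j ∈ Finset.Ioc i n, (-1 : ℝ) ^ j / 2 = ((-1) ^ n - (-1) ^ i) / 4 := by
  induction n, h using Nat.le_induction with
  | base => simp
  | succ n h ih =>
    rw [Finset.sum_Ioc_succ_top h, ih]
    ring

theorem prod_zpow_neg_one_pow {s : ℝ} (hs : s ≠ 0) (m : ℕ) :
    ∏ j ∈ Finset.Icc 1 m, (s ^ 2) ^ ((-1 : ℤ) ^ j) = s ^ ((-1 : ℤ) ^ m - 1) := by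
  induction m with
  | zero => simp
  | succ m ih =>
    rw [← Finset.insert_Icc_right_eq_Icc_add_one (by omega), Finset.prod_insert (by simp), ih]
    rcases Nat.even_or_odd m with h | h
    · rw [h.neg_one_pow, h.add_one.neg_one_pow]
      norm_num
    · rw [h.neg_one_pow, h.add_one.neg_one_pow]
      norm_num
      field_simp

namespace Config

variable (d : Config)

theorem exp_logRho_sq {i : ℕ} (hi : i ≤ d.n) {x : ℝ} (hx : x ∈ Ioo (d.c i) (d.c (i + 1))) :
    Real.exp (d.logRho x) ^ 2 * |d.subProd (d.angle x)| = d.addProd (d.angle x) := by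
  have hx' := d.Ioo_subset hi hx
  rw [← Real.exp_nat_mul, logRho, subProd, Finset.abs_prod, addProd]
  rw [show ((2 : ℕ) : ℝ) * (1 / 2 * ∑ j ∈ Finset.Icc 1 d.n, (-1 : ℝ) ^ (j + 1) *
    (Real.log (Real.sin (d.angle x + d.nu j)) - Real.log (Real.sin (d.angle x - d.nu j)))) =
    ∑ j ∈ Finset.Icc 1 d.n, (-1 : ℝ) ^ (j + 1) *
    (Real.log (Real.sin (d.angle x + d.nu j)) - Real.log (Real.sin (d.angle x - d.nu j))) by
      push_cast; ring, Real.exp_sum, ← Finset.prod_mul_distrib]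
  refine Finset.prod_congr rfl fun j hj => ?_
  have hj' := Finset.mem_Icc.mp hj
  have h1 := d.sin_angle_add_nu_pos hx' j
  have h2 : Real.sin (d.angle x - d.nu j) ≠ 0 := by
    rcases le_or_gt j i with h | h
    · exact (d.sin_angle_sub_nu_neg hi hx hj'.1 h).ne
    · exact (d.sin_angle_sub_nu_pos hi hx hj'.2 h).ne'
  -- `Real.log` disregards the sign of its argument, so `logRho` is correct also where sin (η - ν_j)
  -- is negative.
  rw [← Real.log_abs (Real.sin (d.angle x - d.nu j)), abs_zpow]
  have h3 := abs_pos.mpr h2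
  generalize |Real.sin (d.angle x - d.nu j)| = T at *
  generalize Real.sin (d.angle x + d.nu j) = N at *
  rcases Nat.even_or_odd (j + 1) with h | h
  · rw [h.neg_one_pow, h.neg_one_pow, one_mul, Real.exp_sub, Real.exp_log h1, Real.exp_log h3,
      zpow_one, zpow_one]
    field_simp
  · rw [h.neg_one_pow, h.neg_one_pow, neg_one_mul, neg_sub, Real.exp_sub, Real.exp_log h1,
      Real.exp_log h3, zpow_neg, zpow_neg, zpow_one, zpow_one]
    field_simp

/-- The modulus of the boundary value of `B_n^{1/4}`. -/
def modB (x : ℝ) : ℝ := (x - d.a₁) ^ (1 / 4 : ℝ) * (d.a₂ - x) ^ (-(-1 : ℝ) ^ d.n / 4) *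
  ∏ j ∈ Finset.Icc 1 d.n, |x - d.b j| ^ ((-1 : ℝ) ^ j / 2)

theorem modB_pos {i : ℕ} (hi : i ≤ d.n) {x : ℝ} (hx : x ∈ Ioo (d.c i) (d.c (i + 1))) :
    0 < d.modB x := by
  have hx' := d.Ioo_subset hi hx
  refine mul_pos (mul_pos (Real.rpow_pos_of_pos (sub_pos.mpr hx'.1) _)
    (Real.rpow_pos_of_pos (sub_pos.mpr hx'.2) _)) (Finset.prod_pos fun j hj => ?_)
  have hj' := Finset.mem_Icc.mp hj
  exact Real.rpow_pos_of_pos (abs_pos.mpr (sub_ne_zero.mpr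
    (d.ne_b_of_mem_Ioo hi hx hj'.1 hj'.2))) _

theorem continuousAt_modB {i : ℕ} (hi : i ≤ d.n) {x : ℝ} (hx : x ∈ Ioo (d.c i) (d.c (i + 1))) :
    ContinuousAt d.modB x := by
  have hx' := d.Ioo_subset hi hx
  refine ((ContinuousAt.rpow_const (f := fun t => t - d.a₁) (by fun_prop)
    (Or.inl (sub_pos.mpr hx'.1).ne')).mul (ContinuousAt.rpow_const (f := fun t => d.a₂ - t)
    (by fun_prop) (Or.inl (sub_pos.mpr hx'.2).ne'))).mul
    (tendsto_finsetProd _ fun j hj => ?_)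
  have hj' := Finset.mem_Icc.mp hj
  exact ContinuousAt.rpow_const (f := fun t => |t - d.b j|)
    (Continuous.continuousAt (by fun_prop)) (Or.inl (abs_pos.mpr (sub_ne_zero.mpr
    (d.ne_b_of_mem_Ioo hi hx hj'.1 hj'.2))).ne')

theorem modB_sq {i : ℕ} (hi : i ≤ d.n) {x : ℝ} (hx : x ∈ Ioo (d.c i) (d.c (i + 1))) :
    d.modB x ^ 2 * (d.addProd (d.angle x) * |d.subProd (d.angle x)|) =
      Real.cos (d.angle x) * Real.sin (d.angle x) ^ (-(-1 : ℤ) ^ d.n) := by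
  have hx' := d.Ioo_subset hi hx
  have h0 := d.scale_pos
  have hs := d.sin_angle_pos hx'
  have hc := d.cos_angle_pos hx'
  have e1 : ((x - d.a₁) ^ (1 / 4 : ℝ)) ^ 2 = d.scale * Real.cos (d.angle x) := by
    rw [d.scale_mul_cos (Ioo_subset_Icc_self hx'), Real.sqrt_eq_rpow, ← Real.rpow_natCast,
      ← Real.rpow_mul (sub_pos.mpr hx'.1).le]
    norm_num
  have e2 : ((d.a₂ - x) ^ (-(-1 : ℝ) ^ d.n / 4)) ^ 2 =
      (d.scale * Real.sin (d.angle x)) ^ (-(-1 : ℤ) ^ d.n) := by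
    rw [d.scale_mul_sin (Ioo_subset_Icc_self hx'), Real.sqrt_eq_rpow, ← Real.rpow_natCast,
      ← Real.rpow_mul (sub_pos.mpr hx'.2).le, ← Real.rpow_intCast,
      ← Real.rpow_mul (sub_pos.mpr hx'.2).le]
    congr 1
    push_cast
    ring
  have e3 : ∀ j ∈ Finset.Icc 1 d.n, (|x - d.b j| ^ ((-1 : ℝ) ^ j / 2)) ^ 2 *
      (Real.sin (d.angle x + d.nu j) ^ ((-1 : ℤ) ^ (j + 1)) *
        |Real.sin (d.angle x - d.nu j) ^ ((-1 : ℤ) ^ (j + 1))|) = (d.scale ^ 2) ^ ((-1 : ℤ) ^ j) := by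
    intro j hj
    have hj' := Finset.mem_Icc.mp hj
    have hne := d.ne_b_of_mem_Ioo hi hx hj'.1 hj'.2
    have h1 := d.sin_angle_add_nu_pos hx' j
    have h2 : 0 < |Real.sin (d.angle x - d.nu j)| := by
      rw [abs_pos, ← neg_ne_zero, ← Real.sin_neg, neg_sub]
      exact d.sin_nu_sub_angle_ne_zero hx' hj'.1 hj'.2 hne
    have h3 := rpow_sq_of_sign (abs_pos.mpr (sub_ne_zero.mpr hne)) ((-1) ^ j)
    push_cast at h3
    rw [h3, abs_zpow, d.sub_b_eq hx' hj'.1 hj'.2, abs_mul, abs_mul, abs_of_pos h1,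
      abs_of_pos (pow_pos h0 2), ← neg_sub (d.angle x), Real.sin_neg, abs_neg, mul_zpow, mul_zpow,
      pow_succ (-1 : ℤ) j, mul_neg_one, zpow_neg, zpow_neg]
    have h4 := (zpow_pos h1 ((-1) ^ j)).ne'
    have h5 := (zpow_pos h2 ((-1) ^ j)).ne'
    field_simp
  have e4 : (∏ j ∈ Finset.Icc 1 d.n, |x - d.b j| ^ ((-1 : ℝ) ^ j / 2)) ^ 2 *
      (d.addProd (d.angle x) * |d.subProd (d.angle x)|) = d.scale ^ ((-1 : ℤ) ^ d.n - 1) := by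
    rw [addProd, subProd, Finset.abs_prod, ← Finset.prod_pow, ← Finset.prod_mul_distrib,
      ← Finset.prod_mul_distrib, Finset.prod_congr rfl e3, prod_zpow_neg_one_pow h0.ne']
  rw [modB, mul_pow, mul_pow, e1, e2, mul_assoc, e4, mul_zpow]
  -- The exponents of `scale` coming from a₁, from a₂ and from the b_j add up to zero.
  have e5 : d.scale * d.scale ^ (-(-1 : ℤ) ^ d.n) * d.scale ^ ((-1 : ℤ) ^ d.n - 1) = 1 := by
    rw [← zpow_one_add₀ h0.ne', ← zpow_add₀ h0.ne']
    ring_nf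
    simp
  linear_combination (Real.cos (d.angle x) * Real.sin (d.angle x) ^ (-(-1 : ℤ) ^ d.n)) * e5

/-- Each b_j > x contributes the phase π (-1)^j / 2, and a₂ contributes -π (-1)^n / 4. The
alternating sum over j > i cancels the dependence on n and leaves -π (-1)^i / 4. -/
theorem plus_BRoot {i : ℕ} (hi : i ≤ d.n) {x : ℝ} (hx : x ∈ Ioo (d.c i) (d.c (i + 1))) :
    plus d.BRoot x = d.modB x * Complex.exp (-(-1) ^ i * (π / 4 * Complex.I)) := by
  have hx' := d.Ioo_subset hi hx
  refine plus_eq ?_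
  have h : Tendsto d.BRoot (upper x) (𝓝 ((((x - d.a₁ : ℝ) : ℂ) ^ (1 / 4 : ℂ)) *
      (((x - d.a₂ : ℝ) : ℂ) ^ (-(-1) ^ d.n / 4 : ℂ)) *
      ∏ j ∈ Finset.Icc 1 d.n, ((x - d.b j : ℝ) : ℂ) ^ ((-1) ^ j / 2 : ℂ))) := by
    refine ((tendsto_sub_cpow_upper hx'.1.ne' _).mul (tendsto_sub_cpow_upper hx'.2.ne _)).mul
      (tendsto_finsetProd _ fun j hj => ?_)
    have hj' := Finset.mem_Icc.mp hj
    exact tendsto_sub_cpow_upper (d.ne_b_of_mem_Ioo hi hx hj'.1 hj'.2) _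
  convert h using 2
  have e1 : ((x - d.a₁ : ℝ) : ℂ) ^ (1 / 4 : ℂ) = (((x - d.a₁) ^ (1 / 4 : ℝ) : ℝ) : ℂ) := by
    rw [← ofReal_cpow_of_pos (sub_pos.mpr hx'.1)]; congr 1; push_cast; rfl
  have e2 : ((x - d.a₂ : ℝ) : ℂ) ^ (-(-1) ^ d.n / 4 : ℂ) =
      (((d.a₂ - x) ^ (-(-1 : ℝ) ^ d.n / 4) : ℝ) : ℂ) *
        Complex.exp (π * Complex.I * (-(-1 : ℝ) ^ d.n / 4 : ℝ)) := by
    rw [← neg_sub x, ← ofReal_cpow_of_neg (by linarith [hx'.2])]; congr 1; push_cast; rfl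
  have e3 : ∀ j ∈ Finset.Icc 1 d.n, ((x - d.b j : ℝ) : ℂ) ^ ((-1) ^ j / 2 : ℂ) =
      ((|x - d.b j| ^ ((-1 : ℝ) ^ j / 2) : ℝ) : ℂ) *
        Complex.exp (π * Complex.I * (if i < j then (-1 : ℝ) ^ j / 2 else 0 : ℝ)) := by
    intro j hj
    have hj' := Finset.mem_Icc.mp hj
    have hexp : ((-1) ^ j / 2 : ℂ) = (((-1 : ℝ) ^ j / 2 : ℝ) : ℂ) := by push_cast; rfl
    rw [hexp]
    split_ifs with hij
    · have hlt : x - d.b j < 0 := by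
        rw [← d.c_of_mem hj'.1 hj'.2]
        linarith [hx.2, d.c_le (show i + 1 ≤ j from hij) (by omega)]
      rw [ofReal_cpow_of_neg hlt, abs_of_neg hlt]
    · have hlt : 0 < x - d.b j := by
        rw [← d.c_of_mem hj'.1 hj'.2]
        linarith [hx.1, d.c_le (show j ≤ i by omega) (by omega)]
      rw [ofReal_cpow_of_pos hlt, abs_of_pos hlt]
      simp
  rw [e1, e2, Finset.prod_congr rfl e3, Finset.prod_mul_distrib, ← Complex.exp_sum,
    ← Finset.mul_sum, ← Complex.ofReal_sum, ← Finset.sum_filter,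
    show Finset.filter (fun j => i < j) (Finset.Icc 1 d.n) = Finset.Ioc i d.n by
      ext j; simp; omega, sum_Ioc_neg_one_pow hi, modB]
  have e4 : Complex.exp (-(-1) ^ i * (π / 4 * Complex.I)) =
      Complex.exp (π * Complex.I * (-(-1 : ℝ) ^ d.n / 4 : ℝ)) *
        Complex.exp (π * Complex.I * (((-1 : ℝ) ^ d.n - (-1) ^ i) / 4 : ℝ)) := by
    rw [← Complex.exp_add]
    congr 1
    push_cast
    ring
  rw [e4]
  push_cast
  ring

theorem isBoundaryData_of_mem_Ioo {i : ℕ} (hi : i ≤ d.n) {x : ℝ}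
    (hx : x ∈ Ioo (d.c i) (d.c (i + 1))) :
    d.IsBoundaryData x ((-1) ^ i) (Real.exp (d.logRho x)) (d.modB x) (d.norm x) :=
  d.isBoundaryData hi hx (Real.exp_pos _) (d.modB_pos hi hx) (d.norm_pos (d.Ioo_subset hi hx))
    (d.norm_sq_mul (d.Ioo_subset hi hx)) (d.exp_logRho_sq hi hx) (d.modB_sq hi hx)

end Config

/-! ### The columns u and w on the two shores. -/

/-- The shape of an entry of Ψ + Ψ*: the summands differ in the signs of α and of r + iφ, the value
of g̃ up to the sign of the column. The phase μ is that of the fourth root, and θ is ±ϰ Im g₊. In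
`re_mul_sub` the factor 1/i turns cosines into sines. -/
theorem re_mul_add (θ α μ m r φ : ℝ) :
    (Complex.exp (Complex.I * θ) * (1 / 2 * (Complex.exp (Complex.I * α) *
      (m * Complex.exp (μ * Complex.I)) * Complex.exp (-(r + φ * Complex.I)) +
      Complex.exp (-(Complex.I * α)) * (m * Complex.exp (μ * Complex.I)) *
        Complex.exp (r + φ * Complex.I)))).re =
    m / 2 * (Real.exp (-r) * Real.cos (θ + α + μ - φ) + Real.exp r * Real.cos (θ - α + μ + φ)) := by
  have h : Complex.exp (Complex.I * θ) * (1 / 2 * (Complex.exp (Complex.I * α) *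
      (m * Complex.exp (μ * Complex.I)) * Complex.exp (-(r + φ * Complex.I)) +
      Complex.exp (-(Complex.I * α)) * (m * Complex.exp (μ * Complex.I)) *
        Complex.exp (r + φ * Complex.I))) =
      ((m / 2 : ℝ) : ℂ) * (Complex.exp ((-r : ℝ) + (θ + α + μ - φ : ℝ) * Complex.I) +
        Complex.exp (r + (θ - α + μ + φ : ℝ) * Complex.I)) := by
    have e1 : Complex.exp ((-r : ℝ) + (θ + α + μ - φ : ℝ) * Complex.I) =
        Complex.exp (Complex.I * θ) * Complex.exp (Complex.I * α) * Complex.exp (μ * Complex.I) *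
          Complex.exp (-(r + φ * Complex.I)) := by
      simp only [← Complex.exp_add]; congr 1; push_cast; ring
    have e2 : Complex.exp (r + (θ - α + μ + φ : ℝ) * Complex.I) =
        Complex.exp (Complex.I * θ) * Complex.exp (-(Complex.I * α)) *
          Complex.exp (μ * Complex.I) * Complex.exp (r + φ * Complex.I) := by
      simp only [← Complex.exp_add]; congr 1; push_cast; ring
    rw [e1, e2]
    push_cast
    ring
  rw [h, Complex.re_ofReal_mul, Complex.add_re, Complex.exp_re, Complex.exp_re]
  simp

theorem re_mul_sub (θ α μ m r φ : ℝ) :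
    (Complex.exp (Complex.I * θ) * (1 / (2 * Complex.I) * (Complex.exp (Complex.I * α) *
      (m * Complex.exp (μ * Complex.I)) * Complex.exp (-(r + φ * Complex.I)) -
      Complex.exp (-(Complex.I * α)) * (m * Complex.exp (μ * Complex.I)) *
        Complex.exp (r + φ * Complex.I)))).re =
    m / 2 * (Real.exp (-r) * Real.sin (θ + α + μ - φ) - Real.exp r * Real.sin (θ - α + μ + φ)) := by
  have h : Complex.exp (Complex.I * θ) * (1 / (2 * Complex.I) * (Complex.exp (Complex.I * α) *
      (m * Complex.exp (μ * Complex.I)) * Complex.exp (-(r + φ * Complex.I)) -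
      Complex.exp (-(Complex.I * α)) * (m * Complex.exp (μ * Complex.I)) *
        Complex.exp (r + φ * Complex.I))) =
      ((m / 2 : ℝ) : ℂ) * (-Complex.I *
        (Complex.exp ((-r : ℝ) + (θ + α + μ - φ : ℝ) * Complex.I) -
        Complex.exp (r + (θ - α + μ + φ : ℝ) * Complex.I))) := by
    have e1 : Complex.exp ((-r : ℝ) + (θ + α + μ - φ : ℝ) * Complex.I) =
        Complex.exp (Complex.I * θ) * Complex.exp (Complex.I * α) * Complex.exp (μ * Complex.I) *
          Complex.exp (-(r + φ * Complex.I)) := by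
      simp only [← Complex.exp_add]; congr 1; push_cast; ring
    have e2 : Complex.exp (r + (θ - α + μ + φ : ℝ) * Complex.I) =
        Complex.exp (Complex.I * θ) * Complex.exp (-(Complex.I * α)) *
          Complex.exp (μ * Complex.I) * Complex.exp (r + φ * Complex.I) := by
      simp only [← Complex.exp_add]; congr 1; push_cast; ring
    rw [e1, e2, one_div, mul_inv, Complex.inv_I]
    push_cast
    ring
  rw [h, Complex.re_ofReal_mul, neg_mul, Complex.neg_re, Complex.I_mul_re, Complex.sub_im,
    Complex.exp_im, Complex.exp_im]
  simp

/-- The diagonal entries of `σ₃`. -/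
def pauliSign : Fin 2 → ℝ := ![1, -1]

namespace Config

variable (d : Config)

/-- The entries of `((z - a₁) / (z - a₂))^(σ₁ / 4)`. -/
def betaEntry (i k : Fin 2) (z : ℂ) : ℂ :=
  if i = k then (d.beta z + (d.beta z)⁻¹) / 2 else (d.beta z - (d.beta z)⁻¹) / 2

theorem Psi_apply (z : ℂ) (i k : Fin 2) :
    d.Psi z i k = Complex.exp (pauliSign i * d.gTildeInf) * d.betaEntry i k z *
      Complex.exp (-(pauliSign k * d.gTilde z)) := by
  fin_cases i <;> fin_cases k <;>
    simp [Psi, expSigma3, powSigma1, betaEntry, pauliSign, beta, Matrix.mul_apply,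
      Fin.sum_univ_two]

theorem conj_betaEntry {z : ℂ} (hz : 0 < z.im) (i k : Fin 2) :
    starRingEnd ℂ (d.betaEntry i k (starRingEnd ℂ z)) = d.betaEntry i k z := by
  unfold betaEntry
  split_ifs <;> simp only [map_div₀, map_add, map_sub, map_inv₀, d.conj_beta hz, map_ofNat]

theorem PsiStar_apply {z : ℂ} (hz : 0 < z.im) (i k : Fin 2) :
    d.PsiStar z i k = Complex.exp (-(pauliSign i * d.gTildeInf)) * d.betaEntry i k z *
      Complex.exp (pauliSign k * d.gTilde z) := by
  have h : starRingEnd ℂ d.gTildeInf = -d.gTildeInf := by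
    rw [gTildeInf_eq, map_mul, Complex.conj_I, Complex.conj_ofReal]; ring
  rw [PsiStar, Matrix.map_apply, Psi_apply, map_mul, map_mul, ← Complex.exp_conj,
    ← Complex.exp_conj, d.conj_betaEntry hz, map_neg, map_mul, map_mul, d.conj_gTilde hz, h,
    Complex.conj_ofReal, Complex.conj_ofReal]
  simp only [mul_neg, neg_neg]

theorem tendsto_betaEntry {x : ℝ} (hx : x ∈ Ioo d.a₁ d.a₂) (i k : Fin 2) :
    Tendsto (d.betaEntry i k) (upper x) (𝓝 (d.norm x *
      Complex.exp ((pauliSign i * pauliSign k * d.angle x - π / 4 : ℝ) * Complex.I))) := by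
  obtain ⟨h1, h2⟩ := d.tendsto_beta_add_inv hx
  have hb : d.betaEntry i k = fun z => if i = k then (d.beta z + (d.beta z)⁻¹) / 2
    else (d.beta z - (d.beta z)⁻¹) / 2 := rfl
  rw [hb]
  fin_cases i <;> fin_cases k
  · simpa [pauliSign] using h1
  · simpa [pauliSign] using h2
  · simpa [pauliSign] using h2
  · simpa [pauliSign] using h1

/-- The imaginary part of the boundary value of `g̃` on the `i`-th interval. -/
def argBd (i : ℕ) : ℝ := if Odd i then π / 2 else 0

theorem tendsto_Psi_terms {i : ℕ} (hi : i ≤ d.n) {x : ℝ} (hx : x ∈ Ioo (d.c i) (d.c (i + 1)))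
    (j k : Fin 2) :
    Tendsto (fun z => d.Psi z j k) (upper x)
      (𝓝 (Complex.exp (Complex.I * (pauliSign j * d.alpha : ℝ)) * (d.norm x *
        Complex.exp ((pauliSign j * pauliSign k * d.angle x - π / 4 : ℝ) * Complex.I)) *
        Complex.exp (-((pauliSign k * d.logRho x : ℝ) + (pauliSign k * argBd i : ℝ) *
          Complex.I)))) ∧
    Tendsto (fun z => d.PsiStar z j k) (upper x)
      (𝓝 (Complex.exp (-(Complex.I * (pauliSign j * d.alpha : ℝ))) * (d.norm x *
        Complex.exp ((pauliSign j * pauliSign k * d.angle x - π / 4 : ℝ) * Complex.I)) *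
        Complex.exp ((pauliSign k * d.logRho x : ℝ) + (pauliSign k * argBd i : ℝ) *
          Complex.I))) := by
  have hg := (d.tendsto_gTilde_upper hi hx).const_mul (pauliSign k : ℂ)
  have hb := d.tendsto_betaEntry (d.Ioo_subset hi hx) j k
  have e1 : (pauliSign k : ℂ) * (d.logRho x + (if Odd i then 1 else 0) * (π / 2 * Complex.I)) =
      (pauliSign k * d.logRho x : ℝ) + (pauliSign k * argBd i : ℝ) * Complex.I := by
    unfold argBd
    split_ifs
    · push_cast; ring
    · push_cast; ring
  have e2 : (pauliSign j : ℂ) * d.gTildeInf = Complex.I * (pauliSign j * d.alpha : ℝ) := by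
    rw [gTildeInf_eq, alpha_eq]; push_cast; ring
  rw [e1] at hg
  constructor
  · simp only [Psi_apply, e2]
    exact (hb.const_mul _).mul ((Complex.continuous_exp.tendsto _).comp hg.neg)
  · refine Tendsto.congr' (eventually_mem_nhdsWithin.mono fun z hz =>
      (d.PsiStar_apply hz j k).symm) ?_
    simp only [e2]
    exact (hb.const_mul _).mul ((Complex.continuous_exp.tendsto _).comp hg)

theorem shoreCol_PsiHat {i : ℕ} (hi : i ≤ d.n) {x : ℝ} (hx : x ∈ Ioo (d.c i) (d.c (i + 1)))
    (s : ℝ) (k j : Fin 2) (lam : ℝ) : d.shoreCol d.PsiHat s k lam x j =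
      d.norm x / 2 * (Real.exp (-(pauliSign k * d.logRho x)) *
        Real.cos (s * (kappa lam * (plus d.g x).im) + pauliSign j * d.alpha +
          (pauliSign j * pauliSign k * d.angle x - π / 4) - pauliSign k * argBd i) +
        Real.exp (pauliSign k * d.logRho x) *
        Real.cos (s * (kappa lam * (plus d.g x).im) - pauliSign j * d.alpha +
          (pauliSign j * pauliSign k * d.angle x - π / 4) + pauliSign k * argBd i)) := by
  obtain ⟨h1, h2⟩ := d.tendsto_Psi_terms hi hx j k
  rw [shoreCol, ← re_mul_add, plus_eq (f := fun z => d.PsiHat z j k) ((h1.add h2).const_mul (1 / 2))]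
  congr 3
  push_cast
  ring

theorem shoreCol_PsiBreve {i : ℕ} (hi : i ≤ d.n) {x : ℝ} (hx : x ∈ Ioo (d.c i) (d.c (i + 1)))
    (s : ℝ) (k j : Fin 2) (lam : ℝ) : d.shoreCol d.PsiBreve s k lam x j =
      d.norm x / 2 * (Real.exp (-(pauliSign k * d.logRho x)) *
        Real.sin (s * (kappa lam * (plus d.g x).im) + pauliSign j * d.alpha +
          (pauliSign j * pauliSign k * d.angle x - π / 4) - pauliSign k * argBd i) -
        Real.exp (pauliSign k * d.logRho x) *
        Real.sin (s * (kappa lam * (plus d.g x).im) - pauliSign j * d.alpha +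
          (pauliSign j * pauliSign k * d.angle x - π / 4) + pauliSign k * argBd i)) := by
  obtain ⟨h1, h2⟩ := d.tendsto_Psi_terms hi hx j k
  rw [shoreCol, ← re_mul_sub, plus_eq (f := fun z => d.PsiBreve z j k)
    ((h1.sub h2).const_mul (1 / (2 * Complex.I)))]
  congr 3
  push_cast
  ring

/-- The phase `π / 4 + ϰ Im g(x₊)`. -/
def phase (lam x : ℝ) : ℝ := π / 4 + kappa lam * (plus d.g x).im

theorem hatE_eq {i : ℕ} (hi : i ≤ d.n) (he : Even i) {x : ℝ}
    (hx : x ∈ Ioo (d.c i) (d.c (i + 1))) (lam : ℝ) :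
    d.hatE lam x =
      hatCol (d.norm x) (Real.exp (d.logRho x)) 1 (d.angle x) d.alpha (d.phase lam x) := by
  have h0 : argBd i = 0 := if_neg (Nat.not_odd_iff_even.mpr he)
  ext j
  rw [hatE, d.shoreCol_PsiHat hi hx, h0, hatCol, phase, one_div, ← Real.exp_neg]
  fin_cases j
  · simp only [pauliSign, Fin.zero_eta, Matrix.cons_val_zero]
    rw [add_comm (Real.exp _ * _)]
    congr 4 <;> ring_nf
  · simp only [pauliSign, Fin.mk_one, Matrix.cons_val_zero, Matrix.cons_val_one]
    rw [add_comm (Real.exp _ * _), ← Real.cos_neg (_ + _), ← Real.cos_neg (_ - _)]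
    congr 4 <;> ring_nf

theorem breveE_eq {i : ℕ} (hi : i ≤ d.n) (he : Even i) {x : ℝ}
    (hx : x ∈ Ioo (d.c i) (d.c (i + 1))) (lam : ℝ) :
    d.breveE lam x =
      breveCol (d.norm x) (Real.exp (d.logRho x)) 1 (d.angle x) d.alpha (d.phase lam x) := by
  have h0 : argBd i = 0 := if_neg (Nat.not_odd_iff_even.mpr he)
  ext j
  rw [breveE, d.shoreCol_PsiBreve hi hx, h0, breveCol, phase, one_div, ← Real.exp_neg]
  generalize kappa lam * (plus d.g x).im = θ
  fin_cases j
  · simp only [pauliSign, Fin.zero_eta, Matrix.cons_val_zero]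
    rw [show -1 * θ + 1 * d.alpha + (1 * 1 * d.angle x - π / 4) - 1 * 0 =
        d.angle x + d.alpha - (π / 4 + θ) by ring,
      show -1 * θ - 1 * d.alpha + (1 * 1 * d.angle x - π / 4) + 1 * 0 =
        d.angle x - d.alpha - (π / 4 + θ) by ring, one_mul]
    ring
  · simp only [pauliSign, Fin.mk_one, Matrix.cons_val_zero, Matrix.cons_val_one]
    rw [show -1 * θ + -1 * d.alpha + (-1 * 1 * d.angle x - π / 4) - 1 * 0 =
        -(d.angle x + d.alpha + (π / 4 + θ)) by ring,
      show -1 * θ - -1 * d.alpha + (-1 * 1 * d.angle x - π / 4) + 1 * 0 =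
        -(d.angle x - d.alpha + (π / 4 + θ)) by ring, one_mul, Real.sin_neg, Real.sin_neg]
    ring

/-- On J the imaginary part π/2 of g̃ shifts the two cosines by π relative to each other. This is
the sign σ = -1, and it lets E and J share `hatCol`. -/
theorem hatJ_eq {i : ℕ} (hi : i ≤ d.n) (ho : Odd i) {x : ℝ}
    (hx : x ∈ Ioo (d.c i) (d.c (i + 1))) (lam : ℝ) :
    d.hatJ lam x =
      hatCol (d.norm x) (Real.exp (d.logRho x)) (-1) (d.angle x) d.alpha (d.phase lam x) := by
  have h0 : argBd i = π / 2 := if_pos ho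
  ext j
  rw [hatJ, d.shoreCol_PsiHat hi hx, h0, hatCol, phase, neg_div, one_div, ← Real.exp_neg]
  generalize kappa lam * (plus d.g x).im = θ
  fin_cases j
  · simp only [pauliSign, Fin.zero_eta, Matrix.cons_val_zero, Matrix.cons_val_one]
    rw [show 1 * θ + 1 * d.alpha + (1 * -1 * d.angle x - π / 4) - -1 * (π / 2) =
        -(d.angle x - d.alpha - (π / 4 + θ)) by ring,
      show 1 * θ - 1 * d.alpha + (1 * -1 * d.angle x - π / 4) + -1 * (π / 2) =
        -(d.angle x + d.alpha - (π / 4 + θ)) - π by ring, Real.cos_sub_pi, Real.cos_neg,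
      Real.cos_neg, neg_one_mul, neg_neg]
    ring
  · simp only [pauliSign, Fin.mk_one, Matrix.cons_val_zero, Matrix.cons_val_one]
    rw [show 1 * θ + -1 * d.alpha + (-1 * -1 * d.angle x - π / 4) - -1 * (π / 2) =
        d.angle x - d.alpha + (π / 4 + θ) by ring,
      show 1 * θ - -1 * d.alpha + (-1 * -1 * d.angle x - π / 4) + -1 * (π / 2) =
        d.angle x + d.alpha + (π / 4 + θ) - π by ring, Real.cos_sub_pi, neg_one_mul, neg_neg]
    ring

theorem breveJ_eq {i : ℕ} (hi : i ≤ d.n) (ho : Odd i) {x : ℝ}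
    (hx : x ∈ Ioo (d.c i) (d.c (i + 1))) (lam : ℝ) :
    d.breveJ lam x =
      breveCol (d.norm x) (Real.exp (d.logRho x)) (-1) (d.angle x) d.alpha (d.phase lam x) := by
  have h0 : argBd i = π / 2 := if_pos ho
  ext j
  rw [breveJ, d.shoreCol_PsiBreve hi hx, h0, breveCol, phase, neg_div, one_div, ← Real.exp_neg]
  generalize kappa lam * (plus d.g x).im = θ
  fin_cases j
  · simp only [pauliSign, Fin.zero_eta, Matrix.cons_val_zero, Matrix.cons_val_one]
    rw [show 1 * θ + 1 * d.alpha + (1 * -1 * d.angle x - π / 4) - -1 * (π / 2) =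
        -(d.angle x - d.alpha - (π / 4 + θ)) by ring,
      show 1 * θ - 1 * d.alpha + (1 * -1 * d.angle x - π / 4) + -1 * (π / 2) =
        -(d.angle x + d.alpha - (π / 4 + θ)) - π by ring, Real.sin_sub_pi, Real.sin_neg,
      Real.sin_neg, neg_one_mul, neg_neg]
    ring
  · simp only [pauliSign, Fin.mk_one, Matrix.cons_val_zero, Matrix.cons_val_one]
    rw [show 1 * θ + -1 * d.alpha + (-1 * -1 * d.angle x - π / 4) - -1 * (π / 2) =
        d.angle x - d.alpha + (π / 4 + θ) by ring,
      show 1 * θ - -1 * d.alpha + (-1 * -1 * d.angle x - π / 4) + -1 * (π / 2) =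
        d.angle x + d.alpha + (π / 4 + θ) - π by ring, Real.sin_sub_pi, neg_one_mul, neg_neg]
    ring

/-! ### The vectors f and h, and their continuity. -/

theorem re_exp_mul_modulus (θ τ D : ℝ) :
    (Complex.exp (Complex.I * θ) * (D * Complex.exp (τ * Complex.I))).re =
      D * Real.cos (θ + τ) := by
  have h : Complex.exp (Complex.I * θ) * (D * Complex.exp (τ * Complex.I)) =
      D * Complex.exp ((θ + τ : ℝ) * Complex.I) := by
    rw [mul_left_comm, ← Complex.exp_add]; congr 2; push_cast; ring
  rw [h, Complex.re_ofReal_mul, Complex.exp_ofReal_mul_I_re]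

theorem re_exp_mul_inv_modulus (θ τ D : ℝ) :
    (Complex.exp (Complex.I * θ) * (D * Complex.exp (τ * Complex.I))⁻¹).re =
      Real.cos (θ - τ) / D := by
  have h : (D * Complex.exp (τ * Complex.I) : ℂ)⁻¹ =
      ((D⁻¹ : ℝ) : ℂ) * Complex.exp ((-τ : ℝ) * Complex.I) := by
    rw [mul_inv, ← Complex.exp_neg]; push_cast; congr 2; ring
  rw [h, re_exp_mul_modulus]
  rw [← sub_eq_add_neg]; ring

/-- On E the phase -π/4 of B_n^{1/4} completes -ϰ Im g₊ to -ψ. For the inverse root it is +π/4, a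
shift by π/2 that gives sin ψ instead of cos ψ. -/
theorem hvec_eq {i : ℕ} (hi : i ≤ d.n) (he : Even i) {x : ℝ}
    (hx : x ∈ Ioo (d.c i) (d.c (i + 1))) (lam : ℝ) :
    d.hvec lam x = d.boundaryVec (d.modB x) 1 (d.phase lam x) x := by
  have hB : plus d.BRoot x = d.modB x * Complex.exp ((-(π / 4) : ℝ) * Complex.I) := by
    rw [d.plus_BRoot hi hx, he.neg_one_pow]; congr 2; push_cast; ring
  have hθ : -Complex.I * kappa lam * (plus d.g x).im =
      Complex.I * (-(kappa lam * (plus d.g x).im) : ℝ) := by push_cast; ring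
  have h1 : d.phiTildePlus lam x = d.modB x * Real.cos (d.phase lam x) := by
    rw [phiTildePlus, hθ, hB, re_exp_mul_modulus, phase, ← Real.cos_neg]
    congr 2; ring
  have h2 : d.phiTildeMinus lam x = -1 * Real.sin (d.phase lam x) / d.modB x := by
    rw [phiTildeMinus, hθ, hB, re_exp_mul_inv_modulus, phase, ← Real.cos_pi_div_two_sub, neg_one_mul,
      neg_div]
    congr 3; ring
  rw [hvec, boundaryVec, h1, h2]

theorem fvec_eq {i : ℕ} (hi : i ≤ d.n) (ho : Odd i) {x : ℝ}
    (hx : x ∈ Ioo (d.c i) (d.c (i + 1))) (lam : ℝ) :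
    d.fvec lam x = d.boundaryVec (d.modB x) (-1) (d.phase lam x) x := by
  have hB : plus d.BRoot x = d.modB x * Complex.exp ((π / 4 : ℝ) * Complex.I) := by
    rw [d.plus_BRoot hi hx, ho.neg_one_pow]; congr 2; push_cast; ring
  have hθ : Complex.I * kappa lam * (plus d.g x).im =
      Complex.I * (kappa lam * (plus d.g x).im : ℝ) := by push_cast; ring
  have h1 : d.phiPlus lam x = d.modB x * Real.cos (d.phase lam x) := by
    rw [phiPlus, hθ, hB, re_exp_mul_modulus, phase, add_comm]
  have h2 : d.phiMinus lam x = - -1 * Real.sin (d.phase lam x) / d.modB x := by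
    rw [phiMinus, hθ, hB, re_exp_mul_inv_modulus, phase, ← Real.cos_sub_pi_div_two, neg_neg, one_mul]
    congr 2; ring
  rw [fvec, boundaryVec, h1, h2]

theorem continuousAt_boundaryVec {i : ℕ} (hi : i ≤ d.n) {x : ℝ}
    (hx : x ∈ Ioo (d.c i) (d.c (i + 1))) (σ lam : ℝ) :
    ContinuousAt (fun t => d.boundaryVec (d.modB t) σ (d.phase lam t) t) x := by
  have hD := d.continuousAt_modB hi hx
  have hD0 := (d.modB_pos hi hx).ne'
  have hphase : ContinuousAt (d.phase lam) x :=
    continuousAt_const.add (continuousAt_const.mul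
      (Complex.continuous_im.continuousAt.comp (d.continuousAt_plus_g hi hx)))
  refine continuousAt_pi.mpr fun l => ?_
  rcases l with l | l
  · exact ((continuousAt_const.mul (Real.continuous_sin.continuousAt.comp hphase)).div hD hD0).div
      (by fun_prop) (sub_ne_zero.mpr
        (d.ne_b_of_mem_Ioo hi hx (d.one_le_oddIdx l) (d.oddIdx_le l)))
  · exact (hD.mul (Real.continuous_cos.continuousAt.comp hphase)).div
      (by fun_prop) (sub_ne_zero.mpr
        (d.ne_b_of_mem_Ioo hi hx (d.one_le_evenIdx l) (d.evenIdx_le l)))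

theorem continuousAt_hvec {x : ℝ} (hx : x ∈ interior d.E) (lam : ℝ) :
    ContinuousAt (d.hvec lam) x := by
  obtain ⟨i, hi, he, hxi⟩ := d.exists_even_of_mem_interior_E hx
  refine (d.continuousAt_boundaryVec hi hxi 1 lam).congr ?_
  filter_upwards [isOpen_Ioo.mem_nhds hxi] with t ht
  exact (d.hvec_eq hi he ht lam).symm

theorem continuousAt_fvec {x : ℝ} (hx : x ∈ interior d.J) (lam : ℝ) :
    ContinuousAt (d.fvec lam) x := by
  obtain ⟨i, hi, ho, hxi⟩ := d.exists_odd_of_mem_interior_J hx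
  refine (d.continuousAt_boundaryVec hi hxi (-1) lam).congr ?_
  filter_upwards [isOpen_Ioo.mem_nhds hxi] with t ht
  exact (d.fvec_eq hi ho ht lam).symm

theorem continuous_form : Continuous fun p : (d.Idx → ℝ) × (d.Idx → ℝ) => d.form p.1 p.2 := by
  unfold form
  refine continuous_const.mul (Complex.continuous_ofReal.comp ?_)
  exact continuous_fst.dotProduct (continuous_const.matrix_mulVec continuous_snd)

theorem tendsto_form_diag {v : ℝ → d.Idx → ℝ} {x : ℝ} (hv : ContinuousAt v x) (C : ℂ) :
    Tendsto (fun p : ℝ × ℝ => C * d.form (v p.2) (v p.1)) (𝓝[{p | p.1 ≠ p.2}] (x, x))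
      (𝓝 (C * d.form (v x) (v x))) := by
  have h2 : Tendsto (fun p : ℝ × ℝ => (v p.2, v p.1)) (𝓝 (x, x)) (𝓝 (v x, v x)) :=
    (Tendsto.prodMk_nhds (hv.tendsto.comp (continuous_snd.tendsto (x, x)))
      (hv.tendsto.comp (continuous_fst.tendsto (x, x))))
  exact (((d.continuous_form.tendsto (v x, v x)).comp h2).const_mul C).mono_left nhdsWithin_le_nhds

/-! ### The four kernels. -/

/-- The columns and the vector at a point of `E` or `J`, in terms of boundary data. -/
structure IsShore (x : ℝ) (u w : Fin 2 → ℝ) (v : d.Idx → ℝ) : Prop where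
  exists_data : ∃ σ ρ D m ψ : ℝ, d.IsBoundaryData x σ ρ D m ∧
    u = hatCol m ρ σ (d.angle x) d.alpha ψ ∧ w = breveCol m ρ σ (d.angle x) d.alpha ψ ∧
    v = d.boundaryVec D σ ψ x
  ne_b : ∀ j ∈ Finset.Icc 1 d.n, x ≠ d.b j

theorem isShore_E {x : ℝ} (hx : x ∈ interior d.E) (lam : ℝ) :
    d.IsShore x (d.hatE lam x) (d.breveE lam x) (d.hvec lam x) := by
  obtain ⟨i, hi, he, hxi⟩ := d.exists_even_of_mem_interior_E hx
  have h := d.isBoundaryData_of_mem_Ioo hi hxi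
  rw [he.neg_one_pow] at h
  exact ⟨⟨_, _, _, _, _, h, d.hatE_eq hi he hxi lam, d.breveE_eq hi he hxi lam,
    d.hvec_eq hi he hxi lam⟩, fun j hj => d.ne_b_of_mem_Ioo hi hxi (Finset.mem_Icc.mp hj).1
      (Finset.mem_Icc.mp hj).2⟩

theorem isShore_J {x : ℝ} (hx : x ∈ interior d.J) (lam : ℝ) :
    d.IsShore x (d.hatJ lam x) (d.breveJ lam x) (d.fvec lam x) := by
  obtain ⟨i, hi, he, hxi⟩ := d.exists_odd_of_mem_interior_J hx
  have h := d.isBoundaryData_of_mem_Ioo hi hxi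
  rw [he.neg_one_pow] at h
  exact ⟨⟨_, _, _, _, _, h, d.hatJ_eq hi he hxi lam, d.breveJ_eq hi he hxi lam,
    d.fvec_eq hi he hxi lam⟩, fun j hj => d.ne_b_of_mem_Ioo hi hxi (Finset.mem_Icc.mp hj).1
      (Finset.mem_Icc.mp hj).2⟩

variable {d}

/-- `IsShore` does not record whether the point lies in E or in J, so one identity serves all four
kernels. -/
theorem IsShore.colDet_eq {x y : ℝ} {u w u' w' : Fin 2 → ℝ} {v v' : d.Idx → ℝ}
    (hx : d.IsShore x u w v) (hy : d.IsShore y u' w' v') :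
    colDet u' w - colDet u w' = (x - y) * dotProduct v' (d.M.mulVec v) := by
  obtain ⟨⟨σ, ρ, D, m, ψ, h, rfl, rfl, rfl⟩, hb⟩ := hx
  obtain ⟨⟨σ', ρ', D', m', ψ', h', rfl, rfl, rfl⟩, hb'⟩ := hy
  exact d.colDet_boundary_eq d.alpha_eq ψ ψ' h h' hb hb'

theorem IsShore.div_eq {x y : ℝ} {u w u' w' : Fin 2 → ℝ} {v v' : d.Idx → ℝ}
    (hx : d.IsShore x u w v) (hy : d.IsShore y u' w' v') (hne : x ≠ y) :
    ((colDet u' w - colDet u w' : ℝ) : ℂ) / ((Complex.I * π / 4) * ((x : ℂ) - y)) =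
      d.form v' v := by
  have h1 : (x : ℂ) - y ≠ 0 := sub_ne_zero.mpr (by exact_mod_cast hne)
  have h2 : (π : ℂ) ≠ 0 := by exact_mod_cast Real.pi_ne_zero
  have h3 := Complex.I_ne_zero
  rw [hx.colDet_eq hy, form]
  push_cast
  field_simp

/-- The sign of a nonzero real is ±1, hence its own inverse. -/
theorem div_sign_mul {lam : ℝ} (hlam : lam ≠ 0) (N A B : ℂ) :
    N / ((Real.sign lam : ℂ) * A * B) = (Real.sign lam : ℂ) * (N / (A * B)) := by
  rcases Real.sign_apply_eq_of_ne_zero lam hlam with h | h <;> rw [h]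
  · push_cast
    rw [neg_one_mul, neg_mul, div_neg, neg_one_mul]
  · push_cast
    rw [one_mul, one_mul]

end Config

end JumpKernel

end

theorem theorem4p6 (d : JumpKernel.Config) (lam : ℝ) (hlam : lam ∈ Icc (-1 : ℝ) 1 \ {0}) :
    -- both variables in the interior of `E`, off the diagonal and on it
    (∀ x ∈ interior d.E, ∀ y ∈ interior d.E, x ≠ y →
      d.REE lam x y = (Real.sign lam : ℂ) * d.form (d.hvec lam y) (d.hvec lam x)) ∧
    (∀ x ∈ interior d.E,
      Tendsto (fun p : ℝ × ℝ => d.REE lam p.1 p.2) (𝓝[{p | p.1 ≠ p.2}] (x, x))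
        (𝓝 ((Real.sign lam : ℂ) * d.form (d.hvec lam x) (d.hvec lam x)))) ∧
    -- the mixed cases
    (∀ x ∈ interior d.E, ∀ y ∈ interior d.J,
      d.REJ lam x y = d.form (d.fvec lam y) (d.hvec lam x)) ∧
    (∀ x ∈ interior d.J, ∀ y ∈ interior d.E,
      d.RJE lam x y = d.form (d.hvec lam y) (d.fvec lam x)) ∧
    -- both variables in the interior of `J`, off the diagonal and on it
    (∀ x ∈ interior d.J, ∀ y ∈ interior d.J, x ≠ y →
      d.RJJ lam x y = (Real.sign lam : ℂ) * d.form (d.fvec lam y) (d.fvec lam x)) ∧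
    (∀ x ∈ interior d.J,
      Tendsto (fun p : ℝ × ℝ => d.RJJ lam p.1 p.2) (𝓝[{p | p.1 ≠ p.2}] (x, x))
        (𝓝 ((Real.sign lam : ℂ) * d.form (d.fvec lam x) (d.fvec lam x)))) := by
  have h0 : lam ≠ 0 := hlam.2
  have hEE : ∀ x ∈ interior d.E, ∀ y ∈ interior d.E, x ≠ y →
      d.REE lam x y = (Real.sign lam : ℂ) * d.form (d.hvec lam y) (d.hvec lam x) :=
    fun x hx y hy hne => by
      rw [JumpKernel.Config.REE, JumpKernel.Config.div_sign_mul h0,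
        (d.isShore_E hx lam).div_eq (d.isShore_E hy lam) hne]
  have hJJ : ∀ x ∈ interior d.J, ∀ y ∈ interior d.J, x ≠ y →
      d.RJJ lam x y = (Real.sign lam : ℂ) * d.form (d.fvec lam y) (d.fvec lam x) :=
    fun x hx y hy hne => by
      rw [JumpKernel.Config.RJJ, JumpKernel.Config.div_sign_mul h0,
        (d.isShore_J hx lam).div_eq (d.isShore_J hy lam) hne]
  -- The interiors of E and J are disjoint, so the mixed kernels have no diagonal.
  have hne : ∀ x ∈ interior d.E, ∀ y ∈ interior d.J, x ≠ y := by
    rintro x hx y hy rfl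
    obtain ⟨i, hi, he, hxi⟩ := d.exists_even_of_mem_interior_E hx
    obtain ⟨j, hj, ho, hxj⟩ := d.exists_odd_of_mem_interior_J hy
    rw [d.eq_of_mem_Icc_of_mem_Ioo hi hj (Ioo_subset_Icc_self hxi) hxj] at he
    exact (Nat.not_even_iff_odd.mpr ho) he
  -- Near an interior point both variables stay in the set, so the off-diagonal formula determines
  -- the limit.
  have hev : ∀ S : Set ℝ, ∀ x ∈ interior S, ∀ᶠ p : ℝ × ℝ in 𝓝[{p | p.1 ≠ p.2}] (x, x),
      p.1 ∈ interior S ∧ p.2 ∈ interior S ∧ p.1 ≠ p.2 := fun S x hx => by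
    have h := (isOpen_interior.prod isOpen_interior).mem_nhds
      (show (x, x) ∈ interior S ×ˢ interior S from ⟨hx, hx⟩)
    filter_upwards [mem_nhdsWithin_of_mem_nhds h, self_mem_nhdsWithin] with p hp hp'
    exact ⟨hp.1, hp.2, hp'⟩
  refine ⟨hEE, fun x hx => ?_, fun x hx y hy => ?_, fun x hx y hy => ?_, hJJ, fun x hx => ?_⟩
  · refine (d.tendsto_form_diag (d.continuousAt_hvec hx lam) _).congr' ?_
    filter_upwards [hev _ x hx] with p hp
    exact (hEE _ hp.1 _ hp.2.1 hp.2.2).symm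
  · exact (d.isShore_E hx lam).div_eq (d.isShore_J hy lam) (hne x hx y hy)
  · exact (d.isShore_J hx lam).div_eq (d.isShore_E hy lam) (hne y hy x hx).symm
  · refine (d.tendsto_form_diag (d.continuousAt_fvec hx lam) _).congr' ?_
    filter_upwards [hev _ x hx] with p hp
    exact (hJJ _ hp.1 _ hp.2.1 hp.2.2).symm
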